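/- All codes are binary linear codes of length $68$, i.e. subspaces of $\mathbb F_2^{68}$; $C^\perp$ is the dual for the standard inner product, and $C$ is self-dual if $C=C^\perp$. A self-dual code of length $n$ is extremal if its minimum distance equals $4\lfloor n/24\rfloor+4$ (or $4\lfloor n/24\rfloor+6$ if $n\equiv 22 \pmod{24}$ and $C$ is not doubly even); for $n=68$ this means that $C$ is a $[68,34,12]$ code. Two self-dual codes of length $n$ are neighbours if their intersection has dimension $n/2-1$; for a self-dual code $C$ and $x\in\mathbb F_2^{n}\setminus C$ of even weight, $\langle\langle x\rangle^\perp\cap C,\,x\rangle$ is a neighbour of $C$. The weight enumerator of $C$ is $\sum_w A_w y^w$, with $A_w$ the number of codewords of weight $w$. For integers $\beta,\gamma$ put $$\begin{aligned}W_{68,2}(\beta,\gamma)={}&1+y^{68}+(442+4\beta)(y^{12}+y^{56})+(14960-8\beta-256\gamma)(y^{14}+y^{54})\\&+(174471-36\beta+2048\gamma)(y^{16}+y^{52})+(1478048+80\beta-5632\gamma)(y^{18}+y^{50})\\&+(9546537+140\beta+2048\gamma)(y^{20}+y^{48})+(46699952-360\beta+21248\gamma)(y^{22}+y^{46})\\&+(175078410-300\beta-40960\gamma)(y^{24}+y^{44})+(509477760+960\beta-2048\gamma)(y^{26}+y^{42})\\&+(1160564636+360\beta+90112\gamma)(y^{28}+y^{40})+(2081169376-1680\beta-86528\gamma)(y^{30}+y^{38})\\&+(2949602799-168\beta-53248\gamma)(y^{32}+y^{36})+(3312254400+2016\beta+146432\gamma)y^{34}.\end{aligned}$$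 Let $\mathcal N_{(0)}$ be the code with generator matrix $(I_{34}\mid A)$, for the explicit $34\times34$ matrix $A$ listed under (D1). Number the coordinates $1,\dots,68$. For $k=0,1,2,3,4$ let $(p_k,q_k)=(35,36),(34,36),(35,34),(26,35),(36,35)$, and for a string $b=b_1\dots b_{34}$ of bits let $v_k(b)\in\mathbb F_2^{68}$ be the vector with entries $b_1$ at $p_k$, $b_2$ at $q_k$, $b_j$ at $34+j$ for $3\le j\le 34$, and $0$ elsewhere. For $i=0,1,2,3$ let $x_i=v_i(b)$ for the $i$-th string under (D2), and $\mathcal N_{(i+1)}=\langle\langle x_i\rangle^\perp\cap\mathcal N_{(i)},\,x_i\rangle$. For $k=0,\dots,4$ and each string $b$ in the $k$-th list under (D3) consider the code $\langle\langle v_k(b)\rangle^\perp\cap\mathcal N_{(k)},\,v_k(b)\rangle$; there are $7+26+18+38+51=140$ such strings. Each string under (D2) and (D3) is preceded by a pair $(\gamma,\beta)$. Then: 1. $\mathcal N_{(0)}$ is an extremal self-dual $[68,34,12]$ code with weight enumerator $W_{68,2}(213,5)$. 2. For $i=0,1,2,3$: $x_i\notin\mathcal N_{(i)}$, $\mathcal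 N_{(i+1)}$ is a neighbour of $\mathcal N_{(i)}$, and $\mathcal N_{(i+1)}$ is an extremal self-dual $[68,34,12]$ code with weight enumerator $W_{68,2}(\beta,\gamma)$ for the pair listed under (D2), namely $(\gamma,\beta)=(6,210),(7,212),(8,221),(9,221)$. 3. For each $k$ and each string $b$ of the $k$-th list: $v_k(b)\notin\mathcal N_{(k)}$, and the code defined by $b$ is a neighbour of $\mathcal N_{(k)}$ and an extremal self-dual $[68,34,12]$ code with weight enumerator $W_{68,2}(\beta,\gamma)$ for the listed pair. 4. Let $\mathcal S$ consist of $\mathcal N_{(2)},\mathcal N_{(3)},\mathcal N_{(4)}$ and the codes of part 3. Then $\mathcal S$ has exactly $143$ elements, and they have $143$ different weight enumerators. Each of these is of the form $W_{68,2}(\beta,\gamma)$, and the pairs $(\gamma,\beta)$ that occur are exactly: - $\gamma=5$: $\beta\in\{195,198,200,202,211\}$; - $\gamma=6$: $\beta\in\{175,177,179,181,182,183,185,\dots,191,193,\dots,202,204,206,207\}$; - $\gamma=7$: $\beta\in\{163,166,169,\dots,174,176,\dots,181,183,\dots,188,190,\dots,195,197,198,199,212\}$; - $\gamma=8$: $180\le\beta\le221$;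 - $\gamma=9$: $186\le\beta\le230$, $\beta\notin\{191,197,212,227,229\}$. In particular exactly $42$ codes in $\mathcal S$ have $\gamma=8$ and exactly $40$ have $\gamma=9$. 5. The integers $\gamma$ for which there are an extremal self-dual $[68,34,12]$ code $C$ and an integer $\beta$ such that $C$ has weight enumerator $W_{68,2}(\beta,\gamma)$ are exactly $0,1,\dots,9$. (D1) The rows of $A$: `0001000111101111110011110101000110`, `0110001001111010100001101000110010`, `0100101011010000101101111010000001`, `1000010100011111101101000110001110`, `0010111001111000101110101000000111`, `0001110110110100011101010100001011`, `0110100000110111101000110010100100`, `1001010011000100100111000010010100`, `1010010101100000010100100000101011`, `1110100111111010001001111110101111`, `1100111011100011011100110111010110`, `0111111001000110111110100110011101`, `1101100001001010111100010101100101`, `1001011100010000101110110111101110`, `1101001001111010000101001101011001`, `1001001000100000011000010011010010`, `1111101100011100100111001110010111`, `1000010010111001001001010000011111`, `0011111001111101010001110011100010`, `0011110110111110100010110011010001`, `1000100100010100100111010010010001`, `1111010101000010111010001111011010`, `1110101011110100001100010101011011`, `1010011001101101011110110111010011`, `0110100001000010100001001111111111`, `1001010001111110100001111100110011`, `0011001101110101101111011001011011`,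 `1000000000101111001101111011010011`, `0100001011001100001000001100111010`, `0100000100110011110111111111111001`, `0001010011010110010001101010110001`, `1001101101111100110000001000000110`, `1101110011100101111001111111100101`, `0010110011011010110110111111011010`. (D2) $(6,210)$: `1100000101101111011001110100000100`; $(7,212)$: `0111111111110110010100110111001100`; $(8,221)$: `0111010010010101001000101110011001`; $(9,221)$: `1000000111110011101001110001110000`. (D3) - $k=0$: $(5,195)$: `1001100000010100010100001111100011`; $(5,198)$: `1000010001011010000011010000011010`; $(5,200)$: `0111101000110110001011101100010000`; $(5,202)$: `0111001101010010011001000101101010`; $(5,211)$: `0100101101000111111110110101110111`; $(6,198)$: `0011011100110001100010000000100100`; $(6,204)$: `0111011111101001111101101111001000`. - $k=1$: $(6,175)$: `1001010111010111110011100111000011`; $(6,177)$: `0001011110111110011101001111111100`; $(6,179)$: `1011110110111010111010010111101111`; $(6,181)$: `1011011001101100010101001010001111`; $(6,182)$: `0111001000010101110001001100111100`; $(6,183)$: `0111111111011111101100100100001110`; $(6,185)$: `1011111001001110011110000010100011`; $(6,186)$: `1010100011111100010011111101001101`; $(6,187)$: `1011010111110011001011000100111011`; $(6,188)$: `0011110011110111111101101100110100`;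 $(6,189)$: `0000000010010101010011001010001011`; $(6,190)$: `1011101110011101111110100101011100`; $(6,191)$: `1111000000010110001111001111010101`; $(6,193)$: `1010111010101011100011100011001111`; $(6,194)$: `1000001101010100110101000011000101`; $(6,195)$: `0101011110100101000000011010001111`; $(6,196)$: `1111011101111101110110100010000111`; $(6,197)$: `1111011010010110011101100001000110`; $(6,199)$: `1011110001001000100001000110100000`; $(6,200)$: `1001010010110100100000001100000101`; $(6,201)$: `1010010010100011111100011100111010`; $(6,202)$: `0100010011101100010110001010110000`; $(6,206)$: `0100100000011110000010011000010110`; $(6,207)$: `0001110111010001111011010001011111`; $(7,184)$: `0010110010011001111110101000011110`; $(7,185)$: `0011001100100010111110000000011001`. - $k=2$: $(7,174)$: `1101111111101111011110011101101110`; $(7,177)$: `1001101001000111010110110111111111`; $(7,178)$: `1011010010001010111100010010000100`; $(7,179)$: `1101111001010110110111010110001111`; $(7,181)$: `1011101100100101100110111101101111`; $(7,183)$: `1001111111011111110110010001001110`; $(7,186)$: `1101010001010110001001111001100010`; $(7,187)$: `0110111111000000011011000001110001`; $(7,188)$: `0010011000010000000011111111111010`; $(7,190)$: `1001101101101011111111010100101101`;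 $(7,191)$: `0110000001011010011001111110100010`; $(7,192)$: `1011000011111010100011111011100011`; $(7,193)$: `0100001110010111010110101010011110`; $(7,194)$: `0000001101111110100001100001000000`; $(7,195)$: `0100110110001011101001011000110001`; $(7,197)$: `1111010100000010111100100101110101`; $(7,198)$: `1100100000001001100110010111111111`; $(7,199)$: `0000110011100001111010110100110001`. - $k=3$: $(7,171)$: `0101000010100010000111100101011100`; $(7,173)$: `0000011101001011001010111100001110`; $(7,176)$: `0000011101101010010000110000101000`; $(7,180)$: `1011010010100001010000111011100110`; $(8,181)$: `1011110011111111111100111110100111`; $(8,186)$: `1101111111010111111111100010110111`; $(8,187)$: `0000110100100011011001001101111010`; $(8,189)$: `1101000111000011001010010001000000`; $(8,190)$: `0000001011100100110100101111000100`; $(8,192)$: `0111011011011011010010101101100011`; $(8,191)$: `0011011011110001000111111111011110`; $(8,193)$: `1010111011000111100110111001110111`; $(8,194)$: `0010010011101001110101011010111100`; $(8,195)$: `0001001001010000111101111001110111`; $(8,196)$: `0001101011101101100010111110110011`; $(8,197)$: `0100100001010000001010001111100010`; $(8,198)$: `1011100101000101100011110111101011`; $(8,199)$: `0011011111101011011011111011110011`;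 $(8,200)$: `1111000101100111100010101010000001`; $(8,201)$: `0011000110010100110010000110000001`; $(8,202)$: `1110101001000010010100101000011100`; $(8,203)$: `0110111010011110110001011011101001`; $(8,204)$: `1001100101111110111101011001101110`; $(8,205)$: `0000100111111101000010110011001001`; $(8,206)$: `1011001000010010011100101011000100`; $(8,207)$: `0101111110001111110000111111111011`; $(8,208)$: `0110101010100001110101011010110110`; $(8,209)$: `0001111000110101011111001111101111`; $(8,210)$: `1111011101111110000011100111111011`; $(8,211)$: `1101010100000100000001110100010001`; $(8,212)$: `0011110101110001000001111001110000`; $(8,213)$: `1100011110110111110101000101011111`; $(8,214)$: `0101011001011011111001010100001000`; $(8,215)$: `0000011110101100110001010101100011`; $(8,216)$: `1110100101011111001101011011011110`; $(8,217)$: `0001111000001111100010100011011010`; $(8,218)$: `1110011000000010100101000101010110`; $(8,220)$: `0100011111001011000000000010000011`. - $k=4$: $(7,163)$: `0110011110100110101110111111001110`; $(7,166)$: `1010011101011110101011111111011110`; $(7,169)$: `1001110111100010010000100001111010`; $(7,170)$: `0011101011111100101001110010011011`; $(7,172)$: `1101101101010111100010000101001101`; $(8,180)$: `1001001100010110100011110011101101`;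 $(8,182)$: `0110000111110011101010000111110111`; $(8,183)$: `1110000100101011001100000100001101`; $(8,184)$: `1110111101111011001110111111010111`; $(8,185)$: `0111001000001101101001110011010010`; $(8,219)$: `0010010100101110111101101011111111`; $(8,188)$: `1101000000110100011000000110101000`; $(9,186)$: `0111101011001101101011010011001011`; $(9,187)$: `0001001011000000110111110000010110`; $(9,188)$: `1011011001100001001110011100101101`; $(9,189)$: `1000000111000110111000100010000001`; $(9,190)$: `1111010100111110101110110000011111`; $(9,192)$: `1000100000000111110001110000010010`; $(9,193)$: `0111011010010110011110110001000110`; $(9,194)$: `0010011100001000000010001111011000`; $(9,195)$: `0001101100111010100010011110101000`; $(9,196)$: `1000011011111111111010001110010001`; $(9,198)$: `0111010111111001111101011000101110`; $(9,199)$: `0101101101001100001001110011010010`; $(9,200)$: `1111011011111111111010100100111001`; $(9,201)$: `0011111100000101110110110111011111`; $(9,202)$: `0100111111101001101001110001101011`; $(9,203)$: `1111101111000110001100111111101100`; $(9,204)$: `0101111110001110100001110110011011`; $(9,205)$: `0111110111111110111101000001110100`; $(9,206)$: `1110110111101011000110100111111100`; $(9,207)$: `0000000111010010100010010001011001`; $(9,208)$: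 `0001001101110101011111001000101101`; $(9,209)$: `0100001111001011001010000111010011`; $(9,210)$: `0101000110111111010111000111000100`; $(9,211)$: `0110110111011011011110111101001100`; $(9,213)$: `0001110001110001001001110010111010`; $(9,214)$: `0001010100001110010110011101111101`; $(9,215)$: `0101010110001011110111000001101110`; $(9,216)$: `0010011111011010100011110101011011`; $(9,217)$: `0111100100111001111101100111110101`; $(9,218)$: `1101110110110011011001111111011011`; $(9,219)$: `1101011010110011000111101000101100`; $(9,220)$: `0110101110111110101011011111101011`; $(9,222)$: `1110000011001101000110000000101110`; $(9,223)$: `1001111010110000000101110100000100`; $(9,224)$: `1001000111100111010011111100111001`; $(9,225)$: `1011111011110111101111011111011100`; $(9,226)$: `0011111100110101110101101110110101`; $(9,228)$: `1011010011100011110000011000001011`; $(9,230)$: `0101001011001111001010011001000011`. -/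

import Mathlib

open Polynomial

/-- Binary linear codes of length `n`. -/
abbrev BinaryCode (n : ℕ) := Submodule (ZMod 2) (Fin n → ZMod 2)

namespace BinaryCode

variable {n : ℕ}

/-- The dual code, with respect to the standard inner product on `𝔽₂ⁿ`. -/
def dual (D : BinaryCode n) : BinaryCode n where
  carrier := {y | ∀ x ∈ D, y ⬝ᵥ x = 0}
  add_mem' := by
    intro a b ha hb x hx
    rw [add_dotProduct, ha x hx, hb x hx, add_zero]
  zero_mem' := by
    intro x _
    exact zero_dotProduct x
  smul_mem' := by
    intro c a ha x hx
    rw [smul_dotProduct, ha x hx, smul_zero]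

def IsSelfDual (D : BinaryCode n) : Prop := D = D.dual

/-- Doubly-even: all Hamming weights are divisible by 4. -/
def IsDoublyEven (D : BinaryCode n) : Prop := ∀ c ∈ D, 4 ∣ hammingNorm c

/-- The minimum distance, that is, the least weight of a nonzero codeword. -/
noncomputable def minDist (D : BinaryCode n) : ℕ :=
  sInf {w | ∃ c ∈ D, c ≠ 0 ∧ hammingNorm c = w}

open Classical in
/-- The general upper bound for the minimum distance of a self-dual code of length `n`
that is doubly even (Type II), respectively not doubly even (Type I). -/
noncomputable def distanceBound (D : BinaryCode n) : ℕ :=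
  if D.IsDoublyEven then 4 * (n / 24) + 4
  else if n % 24 = 22 then 4 * (n / 24) + 6
  else 4 * (n / 24) + 4

/-- Extremal self-dual codes: those whose minimum distance attains the bound. -/
def IsExtremal (D : BinaryCode n) : Prop :=
  D.IsSelfDual ∧ D.minDist = D.distanceBound

/-- `D` is an `[n, k, d]` code. -/
def HasParameters (D : BinaryCode n) (k d : ℕ) : Prop :=
  Module.finrank (ZMod 2) D = k ∧ D.minDist = d

/-- The number of codewords of weight `w`. -/
noncomputable def weightCount (D : BinaryCode n) (w : ℕ) : ℕ :=
  {c : Fin n → ZMod 2 | c ∈ D ∧ hammingNorm c = w}.ncard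

/-- The weight enumerator `∑ A_w y^w`. -/
noncomputable def weightEnumerator (D : BinaryCode n) : ℤ[X] :=
  ∑ w ∈ Finset.range (n + 1), C (D.weightCount w : ℤ) * X ^ w

/-- Two self-dual codes of length `n` are neighbours if their intersection has
dimension `n / 2 - 1`. -/
def AreNeighbours (D D' : BinaryCode n) : Prop :=
  D.IsSelfDual ∧ D'.IsSelfDual ∧
    2 * (Module.finrank (ZMod 2) (D ⊓ D' : BinaryCode n) + 1) = n

/-- The code `⟨⟨x⟩^⊥ ∩ D, x⟩`. -/
def neighbourBy (D : BinaryCode n) (x : Fin n → ZMod 2) : BinaryCode n :=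
  (dual (Submodule.span (ZMod 2) {x}) ⊓ D) ⊔ Submodule.span (ZMod 2) {x}

end BinaryCode

/-- The weight enumerator `W_{68,2}` with parameters `β` and `γ`, written out in full:
the coefficients of `y^w` and `y^(68-w)` agree. -/
noncomputable def W682 (β γ : ℤ) : ℤ[X] :=
  (1 + X ^ 68)
  + C (442 + 4 * β) * (X ^ 12 + X ^ 56)
  + C (14960 - 8 * β - 256 * γ) * (X ^ 14 + X ^ 54)
  + C (174471 - 36 * β + 2048 * γ) * (X ^ 16 + X ^ 52)
  + C (1478048 + 80 * β - 5632 * γ) * (X ^ 18 + X ^ 50)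
  + C (9546537 + 140 * β + 2048 * γ) * (X ^ 20 + X ^ 48)
  + C (46699952 - 360 * β + 21248 * γ) * (X ^ 22 + X ^ 46)
  + C (175078410 - 300 * β - 40960 * γ) * (X ^ 24 + X ^ 44)
  + C (509477760 + 960 * β - 2048 * γ) * (X ^ 26 + X ^ 42)
  + C (1160564636 + 360 * β + 90112 * γ) * (X ^ 28 + X ^ 40)
  + C (2081169376 - 1680 * β - 86528 * γ) * (X ^ 30 + X ^ 38)
  + C (2949602799 - 168 * β - 53248 * γ) * (X ^ 32 + X ^ 36)
  + C (3312254400 + 2016 * β + 146432 * γ) * X ^ 34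

/-- The `j`-th digit, counted from the left and from `j = 0`, of the 34-digit binary
string `b` (leading zeros included). -/
def bitAt (b : ℕ) (j : ℕ) : ZMod 2 := if b.testBit (33 - j) then 1 else 0

/-- The rows of the matrix `A`. -/
def rowsA : Fin 34 → ℕ :=
  ![0b0001000111101111110011110101000110,
    0b0110001001111010100001101000110010,
    0b0100101011010000101101111010000001,
    0b1000010100011111101101000110001110,
    0b0010111001111000101110101000000111,
    0b0001110110110100011101010100001011,
    0b0110100000110111101000110010100100,
    0b1001010011000100100111000010010100,
    0b1010010101100000010100100000101011,
    0b1110100111111010001001111110101111,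
    0b1100111011100011011100110111010110,
    0b0111111001000110111110100110011101,
    0b1101100001001010111100010101100101,
    0b1001011100010000101110110111101110,
    0b1101001001111010000101001101011001,
    0b1001001000100000011000010011010010,
    0b1111101100011100100111001110010111,
    0b1000010010111001001001010000011111,
    0b0011111001111101010001110011100010,
    0b0011110110111110100010110011010001,
    0b1000100100010100100111010010010001,
    0b1111010101000010111010001111011010,
    0b1110101011110100001100010101011011,
    0b1010011001101101011110110111010011,
    0b0110100001000010100001001111111111,
    0b1001010001111110100001111100110011,
    0b0011001101110101101111011001011011,
    0b1000000000101111001101111011010011,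
    0b0100001011001100001000001100111010,
    0b0100000100110011110111111111111001,
    0b0001010011010110010001101010110001,
    0b1001101101111100110000001000000110,
    0b1101110011100101111001111111100101,
    0b0010110011011010110110111111011010]

/-- The `i`-th row of the generator matrix `(I₃₄ | A)`. -/
def generatorRow (i : Fin 34) : Fin 68 → ZMod 2 := fun j =>
  if j.val < 34 then (if j.val = i.val then 1 else 0) else bitAt (rowsA i) (j.val - 34)

/-- The known code `𝒩₍₀₎`, generated by `(I₃₄ | A)`. -/
def knownCode : BinaryCode 68 := Submodule.span (ZMod 2) (Set.range generatorRow)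

/-- The last 34 coordinates of the standard form of the `k`-th code are, in this order, the
coordinates `p, q, 36, 37, …, 67` (numbered from 0) of the ambient space, where `(p, q)` is
given here. -/
def freePair : ℕ → ℕ × ℕ
  | 0 => (34, 35)
  | 1 => (33, 35)
  | 2 => (34, 33)
  | 3 => (25, 34)
  | _ => (35, 34)

/-- The vector whose entries in the last 34 coordinates of the standard form of the `k`-th
code are the digits of `b`, and which is zero elsewhere. -/
def searchVector (k b : ℕ) : Fin 68 → ZMod 2 := fun i =>
  if i.val = (freePair k).1 then bitAt b 0
  else if i.val = (freePair k).2 then bitAt b 1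
  else if 36 ≤ i.val then bitAt b (i.val - 34)
  else 0

/-- A line of a table: the digits of the vector and the values of `γ` and `β`. -/
structure TableEntry where
  bits : ℕ
  gamma : ℤ
  beta : ℤ

/-- The vectors `x₀, …, x₃`, with the parameters of `𝒩₍₁₎, …, 𝒩₍₄₎`. -/
def chainTable : Fin 4 → TableEntry :=
  ![
   ⟨0b1100000101101111011001110100000100, 6, 210⟩,
   ⟨0b0111111111110110010100110111001100, 7, 212⟩,
   ⟨0b0111010010010101001000101110011001, 8, 221⟩,
   ⟨0b1000000111110011101001110001110000, 9, 221⟩]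

/-- The iterated neighbours: `𝒩₍ᵢ₊₁₎ = ⟨⟨xᵢ⟩^⊥ ∩ 𝒩₍ᵢ₎, xᵢ⟩` for `i < 4`. -/
def chainCode : ℕ → BinaryCode 68
  | 0 => knownCode
  | i + 1 => (chainCode i).neighbourBy
      (searchVector i (if h : i < 4 then (chainTable ⟨i, h⟩).bits else 0))

/-- Neighbours of `𝒩₍0₎`. -/
def neighbourTable0 : List TableEntry :=
  [
   ⟨0b1001100000010100010100001111100011, 5, 195⟩,
   ⟨0b1000010001011010000011010000011010, 5, 198⟩,
   ⟨0b0111101000110110001011101100010000, 5, 200⟩,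
   ⟨0b0111001101010010011001000101101010, 5, 202⟩,
   ⟨0b0100101101000111111110110101110111, 5, 211⟩,
   ⟨0b0011011100110001100010000000100100, 6, 198⟩,
   ⟨0b0111011111101001111101101111001000, 6, 204⟩]

/-- Neighbours of `𝒩₍1₎`. -/
def neighbourTable1 : List TableEntry :=
  [
   ⟨0b1001010111010111110011100111000011, 6, 175⟩,
   ⟨0b0001011110111110011101001111111100, 6, 177⟩,
   ⟨0b1011110110111010111010010111101111, 6, 179⟩,
   ⟨0b1011011001101100010101001010001111, 6, 181⟩,
   ⟨0b0111001000010101110001001100111100, 6, 182⟩,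
   ⟨0b0111111111011111101100100100001110, 6, 183⟩,
   ⟨0b1011111001001110011110000010100011, 6, 185⟩,
   ⟨0b1010100011111100010011111101001101, 6, 186⟩,
   ⟨0b1011010111110011001011000100111011, 6, 187⟩,
   ⟨0b0011110011110111111101101100110100, 6, 188⟩,
   ⟨0b0000000010010101010011001010001011, 6, 189⟩,
   ⟨0b1011101110011101111110100101011100, 6, 190⟩,
   ⟨0b1111000000010110001111001111010101, 6, 191⟩,
   ⟨0b1010111010101011100011100011001111, 6, 193⟩,
   ⟨0b1000001101010100110101000011000101, 6, 194⟩,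
   ⟨0b0101011110100101000000011010001111, 6, 195⟩,
   ⟨0b1111011101111101110110100010000111, 6, 196⟩,
   ⟨0b1111011010010110011101100001000110, 6, 197⟩,
   ⟨0b1011110001001000100001000110100000, 6, 199⟩,
   ⟨0b1001010010110100100000001100000101, 6, 200⟩,
   ⟨0b1010010010100011111100011100111010, 6, 201⟩,
   ⟨0b0100010011101100010110001010110000, 6, 202⟩,
   ⟨0b0100100000011110000010011000010110, 6, 206⟩,
   ⟨0b0001110111010001111011010001011111, 6, 207⟩,
   ⟨0b0010110010011001111110101000011110, 7, 184⟩,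
   ⟨0b0011001100100010111110000000011001, 7, 185⟩]

/-- Neighbours of `𝒩₍2₎`. -/
def neighbourTable2 : List TableEntry :=
  [
   ⟨0b1101111111101111011110011101101110, 7, 174⟩,
   ⟨0b1001101001000111010110110111111111, 7, 177⟩,
   ⟨0b1011010010001010111100010010000100, 7, 178⟩,
   ⟨0b1101111001010110110111010110001111, 7, 179⟩,
   ⟨0b1011101100100101100110111101101111, 7, 181⟩,
   ⟨0b1001111111011111110110010001001110, 7, 183⟩,
   ⟨0b1101010001010110001001111001100010, 7, 186⟩,
   ⟨0b0110111111000000011011000001110001, 7, 187⟩,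
   ⟨0b0010011000010000000011111111111010, 7, 188⟩,
   ⟨0b1001101101101011111111010100101101, 7, 190⟩,
   ⟨0b0110000001011010011001111110100010, 7, 191⟩,
   ⟨0b1011000011111010100011111011100011, 7, 192⟩,
   ⟨0b0100001110010111010110101010011110, 7, 193⟩,
   ⟨0b0000001101111110100001100001000000, 7, 194⟩,
   ⟨0b0100110110001011101001011000110001, 7, 195⟩,
   ⟨0b1111010100000010111100100101110101, 7, 197⟩,
   ⟨0b1100100000001001100110010111111111, 7, 198⟩,
   ⟨0b0000110011100001111010110100110001, 7, 199⟩]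

/-- Neighbours of `𝒩₍3₎`. -/
def neighbourTable3 : List TableEntry :=
  [
   ⟨0b0101000010100010000111100101011100, 7, 171⟩,
   ⟨0b0000011101001011001010111100001110, 7, 173⟩,
   ⟨0b0000011101101010010000110000101000, 7, 176⟩,
   ⟨0b1011010010100001010000111011100110, 7, 180⟩,
   ⟨0b1011110011111111111100111110100111, 8, 181⟩,
   ⟨0b1101111111010111111111100010110111, 8, 186⟩,
   ⟨0b0000110100100011011001001101111010, 8, 187⟩,
   ⟨0b1101000111000011001010010001000000, 8, 189⟩,
   ⟨0b0000001011100100110100101111000100, 8, 190⟩,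
   ⟨0b0111011011011011010010101101100011, 8, 192⟩,
   ⟨0b0011011011110001000111111111011110, 8, 191⟩,
   ⟨0b1010111011000111100110111001110111, 8, 193⟩,
   ⟨0b0010010011101001110101011010111100, 8, 194⟩,
   ⟨0b0001001001010000111101111001110111, 8, 195⟩,
   ⟨0b0001101011101101100010111110110011, 8, 196⟩,
   ⟨0b0100100001010000001010001111100010, 8, 197⟩,
   ⟨0b1011100101000101100011110111101011, 8, 198⟩,
   ⟨0b0011011111101011011011111011110011, 8, 199⟩,
   ⟨0b1111000101100111100010101010000001, 8, 200⟩,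
   ⟨0b0011000110010100110010000110000001, 8, 201⟩,
   ⟨0b1110101001000010010100101000011100, 8, 202⟩,
   ⟨0b0110111010011110110001011011101001, 8, 203⟩,
   ⟨0b1001100101111110111101011001101110, 8, 204⟩,
   ⟨0b0000100111111101000010110011001001, 8, 205⟩,
   ⟨0b1011001000010010011100101011000100, 8, 206⟩,
   ⟨0b0101111110001111110000111111111011, 8, 207⟩,
   ⟨0b0110101010100001110101011010110110, 8, 208⟩,
   ⟨0b0001111000110101011111001111101111, 8, 209⟩,
   ⟨0b1111011101111110000011100111111011, 8, 210⟩,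
   ⟨0b1101010100000100000001110100010001, 8, 211⟩,
   ⟨0b0011110101110001000001111001110000, 8, 212⟩,
   ⟨0b1100011110110111110101000101011111, 8, 213⟩,
   ⟨0b0101011001011011111001010100001000, 8, 214⟩,
   ⟨0b0000011110101100110001010101100011, 8, 215⟩,
   ⟨0b1110100101011111001101011011011110, 8, 216⟩,
   ⟨0b0001111000001111100010100011011010, 8, 217⟩,
   ⟨0b1110011000000010100101000101010110, 8, 218⟩,
   ⟨0b0100011111001011000000000010000011, 8, 220⟩]

/-- Neighbours of `𝒩₍4₎`. -/
def neighbourTable4 : List TableEntry :=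
  [
   ⟨0b0110011110100110101110111111001110, 7, 163⟩,
   ⟨0b1010011101011110101011111111011110, 7, 166⟩,
   ⟨0b1001110111100010010000100001111010, 7, 169⟩,
   ⟨0b0011101011111100101001110010011011, 7, 170⟩,
   ⟨0b1101101101010111100010000101001101, 7, 172⟩,
   ⟨0b1001001100010110100011110011101101, 8, 180⟩,
   ⟨0b0110000111110011101010000111110111, 8, 182⟩,
   ⟨0b1110000100101011001100000100001101, 8, 183⟩,
   ⟨0b1110111101111011001110111111010111, 8, 184⟩,
   ⟨0b0111001000001101101001110011010010, 8, 185⟩,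
   ⟨0b0010010100101110111101101011111111, 8, 219⟩,
   ⟨0b1101000000110100011000000110101000, 8, 188⟩,
   ⟨0b0111101011001101101011010011001011, 9, 186⟩,
   ⟨0b0001001011000000110111110000010110, 9, 187⟩,
   ⟨0b1011011001100001001110011100101101, 9, 188⟩,
   ⟨0b1000000111000110111000100010000001, 9, 189⟩,
   ⟨0b1111010100111110101110110000011111, 9, 190⟩,
   ⟨0b1000100000000111110001110000010010, 9, 192⟩,
   ⟨0b0111011010010110011110110001000110, 9, 193⟩,
   ⟨0b0010011100001000000010001111011000, 9, 194⟩,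
   ⟨0b0001101100111010100010011110101000, 9, 195⟩,
   ⟨0b1000011011111111111010001110010001, 9, 196⟩,
   ⟨0b0111010111111001111101011000101110, 9, 198⟩,
   ⟨0b0101101101001100001001110011010010, 9, 199⟩,
   ⟨0b1111011011111111111010100100111001, 9, 200⟩,
   ⟨0b0011111100000101110110110111011111, 9, 201⟩,
   ⟨0b0100111111101001101001110001101011, 9, 202⟩,
   ⟨0b1111101111000110001100111111101100, 9, 203⟩,
   ⟨0b0101111110001110100001110110011011, 9, 204⟩,
   ⟨0b0111110111111110111101000001110100, 9, 205⟩,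
   ⟨0b1110110111101011000110100111111100, 9, 206⟩,
   ⟨0b0000000111010010100010010001011001, 9, 207⟩,
   ⟨0b0001001101110101011111001000101101, 9, 208⟩,
   ⟨0b0100001111001011001010000111010011, 9, 209⟩,
   ⟨0b0101000110111111010111000111000100, 9, 210⟩,
   ⟨0b0110110111011011011110111101001100, 9, 211⟩,
   ⟨0b0001110001110001001001110010111010, 9, 213⟩,
   ⟨0b0001010100001110010110011101111101, 9, 214⟩,
   ⟨0b0101010110001011110111000001101110, 9, 215⟩,
   ⟨0b0010011111011010100011110101011011, 9, 216⟩,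
   ⟨0b0111100100111001111101100111110101, 9, 217⟩,
   ⟨0b1101110110110011011001111111011011, 9, 218⟩,
   ⟨0b1101011010110011000111101000101100, 9, 219⟩,
   ⟨0b0110101110111110101011011111101011, 9, 220⟩,
   ⟨0b1110000011001101000110000000101110, 9, 222⟩,
   ⟨0b1001111010110000000101110100000100, 9, 223⟩,
   ⟨0b1001000111100111010011111100111001, 9, 224⟩,
   ⟨0b1011111011110111101111011111011100, 9, 225⟩,
   ⟨0b0011111100110101110101101110110101, 9, 226⟩,
   ⟨0b1011010011100011110000011000001011, 9, 228⟩,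
   ⟨0b0101001011001111001010011001000011, 9, 230⟩]

/-- The table of neighbours of `𝒩₍ₖ₎`. -/
def neighbourTable : Fin 5 → List TableEntry :=
  ![neighbourTable0, neighbourTable1, neighbourTable2, neighbourTable3, neighbourTable4]

/-- The neighbour of `𝒩₍ₖ₎` given by a line of its table. -/
def tableCode (k : Fin 5) (e : TableEntry) : BinaryCode 68 :=
  (chainCode k).neighbourBy (searchVector k e.bits)

/-- The new codes: `𝒩₍₂₎`, `𝒩₍₃₎`, `𝒩₍₄₎` and the codes in the tables of neighbours. -/
def newCodes : Set (BinaryCode 68) :=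
  {chainCode 2, chainCode 3, chainCode 4} ∪
    {D | ∃ k : Fin 5, ∃ e ∈ neighbourTable k, D = tableCode k e}

/-- The values of `β` that are attained by the new codes, for each value of `γ`. -/
noncomputable def newBetas (γ : ℤ) : Finset ℤ :=
  if γ = 5 then
    {195, 198, 200, 202, 211}
  else if γ = 6 then
    {175, 177, 179, 181, 182, 183, 185, 186, 187, 188, 189, 190, 191, 193, 194, 195,
      196, 197, 198, 199, 200, 201, 202, 204, 206, 207}
  else if γ = 7 then
    {163, 166, 169, 170, 171, 172, 173, 174, 176, 177, 178, 179, 180, 181, 183, 184,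
      185, 186, 187, 188, 190, 191, 192, 193, 194, 195, 197, 198, 199, 212}
  else if γ = 8 then Finset.Icc 180 221
  else if γ = 9 then Finset.Icc 186 230 \ {191, 197, 212, 227, 229}
  else ∅

/-! A self-dual code of length 68 without nonzero words of weight at most 10 has only even weights,
and since it contains the all-one word its weight distribution is symmetric under `w ↦ 68 - w`. Only
the twelve numbers `A₁₂, A₁₄, …, A₃₄` remain unknown. The MacWilliams identities for the code and
for its shadow (the vectors `u` with `u ⬝ᵥ c` equal to half the weight of `c` modulo 2) are linear
in these numbers. Once the shadow has `0`, `γ` and `β - 14γ` vectors of weights 2, 6 and 10, they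
force the weight enumerator `W682 β γ` (`weightCount_of_shadow`, `extremal_of_shadow`). So each code
requires only self-duality, the absence of words of weight at most 10, and three counts in the
shadow.

If `s` lies in the shadow of `D`, the shadow of the neighbour by `x` is the part of `(s + D) ∪ (s +
x + D)` cut out by one parity condition (`mem_shadow_neighbourBy`). Each base code is brought to the
form `(I | A)` with `A Aᵀ = 1`, where `x` and `s` vanish on the left half. A vector of weight at
most 10 has at most 5 ones on the left or at most 4 on the right, so it comes from a sum of at most
5 rows of `A` or at most 4 rows of `Aᵀ`. These sums depend only on the base code. They are stored as
base-128 digits of large numbers, so that a few arithmetic operations treat all of them at once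
(`extremal_of_standardCheck`, `extremal_of_neighbourCheck`), and the kernel evaluates the result.

Conversely `γ` is the number of shadow vectors of weight 6. Two of these sum to a codeword, so they
have disjoint supports; ten of them would sum to a codeword of weight 60, whose complement has
weight 8. Hence `0 ≤ γ ≤ 9`, and explicit codes attain every value. The 143 codes are distinct
because their parameters are, and `W682` determines its parameters. -/

namespace BinaryCode

variable {n : ℕ}

/-! ### Self-dual codes, half weights and the shadow. -/

theorem mem_dual {D : BinaryCode n} {y : Fin n → ZMod 2} :
    y ∈ D.dual ↔ ∀ x ∈ D, y ⬝ᵥ x = 0 := Iff.rfl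

theorem finrank_add_finrank_dual (D : BinaryCode n) :
    Module.finrank (ZMod 2) D + Module.finrank (ZMod 2) D.dual = n := by
  have h : D.dual = (D.dualAnnihilator).map
      (dotProductEquiv (ZMod 2) (Fin n)).symm.toLinearMap := by
    ext y
    rw [Submodule.mem_map_equiv]
    simp [mem_dual, Submodule.mem_dualAnnihilator]
  have h2 := Subspace.finrank_add_finrank_dualAnnihilator_eq D
  rw [h, LinearEquiv.finrank_map_eq]
  simpa using h2

theorem IsSelfDual.dotProduct_eq_zero {D : BinaryCode n} (hD : D.IsSelfDual)
    {x y : Fin n → ZMod 2} (hx : x ∈ D) (hy : y ∈ D) : x ⬝ᵥ y = 0 := by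
  rw [hD] at hx
  exact hx y hy

theorem IsSelfDual.mem_iff {D : BinaryCode n} (hD : D.IsSelfDual) {y : Fin n → ZMod 2} :
    y ∈ D ↔ ∀ x ∈ D, y ⬝ᵥ x = 0 := by
  conv_lhs => rw [hD]
  exact mem_dual

theorem IsSelfDual.two_mul_finrank {D : BinaryCode n} (hD : D.IsSelfDual) :
    2 * Module.finrank (ZMod 2) D = n := by
  have h := finrank_add_finrank_dual D
  rw [← hD] at h
  omega

/-- Self-dual codes are maximal among self-orthogonal ones, so a single inclusion identifies two of
them. -/
theorem IsSelfDual.eq_of_le {D D' : BinaryCode n} (hD : D.IsSelfDual) (hD' : D'.IsSelfDual)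
    (h : D ≤ D') : D = D' :=
  le_antisymm h fun _ hy => hD.mem_iff.2 fun _ hx => hD'.dotProduct_eq_zero hy (h hx)

theorem add_self_eq_zero (x : Fin n → ZMod 2) : x + x = 0 := by
  ext i; exact CharTwo.add_self_eq_zero _

theorem neg_eq_self (x : Fin n → ZMod 2) : -x = x := by
  ext i; exact CharTwo.neg_eq _

theorem dotProduct_self (x : Fin n → ZMod 2) : x ⬝ᵥ x = (hammingNorm x : ZMod 2) := by
  have : ∀ a : ZMod 2, a * a = if a ≠ 0 then 1 else 0 := by decide
  simp only [dotProduct, hammingNorm, this, Finset.sum_boole]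

theorem hammingNorm_eq_sum (x : Fin n → ZMod 2) : hammingNorm x = ∑ i, (x i).val := by
  have : ∀ a : ZMod 2, a.val = if a ≠ 0 then 1 else 0 := by decide
  simp only [hammingNorm, this, Finset.sum_boole, Nat.cast_id]

/-- The number `m` is the size of the intersection of the supports. -/
theorem hammingNorm_add (x y : Fin n → ZMod 2) :
    ∃ m : ℕ, hammingNorm (x + y) + 2 * m = hammingNorm x + hammingNorm y ∧
      (m : ZMod 2) = x ⬝ᵥ y := by
  refine ⟨∑ i, (x i * y i).val, ?_, ?_⟩
  · have : ∀ a b : ZMod 2, (a + b).val + 2 * (a * b).val = a.val + b.val := by decide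
    simp only [hammingNorm_eq_sum, Finset.mul_sum, ← Finset.sum_add_distrib, Pi.add_apply, this]
  · simp [dotProduct]

theorem even_hammingNorm_iff (x : Fin n → ZMod 2) : Even (hammingNorm x) ↔ x ⬝ᵥ x = 0 := by
  rw [dotProduct_self, ZMod.natCast_eq_zero_iff_even]

/-- Half of the Hamming weight, modulo `2`. -/
def halfWeight (x : Fin n → ZMod 2) : ZMod 2 := ((hammingNorm x / 2 : ℕ) : ZMod 2)

/-- Orthogonal vectors overlap in an even number of places, so the correction in the weight of the
sum is divisible by 4. Thus the half weight is a linear functional on a self-dual code. -/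
theorem halfWeight_add {x y : Fin n → ZMod 2} (hx : x ⬝ᵥ x = 0) (hy : y ⬝ᵥ y = 0)
    (hxy : x ⬝ᵥ y = 0) : halfWeight (x + y) = halfWeight x + halfWeight y := by
  obtain ⟨m, h1, h2⟩ := hammingNorm_add x y
  rw [hxy, ZMod.natCast_eq_zero_iff_even] at h2
  rw [← even_hammingNorm_iff] at hx hy
  obtain ⟨a, ha⟩ := hx
  obtain ⟨b, hb⟩ := hy
  obtain ⟨c, hc⟩ := h2
  simp only [halfWeight, ← Nat.cast_add]
  rw [ZMod.natCast_eq_natCast_iff, Nat.ModEq]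
  omega

theorem halfWeight_zero : halfWeight (0 : Fin n → ZMod 2) = 0 := by
  simp [halfWeight]

/-- The shadow of a self-dual code, as the set of characteristic vectors of the half weight. -/
def shadow (D : BinaryCode n) : Set (Fin n → ZMod 2) :=
  {u | ∀ c ∈ D, u ⬝ᵥ c = halfWeight c}

theorem IsSelfDual.add_mem_of_shadow {D : BinaryCode n} (hD : D.IsSelfDual)
    {u v : Fin n → ZMod 2} (hu : u ∈ D.shadow) (hv : v ∈ D.shadow) : u + v ∈ D := by
  rw [hD.mem_iff]
  intro c hc
  rw [add_dotProduct, hu c hc, hv c hc]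
  exact CharTwo.add_self_eq_zero _

/-- Over `𝔽₂` the products `x ⬝ᵥ x` and `1 ⬝ᵥ x` agree. -/
theorem IsSelfDual.one_mem {D : BinaryCode n} (hD : D.IsSelfDual) :
    (fun _ => 1 : Fin n → ZMod 2) ∈ D := by
  rw [hD.mem_iff]
  intro x hx
  have h := hD.dotProduct_eq_zero hx hx
  have : ∀ a : ZMod 2, a * a = 1 * a := by decide
  simpa [dotProduct, this] using h

/-! ### Neighbours and their shadows. -/

section Neighbour

variable {D : BinaryCode n} {x : Fin n → ZMod 2}

/-- The span of `x` is `{0, x}`, and `x ⬝ᵥ x = 0` lets the orthogonality condition pass between `y`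
and `y + x`. -/
theorem mem_neighbourBy (hx : x ⬝ᵥ x = 0) {y : Fin n → ZMod 2} :
    y ∈ D.neighbourBy x ↔ y ⬝ᵥ x = 0 ∧ (y ∈ D ∨ y + x ∈ D) := by
  have hd : ∀ z, z ∈ dual (Submodule.span (ZMod 2) {x}) ↔ z ⬝ᵥ x = 0 := by
    intro z
    rw [mem_dual]
    constructor
    · exact fun h => h x (Submodule.mem_span_singleton_self x)
    · intro h w hw
      obtain ⟨a, rfl⟩ := Submodule.mem_span_singleton.1 hw
      rw [dotProduct_smul, h, smul_zero]
  rw [neighbourBy, Submodule.mem_sup]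
  constructor
  · rintro ⟨z, ⟨hz1, hz2⟩, w, hw, rfl⟩
    obtain ⟨a, rfl⟩ := Submodule.mem_span_singleton.1 hw
    have hz3 := (hd z).1 hz1
    refine ⟨by rw [add_dotProduct, smul_dotProduct, hz3, hx, smul_zero, add_zero], ?_⟩
    have ha : ∀ a : ZMod 2, a = 0 ∨ a = 1 := by decide
    rcases ha a with rfl | rfl
    · left; simpa using hz2
    · right; rw [one_smul, add_assoc, add_self_eq_zero, add_zero]; exact hz2
  · rintro ⟨h1, h2 | h2⟩
    · exact ⟨y, ⟨(hd y).2 h1, h2⟩, 0, zero_mem _, add_zero y⟩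
    · refine ⟨y + x, ⟨(hd _).2 ?_, h2⟩, x, Submodule.mem_span_singleton_self x, ?_⟩
      · rw [add_dotProduct, h1, hx, add_zero]
      · rw [add_assoc, add_self_eq_zero, add_zero]

theorem isSelfDual_neighbourBy (hD : D.IsSelfDual) (hx : x ⬝ᵥ x = 0) :
    (D.neighbourBy x).IsSelfDual := by
  apply le_antisymm
  · intro y hy z hz
    rw [mem_neighbourBy hx] at hy hz
    obtain ⟨hy1, hy2⟩ := hy
    obtain ⟨hz1, hz2⟩ := hz
    have hz1' : x ⬝ᵥ z = 0 := by rw [dotProduct_comm]; exact hz1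
    rcases hy2 with hy2 | hy2 <;> rcases hz2 with hz2 | hz2 <;>
      have h := hD.dotProduct_eq_zero hy2 hz2 <;>
      simpa [add_dotProduct, dotProduct_add, hx, hy1, hz1'] using h
  · intro y hy
    rw [mem_neighbourBy hx]
    have hyx : y ⬝ᵥ x = 0 := hy x ((mem_neighbourBy hx).2
      ⟨hx, Or.inr (by rw [add_self_eq_zero]; exact zero_mem _)⟩)
    refine ⟨hyx, ?_⟩
    have hy' : ∀ z ∈ D, z ⬝ᵥ x = 0 → y ⬝ᵥ z = 0 := fun z hz hzx =>
      hy z ((mem_neighbourBy hx).2 ⟨hzx, Or.inl hz⟩)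
    -- On `D`, the functional `y` vanishes wherever `x` does. Hence it is zero or agrees with `x`,
    -- so `y` or `y + x` is orthogonal to `D`.
    by_cases h : ∀ z ∈ D, y ⬝ᵥ z = 0
    · exact Or.inl (hD.mem_iff.2 h)
    right
    push Not at h
    obtain ⟨z₀, hz₀, hne⟩ := h
    have two : ∀ a b : ZMod 2, a ≠ 0 → b ≠ 0 → a = b := by decide
    have hx0 : z₀ ⬝ᵥ x ≠ 0 := fun h => hne (hy' z₀ hz₀ h)
    rw [hD.mem_iff]
    intro z hz
    rw [add_dotProduct]
    by_cases hzx : z ⬝ᵥ x = 0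
    · rw [hy' z hz hzx, dotProduct_comm x, hzx, add_zero]
    · have h1 := hy' (z + z₀) (add_mem hz hz₀) (by
        rw [add_dotProduct, two _ _ hzx hx0]; exact CharTwo.add_self_eq_zero _)
      rw [dotProduct_add] at h1
      have h2 : y ⬝ᵥ z ≠ 0 := fun h => hne (by simpa [h] using h1)
      rw [dotProduct_comm x, two _ _ h2 hzx]
      exact CharTwo.add_self_eq_zero _

/-- On the subcode of `D` orthogonal to `x` the two half-weight functionals coincide, so `u + s`
vanishes there and is, as a functional on `D`, either zero or `x`. The value at `x` itself is the
remaining condition. -/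
theorem mem_shadow_neighbourBy (hD : D.IsSelfDual) (hx : x ⬝ᵥ x = 0) {s : Fin n → ZMod 2}
    (hs : s ∈ D.shadow) {u : Fin n → ZMod 2} :
    u ∈ (D.neighbourBy x).shadow ↔
      u ⬝ᵥ x = halfWeight x ∧ (u + s ∈ D ∨ u + (s + x) ∈ D) := by
  have hxm : x ∈ D.neighbourBy x := (mem_neighbourBy hx).2
      ⟨hx, Or.inr (by rw [add_self_eq_zero]; exact zero_mem _)⟩
  constructor
  · intro hu
    refine ⟨hu x hxm, ?_⟩
    have h0 : u + s ∈ D ∨ u + s + x ∈ D := by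
      by_cases hε : (u + s) ⬝ᵥ x = 0
      · have : u + s ∈ D.neighbourBy x := by
          rw [(isSelfDual_neighbourBy hD hx).mem_iff]
          intro c hc
          obtain ⟨h1, h2⟩ := (mem_neighbourBy hx).1 hc
          rcases h2 with h2 | h2
          · rw [add_dotProduct, hu c hc, hs c h2]
            exact CharTwo.add_self_eq_zero _
          · have hcc : c + x ∈ D.neighbourBy x := add_mem hc hxm
            have : c = (c + x) + x := by rw [add_assoc, add_self_eq_zero, add_zero]
            rw [this, dotProduct_add, hε, add_zero, add_dotProduct, hu _ hcc, hs _ h2]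
            exact CharTwo.add_self_eq_zero _
        exact ((mem_neighbourBy hx).1 this).2
      · have key : ∀ c ∈ D, c ⬝ᵥ x = 0 → (u + s) ⬝ᵥ c = 0 := by
          intro c hc hcx
          rw [add_dotProduct, hu c ((mem_neighbourBy hx).2 ⟨hcx, Or.inl hc⟩), hs c hc]
          exact CharTwo.add_self_eq_zero _
        by_cases h : ∀ c ∈ D, (u + s) ⬝ᵥ c = 0
        · exact Or.inl (hD.mem_iff.2 h)
        right
        push Not at h
        obtain ⟨z₀, hz₀, hne⟩ := h
        have two : ∀ a b : ZMod 2, a ≠ 0 → b ≠ 0 → a = b := by decide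
        have hx0 : z₀ ⬝ᵥ x ≠ 0 := fun h => hne (key z₀ hz₀ h)
        rw [hD.mem_iff]
        intro z hz
        rw [add_dotProduct]
        by_cases hzx : z ⬝ᵥ x = 0
        · rw [key z hz hzx, dotProduct_comm x, hzx, add_zero]
        · have h1 := key (z + z₀) (add_mem hz hz₀) (by
            rw [add_dotProduct, two _ _ hzx hx0]; exact CharTwo.add_self_eq_zero _)
          rw [dotProduct_add] at h1
          have h2 : (u + s) ⬝ᵥ z ≠ 0 := fun h => hne (by simpa [h] using h1)
          rw [dotProduct_comm x, two _ _ h2 hzx]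
          exact CharTwo.add_self_eq_zero _
    rwa [← add_assoc]
  · rintro ⟨h1, h2⟩
    have key : ∀ c ∈ D, c ⬝ᵥ x = 0 → u ⬝ᵥ c = halfWeight c := by
      intro c hc hcx
      rcases h2 with h2 | h2
      · have : u = (u + s) + s := by rw [add_assoc, add_self_eq_zero, add_zero]
        rw [this, add_dotProduct, hD.dotProduct_eq_zero h2 hc, zero_add, hs c hc]
      · have : u = (u + (s + x)) + (s + x) := by rw [add_assoc, add_self_eq_zero, add_zero]
        rw [this, add_dotProduct, hD.dotProduct_eq_zero h2 hc, zero_add, add_dotProduct,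
          hs c hc, dotProduct_comm x, hcx, add_zero]
    intro c hc
    obtain ⟨hc1, hc2 | hc2⟩ := (mem_neighbourBy hx).1 hc
    · exact key c hc2 hc1
    · have hcx : (c + x) ⬝ᵥ x = 0 := by rw [add_dotProduct, hc1, hx, add_zero]
      have : c = (c + x) + x := by rw [add_assoc, add_self_eq_zero, add_zero]
      rw [this, dotProduct_add, key _ hc2 hcx, h1,
        halfWeight_add (hD.dotProduct_eq_zero hc2 hc2) hx hcx]

/-- The intersection is proper because `x ∉ D`, and has codimension at most one because adjoining
`x` to it recovers the neighbour. -/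
theorem areNeighbours_neighbourBy (hD : D.IsSelfDual) (hx : x ⬝ᵥ x = 0) (hxD : x ∉ D) :
    AreNeighbours D (D.neighbourBy x) := by
  have hN := isSelfDual_neighbourBy hD hx
  refine ⟨hD, hN, ?_⟩
  have hxm : x ∈ D.neighbourBy x := (mem_neighbourBy hx).2
      ⟨hx, Or.inr (by rw [add_self_eq_zero]; exact zero_mem _)⟩
  have h1 := hD.two_mul_finrank
  have h2 := hN.two_mul_finrank
  have hlt : D ⊓ D.neighbourBy x < D := by
    refine lt_of_le_of_ne inf_le_left fun h => hxD ?_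
    rw [hD.eq_of_le hN (inf_eq_left.1 h)]
    exact hxm
  have h3 := Submodule.finrank_lt_finrank_of_lt hlt
  have h4 : D.neighbourBy x ≤ (D ⊓ D.neighbourBy x) ⊔ Submodule.span (ZMod 2) {x} := by
    refine sup_le_sup (le_inf inf_le_right ?_) le_rfl
    exact le_sup_left
  have h5 := Submodule.finrank_mono h4
  have h6 := Submodule.finrank_add_le_finrank_add_finrank (D ⊓ D.neighbourBy x)
    (Submodule.span (ZMod 2) {x})
  have h7 := finrank_span_le_card (R := ZMod 2) ({x} : Set (Fin n → ZMod 2))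
  rw [Set.toFinset_singleton, Finset.card_singleton] at h7
  omega

end Neighbour

/-! ### Characters and the MacWilliams identities for a code and its shadow. -/

/-- The nontrivial character of `ZMod 2`. -/
def sign (a : ZMod 2) : ℤ := if a = 0 then 1 else -1

theorem sign_add (a b : ZMod 2) : sign (a + b) = sign a * sign b := by
  revert a b; decide

theorem sign_sum {ι : Type*} (s : Finset ι) (f : ι → ZMod 2) :
    sign (∑ i ∈ s, f i) = ∏ i ∈ s, sign (f i) := by
  classical
  induction s using Finset.induction_on with
  | empty => rfl
  | insert a s ha ih => rw [Finset.sum_insert ha, Finset.prod_insert ha, sign_add, ih]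

open Classical in
/-- The words of a code, as a finite set. -/
noncomputable def words (D : BinaryCode n) : Finset (Fin n → ZMod 2) :=
  Finset.univ.filter (· ∈ D)

theorem mem_words {D : BinaryCode n} {c : Fin n → ZMod 2} : c ∈ D.words ↔ c ∈ D := by
  simp [words]

theorem card_words (D : BinaryCode n) :
    D.words.card = 2 ^ Module.finrank (ZMod 2) D := by
  classical
  have h := Module.card_eq_pow_finrank (K := ZMod 2) (V := D)
  rw [ZMod.card] at h
  rw [← h, words, Fintype.card_subtype]

/-- Translation by a word `c` with `φ c ≠ 0` permutes the code and changes the sign of every term.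
-/
theorem sum_sign_eq_zero {D : BinaryCode n} {φ : (Fin n → ZMod 2) → ZMod 2}
    (hφ : ∀ a ∈ D, ∀ b ∈ D, φ (a + b) = φ a + φ b) (h : ∃ c ∈ D, φ c ≠ 0) :
    ∑ c ∈ D.words, sign (φ c) = 0 := by
  obtain ⟨c, hc, hne⟩ := h
  have hs : sign (φ c) = -1 := if_neg hne
  have h1 : ∑ a ∈ D.words, sign (φ a) = ∑ a ∈ D.words, sign (φ (a + c)) := by
    refine Finset.sum_nbij' (· + c) (· + c) ?_ ?_ ?_ ?_ ?_
    · exact fun a ha => mem_words.2 (add_mem (mem_words.1 ha) hc)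
    · exact fun a ha => mem_words.2 (add_mem (mem_words.1 ha) hc)
    · exact fun a _ => by simp [add_assoc, add_self_eq_zero]
    · exact fun a _ => by simp [add_assoc, add_self_eq_zero]
    · exact fun a _ => by simp [add_assoc, add_self_eq_zero]
  have h2 : ∑ a ∈ D.words, sign (φ (a + c)) = -∑ a ∈ D.words, sign (φ a) := by
    rw [← Finset.sum_neg_distrib]
    refine Finset.sum_congr rfl fun a ha => ?_
    rw [hφ a (mem_words.1 ha) c hc, sign_add, hs, mul_neg_one]
  omega

theorem sum_sign_eq_card {D : BinaryCode n} {φ : (Fin n → ZMod 2) → ZMod 2}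
    (h : ∀ c ∈ D, φ c = 0) : ∑ c ∈ D.words, sign (φ c) = D.words.card := by
  rw [Finset.sum_congr rfl fun c hc => show sign (φ c) = 1 by rw [h c (mem_words.1 hc)]; rfl]
  simp

/-- Each summand is a product over the coordinates, so the sum factors: a coordinate contributes `1
- X` on the support of `c` and `1 + X` off it. -/
theorem sum_X_pow_hammingNorm (c : Fin n → ZMod 2) :
    ∑ u : Fin n → ZMod 2, C (sign (u ⬝ᵥ c)) * (X : ℤ[X]) ^ hammingNorm u =
      (1 - X) ^ hammingNorm c * (1 + X) ^ (n - hammingNorm c) := by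
  have h1 : ∀ u : Fin n → ZMod 2, C (sign (u ⬝ᵥ c)) * (X : ℤ[X]) ^ hammingNorm u =
      ∏ i, C (sign (u i * c i)) * X ^ (u i).val := by
    intro u
    rw [Finset.prod_mul_distrib, ← map_prod, ← sign_sum, Finset.prod_pow_eq_pow_sum,
      ← hammingNorm_eq_sum]
    rfl
  have h2 : ∀ i, ∑ a : ZMod 2, C (sign (a * c i)) * (X : ℤ[X]) ^ a.val =
      if c i ≠ 0 then 1 - X else 1 + X := by
    intro i
    have : ∀ b : ZMod 2, b = 0 ∨ b = 1 := by decide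
    rw [show (Finset.univ : Finset (ZMod 2)) = {0, 1} from rfl,
      Finset.sum_pair (by decide)]
    rcases this (c i) with h | h <;> rw [h] <;>
      simp [sign, ZMod.val_one, sub_eq_add_neg]
  rw [Finset.sum_congr rfl fun u _ => h1 u, ← Fintype.piFinset_univ,
    ← Finset.prod_univ_sum (fun _ => Finset.univ)
      (fun i (a : ZMod 2) => C (sign (a * c i)) * (X : ℤ[X]) ^ a.val)]
  rw [Finset.prod_congr rfl fun i _ => h2 i, Finset.prod_ite, Finset.prod_const,
    Finset.prod_const]
  congr 2
  have := Finset.card_filter_add_card_filter_not (s := (Finset.univ : Finset (Fin n)))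
    (fun i => c i ≠ 0)
  rw [Finset.card_univ, Fintype.card_fin] at this
  change _ = n - (Finset.univ.filter fun i => c i ≠ 0).card
  omega

open Classical in
/-- The MacWilliams identity for a coset of the dual code, given by an additive function. -/
theorem macWilliams {D : BinaryCode n} {φ : (Fin n → ZMod 2) → ZMod 2}
    (hφ : ∀ a ∈ D, ∀ b ∈ D, φ (a + b) = φ a + φ b) :
    C (D.words.card : ℤ) *
        ∑ u : Fin n → ZMod 2 with ∀ c ∈ D, u ⬝ᵥ c = φ c, (X : ℤ[X]) ^ hammingNorm u =
      ∑ c ∈ D.words, C (sign (φ c)) *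
        ((1 - X) ^ hammingNorm c * (1 + X) ^ (n - hammingNorm c)) := by
  simp_rw [← sum_X_pow_hammingNorm, Finset.mul_sum]
  -- For a fixed `u` the inner sum is the character sum of `u ⬝ᵥ c + φ c`. It equals the number of
  -- words if `u` represents `φ` on `D`, and 0 otherwise.
  rw [Finset.sum_comm, Finset.sum_filter]
  refine Finset.sum_congr rfl fun u _ => ?_
  have h1 : ∑ c ∈ D.words, C (sign (φ c)) * (C (sign (u ⬝ᵥ c)) * (X : ℤ[X]) ^ hammingNorm u) =
      C (∑ c ∈ D.words, sign (u ⬝ᵥ c + φ c)) * X ^ hammingNorm u := by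
    rw [map_sum, Finset.sum_mul]
    refine Finset.sum_congr rfl fun c _ => ?_
    rw [sign_add, C_mul]
    ring
  rw [h1]
  have hz : ∀ c, u ⬝ᵥ c = φ c ↔ u ⬝ᵥ c + φ c = 0 := fun c => by
    generalize u ⬝ᵥ c = a
    generalize φ c = b
    revert a b
    decide
  split_ifs with h
  · rw [sum_sign_eq_card (φ := fun c => u ⬝ᵥ c + φ c) fun c hc => (hz c).1 (h c hc)]
  · push Not at h
    obtain ⟨c, hc, hne⟩ := h
    rw [sum_sign_eq_zero (φ := fun c => u ⬝ᵥ c + φ c), C_0, zero_mul]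
    · intro a ha b hb
      rw [dotProduct_add, hφ a ha b hb]
      ring
    · exact ⟨c, hc, fun h0 => hne ((hz c).2 h0)⟩

/-- The number of vectors of weight `w` in a set of vectors. -/
noncomputable def weightCountOn (S : Set (Fin n → ZMod 2)) (w : ℕ) : ℕ :=
  {c : Fin n → ZMod 2 | c ∈ S ∧ hammingNorm c = w}.ncard

theorem coeff_sum_X_pow (s : Finset (Fin n → ZMod 2)) (j : ℕ) :
    (∑ u ∈ s, (X : ℤ[X]) ^ hammingNorm u).coeff j =
      (weightCountOn (s : Set (Fin n → ZMod 2)) j : ℤ) := by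
  classical
  have : {c : Fin n → ZMod 2 | c ∈ (s : Set (Fin n → ZMod 2)) ∧ hammingNorm c = j} =
      ((s.filter fun u => hammingNorm u = j : Finset _) : Set (Fin n → ZMod 2)) := by
    ext; simp
  rw [weightCountOn, this, Set.ncard_coe_finset, finsetSum_coeff]
  simp [coeff_X_pow, eq_comm]

theorem sum_words_eq (D : BinaryCode n) {M : Type*} [AddCommGroup M] (f : ℕ → M) :
    ∑ c ∈ D.words, f (hammingNorm c) =
      ∑ w ∈ Finset.range (n + 1), D.weightCount w • f w := by
  classical
  rw [← Finset.sum_fiberwise_of_maps_to (s := D.words) (t := Finset.range (n + 1))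
    (g := hammingNorm)]
  · refine Finset.sum_congr rfl fun w _ => ?_
    have : {c : Fin n → ZMod 2 | c ∈ D ∧ hammingNorm c = w} =
        ((D.words.filter fun u => hammingNorm u = w : Finset _) : Set (Fin n → ZMod 2)) := by
      ext; simp [mem_words]
    rw [weightCount, this, Set.ncard_coe_finset, ← Finset.sum_const]
    refine Finset.sum_congr rfl fun c hc => ?_
    rw [(Finset.mem_filter.1 hc).2]
  · intro c _
    rw [Finset.mem_range, Nat.lt_succ_iff]
    simpa using hammingNorm_le_card_fintype (x := c)

/-- The value at `w` of the Krawtchouk polynomial of degree `j` for length `n`. -/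
noncomputable def krawtchouk (n j w : ℕ) : ℤ :=
  ((1 - X : ℤ[X]) ^ w * (1 + X) ^ (n - w)).coeff j

/-- The case `φ = 0`, where self-duality turns the solution set back into `D`. -/
theorem IsSelfDual.macWilliams_weightCount {D : BinaryCode n} (hD : D.IsSelfDual) (j : ℕ) :
    (D.words.card : ℤ) * D.weightCount j =
      ∑ w ∈ Finset.range (n + 1), D.weightCount w * krawtchouk n j w := by
  classical
  have h := congrArg (fun p => coeff p j)
    (macWilliams (D := D) (φ := fun _ => 0) (fun _ _ _ _ => (add_zero 0).symm))
  beta_reduce at h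
  rw [coeff_C_mul, coeff_sum_X_pow, finsetSum_coeff] at h
  rw [show D.weightCount j = weightCountOn ((Finset.univ.filter fun u : Fin n → ZMod 2 =>
    ∀ c ∈ D, u ⬝ᵥ c = 0 : Finset _) : Set (Fin n → ZMod 2)) j by
      rw [weightCount, weightCountOn]
      congr 1
      ext c
      rw [Set.mem_ofPred_eq, Set.mem_ofPred_eq, hD.mem_iff]
      simp, h]
  have := sum_words_eq D (fun w => krawtchouk n j w)
  simp only [nsmul_eq_mul] at this
  rw [← this]
  simp [sign, krawtchouk]

/-- The case where `φ` is the half weight. Its sign depends only on the weight, so the sum can again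
be grouped by weights. -/
theorem IsSelfDual.macWilliams_shadow {D : BinaryCode n} (hD : D.IsSelfDual) (j : ℕ) :
    (D.words.card : ℤ) * weightCountOn D.shadow j =
      ∑ w ∈ Finset.range (n + 1), D.weightCount w *
        (sign ((w / 2 : ℕ) : ZMod 2) * krawtchouk n j w) := by
  classical
  have h := congrArg (fun p => coeff p j)
    (macWilliams (D := D) (φ := halfWeight) (fun a ha b hb => halfWeight_add
      (hD.dotProduct_eq_zero ha ha) (hD.dotProduct_eq_zero hb hb)
      (hD.dotProduct_eq_zero ha hb)))
  beta_reduce at h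
  rw [coeff_C_mul, coeff_sum_X_pow, finsetSum_coeff] at h
  rw [show weightCountOn D.shadow j = weightCountOn ((Finset.univ.filter fun u : Fin n → ZMod 2 =>
    ∀ c ∈ D, u ⬝ᵥ c = halfWeight c : Finset _) : Set (Fin n → ZMod 2)) j by
      simp [weightCountOn, shadow], h]
  have := sum_words_eq D (fun w => sign ((w / 2 : ℕ) : ZMod 2) * krawtchouk n j w)
  simp only [nsmul_eq_mul] at this
  rw [← this]
  simp only [coeff_C_mul]
  rfl

theorem weightCount_zero (D : BinaryCode n) : D.weightCount 0 = 1 := by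
  have : {c : Fin n → ZMod 2 | c ∈ D ∧ hammingNorm c = 0} = {0} := by
    ext c
    simp only [hammingNorm_eq_zero, Set.mem_ofPred_eq, Set.mem_singleton_iff]
    exact ⟨fun h => h.2, fun h => ⟨h ▸ zero_mem D, h⟩⟩
  rw [weightCount, this, Set.ncard_singleton]

theorem weightCount_eq_zero {D : BinaryCode n} {w : ℕ} :
    D.weightCount w = 0 ↔ ∀ c ∈ D, hammingNorm c ≠ w := by
  rw [weightCount, Set.ncard_eq_zero (Set.toFinite _), Set.eq_empty_iff_forall_notMem]
  simp

theorem IsSelfDual.weightCount_odd {D : BinaryCode n} (hD : D.IsSelfDual) {w : ℕ}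
    (hw : ¬ Even w) : D.weightCount w = 0 :=
  weightCount_eq_zero.2 fun c hc h =>
    hw (h ▸ (even_hammingNorm_iff c).2 (hD.dotProduct_eq_zero hc hc))

theorem hammingNorm_one_add (c : Fin n → ZMod 2) :
    hammingNorm ((fun _ => 1) + c) + hammingNorm c = n := by
  have : ∀ a : ZMod 2, (1 + a).val + a.val = 1 := by decide
  simp [hammingNorm_eq_sum, ← Finset.sum_add_distrib, this]

theorem IsSelfDual.weightCount_sub {D : BinaryCode n} (hD : D.IsSelfDual) {w : ℕ}
    (hw : w ≤ n) : D.weightCount (n - w) = D.weightCount w := by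
  have h1 := hD.one_mem
  unfold weightCount
  refine Set.ncard_congr (fun c _ => (fun _ => 1) + c) ?_ ?_ ?_
  · rintro c ⟨hc, hcw⟩
    have := hammingNorm_one_add c
    exact ⟨add_mem h1 hc, by omega⟩
  · intro a b _ _ hab
    exact add_left_cancel hab
  · rintro c ⟨hc, hcw⟩
    have := hammingNorm_one_add c
    refine ⟨(fun _ => 1) + c, ⟨add_mem h1 hc, by omega⟩, ?_⟩
    rw [← add_assoc, add_self_eq_zero, zero_add]

/-! ### Krawtchouk values by computation, and the linear system for the weight distribution. -/

/-- The polynomial with a given list of coefficients. -/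
noncomputable def ofCoeffs : List ℤ → ℤ[X]
  | [] => 0
  | a :: l => C a + X * ofCoeffs l

theorem coeff_ofCoeffs (l : List ℤ) (j : ℕ) : (ofCoeffs l).coeff j = l.getD j 0 := by
  induction l generalizing j with
  | nil => simp [ofCoeffs]
  | cons a l ih =>
    cases j with
    | zero => simp [ofCoeffs]
    | succ j =>
      rw [ofCoeffs, coeff_add, coeff_C_succ, zero_add, coeff_X_mul, ih, List.getD_cons_succ]

/-- The coefficients of `e p + (1 + e X) f`, for a polynomial `f` given by its coefficients. -/
def mulLinear (e : ℤ) : ℤ → List ℤ → List ℤ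
  | p, [] => [e * p]
  | p, a :: l => (a + e * p) :: mulLinear e a l

theorem ofCoeffs_mulLinear (e p : ℤ) (l : List ℤ) :
    ofCoeffs (mulLinear e p l) = C (e * p) + (1 + C e * X) * ofCoeffs l := by
  induction l generalizing p with
  | nil => simp [mulLinear, ofCoeffs]
  | cons a l ih =>
    simp only [mulLinear, ofCoeffs, ih, C_add, C_mul]
    ring

/-- The coefficients of `(1 - X) ^ a * (1 + X) ^ b`. -/
def krawtchoukList (a b : ℕ) : List ℤ :=
  (mulLinear (-1) 0)^[a] ((mulLinear 1 0)^[b] [1])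

theorem ofCoeffs_krawtchoukList (a b : ℕ) :
    ofCoeffs (krawtchoukList a b) = (1 - X) ^ a * (1 + X) ^ b := by
  have h : ∀ (e : ℤ) (n : ℕ) (l : List ℤ),
      ofCoeffs ((mulLinear e 0)^[n] l) = (1 + C e * X) ^ n * ofCoeffs l := by
    intro e n l
    induction n with
    | zero => simp
    | succ n ih =>
      rw [Function.iterate_succ_apply', ofCoeffs_mulLinear, ih, mul_zero, C_0, pow_succ]
      ring
  rw [krawtchoukList, h, h]
  simp [ofCoeffs, sub_eq_add_neg]

theorem krawtchouk_eq (n j w : ℕ) :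
    krawtchouk n j w = (krawtchoukList w (n - w)).getD j 0 := by
  rw [krawtchouk, ← ofCoeffs_krawtchoukList, coeff_ofCoeffs]

/-- The weights of a self-dual code of length `68` without words of weight at most `10`. -/
def extremalWeights : Finset ℕ :=
  {0, 12, 14, 16, 18, 20, 22, 24, 26, 28, 30, 32, 34, 36, 38, 40, 42, 44, 46, 48, 50, 52, 54,
    56, 68}

theorem weightCount_eq_zero_of_notMem {D : BinaryCode 68} (hD : D.IsSelfDual)
    (hmin : ∀ w, 0 < w → w ≤ 10 → D.weightCount w = 0) {w : ℕ} (hw : w ≤ 68)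
    (hS : w ∉ extremalWeights) : D.weightCount w = 0 := by
  have key : ∀ w < 69, w ∉ extremalWeights →
      ¬ Even w ∨ (0 < w ∧ w ≤ 10) ∨ (0 < 68 - w ∧ 68 - w ≤ 10) := by decide
  rcases key w (by omega) hS with h | h | h
  · exact hD.weightCount_odd h
  · exact hmin w h.1 h.2
  · rw [← hD.weightCount_sub hw]
    exact hmin _ h.1 h.2

/-- The ring is arbitrary because this is used over `ℤ` for the MacWilliams identities and over
`ℤ[X]` for the weight enumerator. -/
theorem sum_weightCount_mul {D : BinaryCode 68} (hD : D.IsSelfDual)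
    (hmin : ∀ w, 0 < w → w ≤ 10 → D.weightCount w = 0) {R : Type*} [CommRing R] (f : ℕ → R) :
    ∑ w ∈ Finset.range 69, D.weightCount w * f w =
      (f 0 + f 68) + D.weightCount 12 * (f 12 + f 56) + D.weightCount 14 * (f 14 + f 54) +
      D.weightCount 16 * (f 16 + f 52) + D.weightCount 18 * (f 18 + f 50) +
      D.weightCount 20 * (f 20 + f 48) + D.weightCount 22 * (f 22 + f 46) +
      D.weightCount 24 * (f 24 + f 44) + D.weightCount 26 * (f 26 + f 42) +
      D.weightCount 28 * (f 28 + f 40) + D.weightCount 30 * (f 30 + f 38) +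
      D.weightCount 32 * (f 32 + f 36) + D.weightCount 34 * f 34 := by
  have h1 : ∑ w ∈ Finset.range 69, D.weightCount w * f w =
      ∑ w ∈ extremalWeights, D.weightCount w * f w := by
    refine (Finset.sum_subset (by decide) fun w hw hS => ?_).symm
    rw [weightCount_eq_zero_of_notMem hD hmin (by simpa [Nat.lt_succ_iff] using hw) hS]
    rw [Nat.cast_zero, zero_mul]
  have h2 : ∀ w ≤ 68, D.weightCount (68 - w) = D.weightCount w :=
    fun w hw => hD.weightCount_sub hw
  rw [h1]
  simp only [extremalWeights]
  repeat rw [Finset.sum_insert (by decide)]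
  rw [Finset.sum_singleton, weightCount_zero]
  rw [h2 0 (by norm_num), h2 12 (by norm_num), h2 14 (by norm_num), h2 16 (by norm_num),
    h2 18 (by norm_num), h2 20 (by norm_num), h2 22 (by norm_num), h2 24 (by norm_num),
    h2 26 (by norm_num), h2 28 (by norm_num), h2 30 (by norm_num), h2 32 (by norm_num),
    weightCount_zero]
  ring

theorem card_words_of_isSelfDual {D : BinaryCode 68} (hD : D.IsSelfDual) :
    (D.words.card : ℤ) = 2 ^ 34 := by
  have h := hD.two_mul_finrank
  rw [card_words, show Module.finrank (ZMod 2) D = 34 by omega]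
  norm_num

/-- The sums `f 0 + f 68, f 12 + f 56, …, f 32 + f 36, f 34`. -/
def foldWeights (f : ℕ → ℤ) : List ℤ :=
  [f 0 + f 68, f 12 + f 56, f 14 + f 54, f 16 + f 52, f 18 + f 50, f 20 + f 48, f 22 + f 46,
    f 24 + f 44, f 26 + f 42, f 28 + f 40, f 30 + f 38, f 32 + f 36, f 34]

/-- The values of the Krawtchouk polynomials of degrees `j`, computed. -/
def krawtchoukRow (j : ℕ) : List ℤ :=
  foldWeights fun w => (krawtchoukList w (68 - w)).getD j 0

/-- The values of the Krawtchouk polynomials of degrees `j`, with the signs for the shadow. -/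
def shadowRow (j : ℕ) : List ℤ :=
  foldWeights fun w => sign ((w / 2 : ℕ) : ZMod 2) * (krawtchoukList w (68 - w)).getD j 0

/-- The linear form in the numbers of words of weights `12, 14, …, 34`. -/
noncomputable def weightForm (D : BinaryCode 68) : List ℤ → ℤ
  | [a0, a1, a2, a3, a4, a5, a6, a7, a8, a9, a10, a11, a12] =>
    a0 + D.weightCount 12 * a1 + D.weightCount 14 * a2 + D.weightCount 16 * a3 +
    D.weightCount 18 * a4 + D.weightCount 20 * a5 + D.weightCount 22 * a6 +
    D.weightCount 24 * a7 + D.weightCount 26 * a8 + D.weightCount 28 * a9 +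
    D.weightCount 30 * a10 + D.weightCount 32 * a11 + D.weightCount 34 * a12
  | _ => 0

theorem weightForm_krawtchoukRow {D : BinaryCode 68} (hD : D.IsSelfDual)
    (hmin : ∀ w, 0 < w → w ≤ 10 → D.weightCount w = 0) (j : ℕ) :
    2 ^ 34 * (D.weightCount j : ℤ) = D.weightForm (krawtchoukRow j) := by
  have h := hD.macWilliams_weightCount j
  rw [card_words_of_isSelfDual hD, sum_weightCount_mul hD hmin] at h
  simp only [krawtchouk_eq] at h
  exact h

theorem weightForm_shadowRow {D : BinaryCode 68} (hD : D.IsSelfDual)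
    (hmin : ∀ w, 0 < w → w ≤ 10 → D.weightCount w = 0) (j : ℕ) :
    2 ^ 34 * (weightCountOn D.shadow j : ℤ) = D.weightForm (shadowRow j) := by
  have h := hD.macWilliams_shadow j
  rw [card_words_of_isSelfDual hD, sum_weightCount_mul hD hmin] at h
  simp only [krawtchouk_eq] at h
  exact h

/-- Only even degrees are listed: the Krawtchouk values of odd degree at `w` and `68 - w` cancel, so
odd degrees carry no information. -/
theorem krawtchoukRow_0 : krawtchoukRow 0 =
      [2, 2, 2, 2, 2, 2, 2, 2, 2, 2, 2, 2, 1] := by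
  decide +kernel

theorem krawtchoukRow_2 : krawtchoukRow 2 =
      [4556, 1868, 1532, 1228, 956, 716, 508, 332, 188, 76, -4, -52, -34] := by
  decide +kernel

theorem krawtchoukRow_4 : krawtchoukRow 4 =
      [1628770, 248930, 161122, 97890, 54370, 26210, 9570, 1122, -1950, -1950, -670, 610, 561] := by
  decide +kernel

theorem krawtchoukRow_6 : krawtchoukRow 6 =
      [218906688, 10984512, 5259072, 2160704, 667968, 75840, -73920, -54208, -5824, 17472, 12096,
        -4032, -5984] := by
  decide +kernel

theorem krawtchoukRow_8 : krawtchoukRow 8 =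
      [14784019536, 202551888, 62401872, 11626576, -1385904, -1925040, -377520, 318032, 198224,
        -68016, -113328, 13392, 46376] := by
  decide +kernel

theorem krawtchoukRow_10 : krawtchoukRow 10 =
      [581504768416, 1581929888, 175600672, -56176224, -28007904, 2032032, 5002272, 58784,
        -1455584, -66144, 705568, 18848, -278256] := by
  decide +kernel

theorem krawtchoukRow_12 : krawtchoukRow 12 =
      [14564051245328, 3052823312, -1178630128, -340742896, 80452368, 44791056, -14583792,
        -8897776, 5402384, 2367248, -3182576, -532208, 1344904] := by
  decide +kernel

theorem krawtchoukRow_14 : krawtchoukRow 14 =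
      [246468559536320, -19946048320, -4407243328, 1237608640, 337245120, -191465280, -23876160,
        48407744, -7873600, -15291200, 10755520, 3739840, -5379616] := by
  decide +kernel

theorem krawtchoukRow_16 : krawtchoukRow 16 =
      [2939137572470616, -68764537512, 14758483032, 2908363608, -1813756584, 60207960, 287040600,
        -123816616, -25894568, 61112664, -27095976, -17541288, 18156204] := by
  decide +kernel

theorem shadowRow_2 : shadowRow 2 =
      [4556, 1868, -1532, 1228, -956, 716, -508, 332, -188, 76, 4, -52, 34] := by
  decide +kernel

theorem shadowRow_6 : shadowRow 6 =
      [218906688, 10984512, -5259072, 2160704, -667968, 75840, 73920, -54208, 5824, 17472,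
        -12096, -4032, 5984] := by
  decide +kernel

theorem shadowRow_10 : shadowRow 10 =
      [581504768416, 1581929888, -175600672, -56176224, 28007904, 2032032, -5002272, 58784,
        1455584, -66144, -705568, 18848, 278256] := by
  decide +kernel

/-- Twelve equations, of degrees 0, 2, …, 16 for the code and 2, 6, 10 for the shadow, determine the
twelve unknowns. In degrees up to 10 the left-hand side is known; in degrees 12, 14, 16 it contains
an unknown. -/
theorem weightCount_of_shadow {D : BinaryCode 68} (hD : D.IsSelfDual)
    (hmin : ∀ w, 0 < w → w ≤ 10 → D.weightCount w = 0) {β γ : ℤ}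
    (h2 : weightCountOn D.shadow 2 = 0) (h6 : (weightCountOn D.shadow 6 : ℤ) = γ)
    (h10 : (weightCountOn D.shadow 10 : ℤ) = β - 14 * γ) :
    (D.weightCount 12 : ℤ) = 442 + 4 * β ∧
    (D.weightCount 14 : ℤ) = 14960 - 8 * β - 256 * γ ∧
    (D.weightCount 16 : ℤ) = 174471 - 36 * β + 2048 * γ ∧
    (D.weightCount 18 : ℤ) = 1478048 + 80 * β - 5632 * γ ∧
    (D.weightCount 20 : ℤ) = 9546537 + 140 * β + 2048 * γ ∧
    (D.weightCount 22 : ℤ) = 46699952 - 360 * β + 21248 * γ ∧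
    (D.weightCount 24 : ℤ) = 175078410 - 300 * β - 40960 * γ ∧
    (D.weightCount 26 : ℤ) = 509477760 + 960 * β - 2048 * γ ∧
    (D.weightCount 28 : ℤ) = 1160564636 + 360 * β + 90112 * γ ∧
    (D.weightCount 30 : ℤ) = 2081169376 - 1680 * β - 86528 * γ ∧
    (D.weightCount 32 : ℤ) = 2949602799 - 168 * β - 53248 * γ ∧
    (D.weightCount 34 : ℤ) = 3312254400 + 2016 * β + 146432 * γ := by
  have z : ∀ w, 0 < w → w ≤ 10 → (D.weightCount w : ℤ) = 0 := fun w h h' => by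
    rw [hmin w h h']; rfl
  have k0 := weightForm_krawtchoukRow hD hmin 0
  have k2 := weightForm_krawtchoukRow hD hmin 2
  have k4 := weightForm_krawtchoukRow hD hmin 4
  have k6 := weightForm_krawtchoukRow hD hmin 6
  have k8 := weightForm_krawtchoukRow hD hmin 8
  have k10 := weightForm_krawtchoukRow hD hmin 10
  have k12 := weightForm_krawtchoukRow hD hmin 12
  have k14 := weightForm_krawtchoukRow hD hmin 14
  have k16 := weightForm_krawtchoukRow hD hmin 16
  have s2 := weightForm_shadowRow hD hmin 2
  have s6 := weightForm_shadowRow hD hmin 6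
  have s10 := weightForm_shadowRow hD hmin 10
  rw [weightCount_zero, Nat.cast_one, krawtchoukRow_0] at k0
  rw [z 2 (by norm_num) (by norm_num), krawtchoukRow_2] at k2
  rw [z 4 (by norm_num) (by norm_num), krawtchoukRow_4] at k4
  rw [z 6 (by norm_num) (by norm_num), krawtchoukRow_6] at k6
  rw [z 8 (by norm_num) (by norm_num), krawtchoukRow_8] at k8
  rw [z 10 (by norm_num) (by norm_num), krawtchoukRow_10] at k10
  rw [krawtchoukRow_12] at k12
  rw [krawtchoukRow_14] at k14
  rw [krawtchoukRow_16] at k16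
  rw [h2, shadowRow_2] at s2
  rw [h6, shadowRow_6] at s6
  rw [h10, shadowRow_10] at s10
  simp only [weightForm] at *
  generalize (D.weightCount 12 : ℤ) = a12 at *
  generalize (D.weightCount 14 : ℤ) = a14 at *
  generalize (D.weightCount 16 : ℤ) = a16 at *
  generalize (D.weightCount 18 : ℤ) = a18 at *
  generalize (D.weightCount 20 : ℤ) = a20 at *
  generalize (D.weightCount 22 : ℤ) = a22 at *
  generalize (D.weightCount 24 : ℤ) = a24 at *
  generalize (D.weightCount 26 : ℤ) = a26 at *
  generalize (D.weightCount 28 : ℤ) = a28 at *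
  generalize (D.weightCount 30 : ℤ) = a30 at *
  generalize (D.weightCount 32 : ℤ) = a32 at *
  generalize (D.weightCount 34 : ℤ) = a34 at *
  clear h2 h6 h10 hmin hD z
  -- The coefficients come from the inverse of the system, and the factors `2^32, …, 2^35` clear its
  -- denominators.
  refine ⟨mul_left_cancel₀ (show (34359738368 : ℤ) ≠ 0 by norm_num)
      (by
        linear_combination
            -442 * k0 - 416 * k2 - 38 * k4 - 56 * k6 + 3 * k8 - 4 * k10 + 1 * k12 - 832 * s2
            - 112 * s6 - 8 * s10),
    mul_left_cancel₀ (show (34359738368 : ℤ) ≠ 0 by norm_num)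
      (by
        linear_combination
            -14960 * k0 - 4576 * k2 - 1552 * k4 - 291 * k6 - 80 * k8 + 4 * k10 + 1 * k14
            + 9856 * s2 + 736 * s6 + 16 * s10),
    mul_left_cancel₀ (show (34359738368 : ℤ) ≠ 0 by norm_num)
      (by
        linear_combination
            -174471 * k0 - 45408 * k2 - 11013 * k4 - 1544 * k6 - 238 * k8 + 36 * k10 + 1 * k16
            - 90816 * s2 - 3088 * s6 + 72 * s10),
    mul_left_cancel₀ (show (17179869184 : ℤ) ≠ 0 by norm_num)
      (by
        linear_combination
            -6214197 * k0 - 1877920 * k2 - 520615 * k4 - 131945 * k6 - 29743 * k8 - 5940 * k10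
            - 979 * k12 - 125 * k14 - 11 * k16 + 311168 * s2 + 4512 * s6 - 80 * s10),
    mul_left_cancel₀ (show (34359738368 : ℤ) ≠ 0 by norm_num)
      (by
        linear_combination
            91311913 * k0 + 34291488 * k2 + 11216555 * k4 + 3188632 * k6 + 779534 * k8
            + 159348 * k10 + 26180 * k12 + 3136 * k14 + 217 * k16 - 3011008 * s2 - 8016 * s6
            - 280 * s10),
    mul_left_cancel₀ (show (34359738368 : ℤ) ≠ 0 by norm_num)
      (by
        linear_combination
            -790330272 * k0 - 247317600 * k2 - 74262560 * k4 - 20575783 * k6 - 5048288 * k8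
            - 1045324 * k10 - 171920 * k12 - 20179 * k14 - 1296 * k16 + 10404992 * s2
            - 32416 * s6 + 720 * s10),
    mul_left_cancel₀ (show (34359738368 : ℤ) ≠ 0 by norm_num)
      (by
        linear_combination
            2554762890 * k0 + 963994080 * k2 + 308299302 * k4 + 86574120 * k6 + 21236035 * k8
            + 4404780 * k10 + 725385 * k12 + 84672 * k14 + 5300 * k16 - 25496640 * s2
            + 90320 * s6 + 600 * s10),
    mul_left_cancel₀ (show (4294967296 : ℤ) ≠ 0 by norm_num)
      (by
        linear_combination
            -1218394947 * k0 - 377075424 * k2 - 115846785 * k4 - 32530747 * k6 - 7997433 * k8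
            - 1658268 * k10 - 273141 * k12 - 31863 * k14 - 1981 * k16 + 5258880 * s2
            - 2848 * s6 - 240 * s10),
    mul_left_cancel₀ (show (17179869184 : ℤ) ≠ 0 by norm_num)
      (by
        linear_combination
            8755651916 * k0 + 3359748832 * k2 + 1055523580 * k4 + 295510728 * k6
            + 72650625 * k8 + 15065804 * k10 + 2480863 * k12 + 289568 * k14 + 18018 * k16
            - 19370560 * s2 - 95152 * s6 - 360 * s10),
    mul_left_cancel₀ (show (17179869184 : ℤ) ≠ 0 by norm_num)
      (by
        linear_combination
            -19612471736 * k0 - 5970805984 * k2 - 1861864744 * k4 - 522310619 * k6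
            - 128280104 * k8 - 26602588 * k10 - 4380024 * k12 - 511511 * k14 - 31928 * k16
            - 1848704 * s2 + 110048 * s6 + 1680 * s10),
    mul_left_cancel₀ (show (17179869184 : ℤ) ≠ 0 by norm_num)
      (by
        linear_combination
            21578890619 * k0 + 8388498976 * k2 + 2603965489 * k4 + 730204792 * k6
            + 179337676 * k8 + 37178068 * k10 + 6121786 * k12 + 715104 * k14 + 44759 * k16
            + 33670208 * s2 + 55600 * s6 + 168 * s10),
    mul_left_cancel₀ (show (8589934592 : ℤ) ≠ 0 by norm_num)
      (by
        linear_combination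
            -15359988735 * k0 - 4642720992 * k2 - 1456336917 * k4 - 407742507 * k6
            - 100172205 * k8 - 20761692 * k10 - 3418905 * k12 - 399399 * k14 - 25025 * k16
            - 24705408 * s2 - 87328 * s6 - 1008 * s10)⟩

end BinaryCode

/-! ### From shadow counts to the parameters `β`, `γ`, and back. -/

theorem coeff_W682 (β γ : ℤ) :
    (W682 β γ).coeff 12 = 442 + 4 * β ∧
    (W682 β γ).coeff 14 = 14960 - 8 * β - 256 * γ ∧
    (W682 β γ).coeff 16 = 174471 - 36 * β + 2048 * γ ∧
    (W682 β γ).coeff 18 = 1478048 + 80 * β - 5632 * γ ∧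
    (W682 β γ).coeff 20 = 9546537 + 140 * β + 2048 * γ ∧
    (W682 β γ).coeff 22 = 46699952 - 360 * β + 21248 * γ ∧
    (W682 β γ).coeff 24 = 175078410 - 300 * β - 40960 * γ ∧
    (W682 β γ).coeff 26 = 509477760 + 960 * β - 2048 * γ ∧
    (W682 β γ).coeff 28 = 1160564636 + 360 * β + 90112 * γ ∧
    (W682 β γ).coeff 30 = 2081169376 - 1680 * β - 86528 * γ ∧
    (W682 β γ).coeff 32 = 2949602799 - 168 * β - 53248 * γ ∧
    (W682 β γ).coeff 34 = 3312254400 + 2016 * β + 146432 * γ := by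
  refine ⟨?_, ?_, ?_, ?_, ?_, ?_, ?_, ?_, ?_, ?_, ?_, ?_⟩ <;>
  · rw [W682]
    simp only [coeff_add, coeff_C_mul, coeff_X_pow, coeff_one]
    norm_num

/-- The coefficient of `X ^ 12` determines `β`, and then that of `X ^ 14` determines `γ`. -/
theorem W682_injective {β γ β' γ' : ℤ} (h : W682 β γ = W682 β' γ') : β = β' ∧ γ = γ' := by
  have h1 := (coeff_W682 β γ).1
  have h2 := (coeff_W682 β γ).2.1
  rw [h, (coeff_W682 β' γ').1] at h1
  rw [h, (coeff_W682 β' γ').2.1] at h2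
  omega

namespace BinaryCode

theorem weightEnumerator_eq_W682 {D : BinaryCode 68} (hD : D.IsSelfDual)
    (hmin : ∀ w, 0 < w → w ≤ 10 → D.weightCount w = 0) {β γ : ℤ}
    (h2 : weightCountOn D.shadow 2 = 0) (h6 : (weightCountOn D.shadow 6 : ℤ) = γ)
    (h10 : (weightCountOn D.shadow 10 : ℤ) = β - 14 * γ) :
    D.weightEnumerator = W682 β γ := by
  have h := sum_weightCount_mul hD hmin (fun w => (X : ℤ[X]) ^ w)
  have hc : ∀ w, (D.weightCount w : ℤ[X]) = C (D.weightCount w : ℤ) := fun w => by simp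
  simp only [hc] at h
  obtain ⟨a12, a14, a16, a18, a20, a22, a24, a26, a28, a30, a32, a34⟩ :=
    weightCount_of_shadow hD hmin h2 h6 h10
  rw [a12, a14, a16, a18, a20, a22, a24, a26, a28, a30, a32, a34, pow_zero] at h
  exact h

theorem minDist_eq {D : BinaryCode 68} (hD : D.IsSelfDual)
    (hmin : ∀ w, 0 < w → w ≤ 10 → D.weightCount w = 0) (h12 : D.weightCount 12 ≠ 0) :
    D.minDist = 12 := by
  apply le_antisymm
  · rw [Ne, weightCount_eq_zero] at h12
    push Not at h12
    obtain ⟨c, hc, hw⟩ := h12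
    refine Nat.sInf_le ⟨c, hc, ?_, hw⟩
    rintro rfl
    simp at hw
  · rw [Ne, weightCount_eq_zero] at h12
    push Not at h12
    obtain ⟨c, hc, hw⟩ := h12
    refine le_csInf ⟨12, c, hc, ?_, hw⟩ ?_
    · rintro rfl
      simp at hw
    · rintro w ⟨c, hc, hne, rfl⟩
      have hpos : 0 < hammingNorm c := hammingNorm_pos_iff.2 hne
      by_contra hlt
      rcases (show hammingNorm c ≤ 10 ∨ hammingNorm c = 11 by omega) with h | h
      · exact weightCount_eq_zero.1 (hmin _ hpos h) c hc rfl
      · exact weightCount_eq_zero.1 (hD.weightCount_odd (w := 11) (by decide)) c hc h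

theorem distanceBound_eq (D : BinaryCode 68) : D.distanceBound = 12 := by
  rw [distanceBound]
  split_ifs <;> first | rfl | omega

/-- A self-dual code of length `68` with the given numbers of shadow vectors. -/
theorem extremal_of_shadow {D : BinaryCode 68} (hD : D.IsSelfDual)
    (hmin : ∀ w, 0 < w → w ≤ 10 → D.weightCount w = 0) {β γ : ℤ}
    (h2 : weightCountOn D.shadow 2 = 0) (h6 : (weightCountOn D.shadow 6 : ℤ) = γ)
    (h10 : (weightCountOn D.shadow 10 : ℤ) = β - 14 * γ) :
    IsExtremal D ∧ HasParameters D 34 12 ∧ weightEnumerator D = W682 β γ := by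
  have h12 := (weightCount_of_shadow hD hmin h2 h6 h10).1
  have hd := minDist_eq hD hmin (by omega)
  have hk := hD.two_mul_finrank
  exact ⟨⟨hD, by rw [hd, distanceBound_eq]⟩, ⟨by omega, hd⟩,
    weightEnumerator_eq_W682 hD hmin h2 h6 h10⟩

theorem weightCount_of_minDist {D : BinaryCode 68} (hd : D.minDist = 12) :
    ∀ w, 0 < w → w ≤ 10 → D.weightCount w = 0 := by
  intro w hw hw'
  rw [weightCount_eq_zero]
  rintro c hc rfl
  have : D.minDist ≤ hammingNorm c := Nat.sInf_le ⟨c, hc, hammingNorm_pos_iff.1 hw, rfl⟩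
  omega

theorem coeff_weightEnumerator (D : BinaryCode 68) {w : ℕ} (hw : w ≤ 68) :
    D.weightEnumerator.coeff w = D.weightCount w := by
  rw [weightEnumerator, finsetSum_coeff]
  simp only [coeff_C_mul, coeff_X_pow, mul_ite, mul_one, mul_zero]
  rw [Finset.sum_ite_eq, if_pos (by simp; omega)]

/-- The converse reading of `γ`: substituting the coefficients of `W682` into the shadow identity of
degree 6 leaves `2 ^ 34 * γ`. This bounds `γ` for arbitrary extremal codes. -/
theorem weightCountOn_shadow_six {D : BinaryCode 68} (hD : D.IsSelfDual) (hd : D.minDist = 12)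
    {β γ : ℤ} (hW : D.weightEnumerator = W682 β γ) : (weightCountOn D.shadow 6 : ℤ) = γ := by
  have s := weightForm_shadowRow hD (weightCount_of_minDist hd) 6
  have hA : ∀ w ≤ 68, (D.weightCount w : ℤ) = (W682 β γ).coeff w := fun w hw => by
    rw [← hW, coeff_weightEnumerator D hw]
  obtain ⟨a12, a14, a16, a18, a20, a22, a24, a26, a28, a30, a32, a34⟩ := coeff_W682 β γ
  rw [shadowRow_6] at s
  simp only [weightForm] at s
  rw [hA 12 (by norm_num), hA 14 (by norm_num), hA 16 (by norm_num), hA 18 (by norm_num),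
    hA 20 (by norm_num), hA 22 (by norm_num), hA 24 (by norm_num), hA 26 (by norm_num),
    hA 28 (by norm_num), hA 30 (by norm_num), hA 32 (by norm_num), hA 34 (by norm_num),
    a12, a14, a16, a18, a20, a22, a24, a26, a28, a30, a32, a34] at s
  exact mul_left_cancel₀ (show (2 ^ 34 : ℤ) ≠ 0 by norm_num) (by linear_combination s)

theorem hammingNorm_add_of_disjoint {n : ℕ} {x y : Fin n → ZMod 2}
    (h : ∀ i, x i = 0 ∨ y i = 0) : hammingNorm (x + y) = hammingNorm x + hammingNorm y := by
  simp only [hammingNorm_eq_sum, ← Finset.sum_add_distrib]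
  refine Finset.sum_congr rfl fun i _ => ?_
  rcases h i with h | h <;> simp [h]

theorem disjoint_of_hammingNorm_add {n : ℕ} {x y : Fin n → ZMod 2}
    (h : hammingNorm x + hammingNorm y ≤ hammingNorm (x + y)) (i : Fin n) :
    x i = 0 ∨ y i = 0 := by
  have key : ∀ a b : ZMod 2, (a + b).val + 2 * (a * b).val = a.val + b.val := by decide
  have h0 : ∀ a b : ZMod 2, (a * b).val = 0 → a = 0 ∨ b = 0 := by decide
  have hs : ∑ j, (x j * y j).val = 0 := by
    have : hammingNorm (x + y) + 2 * ∑ j, (x j * y j).val = hammingNorm x + hammingNorm y := by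
      simp only [hammingNorm_eq_sum, Finset.mul_sum, ← Finset.sum_add_distrib, Pi.add_apply, key]
    omega
  exact h0 _ _ (Finset.sum_eq_zero_iff.1 hs i (Finset.mem_univ i))

/-- The shadow of an extremal code has fewer than ten vectors of weight `6`. -/
theorem weightCountOn_shadow_six_lt {D : BinaryCode 68} (hD : D.IsSelfDual)
    (hd : D.minDist = 12) : weightCountOn D.shadow 6 < 10 := by
  classical
  have hmin : ∀ c ∈ D, c ≠ 0 → 12 ≤ hammingNorm c := fun c hc hne => by
    rw [← hd]
    exact Nat.sInf_le ⟨c, hc, hne, rfl⟩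
  by_contra hge
  rw [not_lt, weightCountOn, Set.ncard_eq_toFinset_card _ (Set.toFinite _)] at hge
  obtain ⟨T, hT, hcard⟩ := Finset.exists_subset_card_eq hge
  have hTm : ∀ u ∈ T, u ∈ D.shadow ∧ hammingNorm u = 6 := fun u hu => by simpa using hT hu
  -- The sum of two shadow vectors is a codeword, of weight at least 12 = 6 + 6, which leaves no
  -- room for an overlap.
  have hdisj : ∀ u ∈ T, ∀ v ∈ T, u ≠ v → ∀ i, u i = 0 ∨ v i = 0 := by
    intro u hu v hv huv
    have hne : u + v ≠ 0 := fun h => huv (by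
      have := eq_neg_of_add_eq_zero_left h
      rwa [neg_eq_self] at this)
    have := hmin _ (hD.add_mem_of_shadow (hTm u hu).1 (hTm v hv).1) hne
    exact disjoint_of_hammingNorm_add (by rw [(hTm u hu).2, (hTm v hv).2]; exact this)
  have hsum : ∀ T' ⊆ T, hammingNorm (∑ u ∈ T', u) = 6 * T'.card := by
    intro T'
    induction T' using Finset.induction_on with
    | empty => simp
    | insert a s ha ih =>
      intro hs
      rw [Finset.insert_subset_iff] at hs
      rw [Finset.sum_insert ha, Finset.card_insert_of_notMem ha, hammingNorm_add_of_disjoint,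
        ih hs.2, (hTm a hs.1).2]
      · ring
      · intro i
        by_cases hai : a i = 0
        · exact Or.inl hai
        · right
          rw [Finset.sum_apply]
          refine Finset.sum_eq_zero fun v hv => ?_
          exact (hdisj a hs.1 v (hs.2 hv) (fun h => ha (h ▸ hv)) i).resolve_left hai
  have h60 := hsum T subset_rfl
  rw [hcard] at h60
  -- An even number of shadow vectors sums to a codeword: ten equal values cancel modulo 2.
  have hmem : ∑ u ∈ T, u ∈ D := by
    rw [hD.mem_iff]
    intro c hc
    rw [sum_dotProduct, Finset.sum_congr rfl fun u hu => (hTm u hu).1 c hc, Finset.sum_const,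
      hcard]
    generalize halfWeight c = a
    revert a
    decide
  -- The complement of the word of weight 60 is a codeword of weight 8.
  have h8 := hammingNorm_one_add (∑ u ∈ T, u)
  have := hmin _ (add_mem hD.one_mem hmem) (by
    rw [← hammingNorm_pos_iff]
    omega)
  omega

end BinaryCode

/-! ### The packed computation: definitions. -/

/-- The 34 binary digits of a number, from the left. -/
def bits (n : ℕ) : List Bool := (List.range 34).map fun j => n.testBit (33 - j)

/-- The number of ones among the 34 binary digits of a number. -/
def popCount (n : ℕ) : ℕ := (bits n).count true

/-- Several lanes packed into numbers in base `128`: the number of lanes, the number with all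
digits `1`, the number with the sizes as digits, and the numbers with the coordinates as digits. -/
structure LaneBatch where
  len : ℕ
  ones : ℕ
  size : ℕ
  planes : List ℕ

namespace LaneBatch

/-- A lane occupies 7 bits, so shifting by `7 * A.len` places the second batch behind the first. -/
def append (A B : LaneBatch) : LaneBatch where
  len := A.len + B.len
  ones := A.ones + B.ones <<< (7 * A.len)
  size := A.size + B.size <<< (7 * A.len)
  planes := List.zipWith (fun p q => p + q <<< (7 * A.len)) A.planes B.planes

/-- Adding a 1 to every lane in one coordinate complements that plane. The subtraction has no
borrows, since all digits are 0 or 1. -/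
def addRow (r : List Bool) (B : LaneBatch) : LaneBatch where
  len := B.len
  ones := B.ones
  size := B.size + B.ones
  planes := List.zipWith (fun b p => cond b (B.ones - p) p) r B.planes

def empty : LaneBatch := ⟨0, 0, 0, List.replicate 34 0⟩

def unit : LaneBatch := ⟨1, 1, 0, List.replicate 34 0⟩

/-- Entry `i` of the list holds the sums of `i` rows, and the recursion is Pascal's: a set of `i +
1` rows either avoids `r` or is `r` together with `i` others. The shorter argument of `zipWith` cuts
off the sets that have become too large. -/
def step (r : List Bool) : List LaneBatch → List LaneBatch
  | [] => []
  | b :: bs => b :: List.zipWith append bs ((b :: bs).map (addRow r))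

def ofRows (t : ℕ) (rows : List ℕ) : LaneBatch :=
  ((rows.map bits).foldr step (unit :: List.replicate t empty)).foldr append empty

/-- The sum of the planes that are selected by the mask. -/
def maskSum : List Bool → List ℕ → ℕ
  | b :: bs, p :: ps => cond b (p + maskSum bs ps) (maskSum bs ps)
  | _, _ => 0

/-- The sizes of the lanes plus their distances from `r`. -/
def weights (B : LaneBatch) (r : ℕ) : ℕ :=
  B.size + B.planes.sum + popCount r * B.ones - 2 * maskSum (bits r) B.planes

/-- The lowest bit of each digit is the inner product with `b`, shifted by `c`. -/
def parity (B : LaneBatch) (b c : ℕ) : ℕ :=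
  (maskSum (bits b) B.planes + c * B.ones) &&& B.ones

/-- Adding `63 - m` to a digit of size at most 64 sets its bit of value 64 exactly when the digit
exceeds `m`. -/
def above (B : LaneBatch) (w m : ℕ) : ℕ :=
  ((w + (63 - m) * B.ones) &&& (B.ones <<< 6)) >>> 6

end LaneBatch

/-- The quotient is a geometric sum of ratio `2 ^ (2 * w)`, so the mask selects every second field
of `w` bits. -/
def fieldMask (w k : ℕ) : ℕ := (2 ^ w - 1) * (((1 <<< (2 * w * k)) - 1) / (2 ^ (2 * w) - 1))

def widen (w k n : ℕ) : ℕ := (n &&& fieldMask w k) + (n - (n &&& fieldMask w k)) >>> w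

/-- Neighbouring digits are added twice, which gives digits in base `2 ^ 28`. This base is 1 modulo
`2 ^ 28 - 1`, so the remainder is the sum of the digits. -/
def digitSum (len n : ℕ) : ℕ :=
  widen 14 (len / 4 + 1) (widen 7 (len / 2 + 1) n) % (2 ^ 28 - 1)

namespace LaneBatch

def countEq (B : LaneBatch) (w p m : ℕ) : ℕ :=
  digitSum B.len ((B.above w (m - 1) - B.above w m) &&& p)

def countLe (B : LaneBatch) (w p m : ℕ) : ℕ :=
  digitSum B.len ((B.ones - B.above w m) &&& p)

end LaneBatch

/-- The sum of the rows selected by the digits of a number. -/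
def rowSum (rows : List ℕ) (b : ℕ) : ℕ :=
  (List.zipWith (fun c r => cond c r 0) (bits b) rows).foldr (· ^^^ ·) 0

/-- Here `s` and `t` represent two cosets and `s'`, `t'` are their images under `Aᵀ`. Weights 2 and
6 are counted from the left only: a vector of weight 6 with more than 5 ones on the left vanishes on
the right, so its left part is `s'` or `t'`, which the last two tests exclude. Weight 10 needs both
lists. -/
def shadowCheck (L R : LaneBatch) (s s' t t' p q : ℕ) (γ β : ℤ) : Bool :=
  (L.countEq (L.weights s) p 2 + L.countEq (L.weights t) p 2 == 0) &&
  (((L.countEq (L.weights s) p 6 + L.countEq (L.weights t) p 6 : ℕ) : ℤ) == γ) &&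
  (((L.countEq (L.weights s) p 10 + L.countEq (L.weights t) p 10 +
    (R.countEq (R.weights s') q 10 + R.countEq (R.weights t') q 10) : ℕ) : ℤ) == β - 14 * γ) &&
  (popCount s' != 6) && (popCount t' != 6)

/-- The computation that determines the parameters of the neighbour given by `b`. -/
def neighbourCheck (L R : LaneBatch) (rows : List ℕ) (s b : ℕ) (γ β : ℤ) : Bool :=
  (popCount b != 0) && (popCount b % 2 == 0) &&
  (L.countLe (L.weights b) (L.parity b 1) 10 == 0) &&
  (R.countLe (R.weights (rowSum rows b)) (R.parity (rowSum rows b) 1) 10 == 0) &&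
  shadowCheck L R s (rowSum rows s) (s ^^^ b) (rowSum rows s ^^^ rowSum rows b)
    -- The mask must be 1 exactly when the inner product with `x` equals the half weight of `x`. On
    -- the left list a lane is the right part minus `s`, so `s ⬝ b` enters; the same constant serves
    -- `s + b`, as `b ⬝ b = 0`. On the right list the pairing of images under `Aᵀ` already is the
    -- pairing of the right part with `b`.
    (L.parity b (1 + popCount b / 2 % 2 + popCount (s &&& b) % 2))
    (R.parity (rowSum rows b) (1 + popCount b / 2 % 2)) γ β

/-- The computation that determines the parameters of a code in standard form. -/
def standardCheck (L R : LaneBatch) (rowsT : List ℕ) (s : ℕ) (γ β : ℤ) : Bool :=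
  -- With `b = 0` and `c = 1` every lane passes the parity test; the count 1 is the zero word.
  (L.countLe (L.weights 0) (L.parity 0 1) 10 == 1) &&
  (R.countLe (R.weights 0) (R.parity 0 1) 10 == 1) &&
  (L.countEq (L.weights s) (L.parity 0 1) 2 == 0) &&
  ((L.countEq (L.weights s) (L.parity 0 1) 6 : ℤ) == γ) &&
  (((L.countEq (L.weights s) (L.parity 0 1) 10 +
    R.countEq (R.weights (rowSum rowsT s)) (R.parity 0 1) 10 : ℕ) : ℤ) == β - 14 * γ) &&
  (popCount (rowSum rowsT s) != 6)

/-! ### Correctness of digitwise arithmetic in base 128. -/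

/-- The number with given digits in base `128`, one digit for each member of a list. -/
def pack {α : Type*} (f : α → ℕ) (L : List α) : ℕ := Nat.ofDigits 128 (L.map f)

section Pack

variable {α : Type*} (f g : α → ℕ) (L L' : List α)

@[simp] theorem pack_cons (a : α) : pack f (a :: L) = f a + 128 * pack f L := rfl

theorem pack_congr {f g : α → ℕ} {L : List α} (h : ∀ x ∈ L, f x = g x) :
    pack f L = pack g L := by
  rw [pack, pack, List.map_congr_left h]

theorem pack_add : pack f L + pack g L = pack (fun x => f x + g x) L := by
  induction L with
  | nil => rfl
  | cons a L ih => simp only [pack_cons, ← ih]; ring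

theorem pack_mul (c : ℕ) : c * pack f L = pack (fun x => c * f x) L := by
  induction L with
  | nil => rfl
  | cons a L ih => simp only [pack_cons, ← ih]; ring

theorem pack_sub {f g : α → ℕ} {L : List α} (h : ∀ x ∈ L, g x ≤ f x) :
    pack f L - pack g L = pack (fun x => f x - g x) L := by
  refine Nat.sub_eq_of_eq_add ?_
  rw [pack_add]
  exact pack_congr fun x hx => (Nat.sub_add_cancel (h x hx)).symm

theorem pack_zero : pack (fun _ : α => 0) L = 0 := by
  induction L with
  | nil => rfl
  | cons a L ih => rw [pack_cons, ih]

theorem pack_sum {ι : Type*} (s : Finset ι) (F : ι → α → ℕ) :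
    ∑ i ∈ s, pack (F i) L = pack (fun x => ∑ i ∈ s, F i x) L := by
  classical
  induction s using Finset.induction_on with
  | empty =>
    simp [pack_zero]
  | insert a s ha ih => simp only [Finset.sum_insert ha, ih, pack_add]

theorem pack_append : pack f (L ++ L') = pack f L + pack f L' <<< (7 * L.length) := by
  rw [pack, List.map_append, Nat.ofDigits_append, List.length_map, Nat.shiftLeft_eq, pow_mul,
    mul_comm (pack f L')]
  rfl

theorem pack_map {β : Type*} (h : β → α) (M : List β) :
    pack f (M.map h) = pack (fun x => f (h x)) M := by
  rw [pack, List.map_map]; rfl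

theorem land_add_two_pow_mul {i a a' : ℕ} (b b' : ℕ) (ha : a < 2 ^ i) (ha' : a' < 2 ^ i) :
    (a + 2 ^ i * b) &&& (a' + 2 ^ i * b') = (a &&& a') + 2 ^ i * (b &&& b') := by
  apply Nat.eq_of_testBit_eq
  intro j
  have h : a &&& a' < 2 ^ i := lt_of_le_of_lt Nat.and_le_left ha
  rw [Nat.testBit_and, add_comm a, add_comm a', add_comm (a &&& a'),
    Nat.testBit_two_pow_mul_add _ ha, Nat.testBit_two_pow_mul_add _ ha',
    Nat.testBit_two_pow_mul_add _ h]
  split_ifs <;> rw [Nat.testBit_and]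

theorem pack_land {f g : α → ℕ} {L : List α} (hf : ∀ x ∈ L, f x < 128) (hg : ∀ x ∈ L, g x < 128) :
    pack f L &&& pack g L = pack (fun x => f x &&& g x) L := by
  induction L with
  | nil => exact Nat.zero_and 0
  | cons a L ih =>
    simp only [List.mem_cons, forall_eq_or_imp] at hf hg
    simp only [pack_cons, ← ih hf.2 hg.2]
    exact land_add_two_pow_mul (i := 7) _ _ hf.1 hg.1

end Pack

theorem fieldMask_eq (w k : ℕ) (hw : 0 < w) :
    fieldMask w k = Nat.ofDigits (2 ^ (2 * w)) (List.replicate k (2 ^ w - 1)) := by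
  have h1 : 2 ≤ 2 ^ (2 * w) := by
    calc 2 = 2 ^ 1 := rfl
      _ ≤ 2 ^ (2 * w) := Nat.pow_le_pow_right (by norm_num) (by omega)
  have h2 : ∀ k, Nat.ofDigits (2 ^ (2 * w)) (List.replicate k (2 ^ w - 1)) =
      (2 ^ w - 1) * ∑ i ∈ Finset.range k, (2 ^ (2 * w)) ^ i := by
    intro k
    induction k with
    | zero => simp
    | succ k ih =>
      rw [List.replicate_succ, Nat.ofDigits_cons, ih, Finset.sum_range_succ']
      simp only [pow_succ, ← Finset.sum_mul, pow_zero]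
      ring
  rw [h2, Nat.geomSum_eq h1, fieldMask, Nat.one_shiftLeft, pow_mul]

/-- The sums of the consecutive pairs of entries of a list. -/
def pairSums : List ℕ → List ℕ
  | a :: b :: l => (a + b) :: pairSums l
  | l => l

theorem sum_pairSums : ∀ l : List ℕ, (pairSums l).sum = l.sum
  | [] => rfl
  | [_] => rfl
  | a :: b :: l => by simp [pairSums, sum_pairSums l, add_assoc]

theorem length_pairSums : ∀ l : List ℕ, (pairSums l).length ≤ l.length / 2 + 1
  | [] => by simp [pairSums]
  | [_] => by simp [pairSums]
  | a :: b :: l => by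
    have := length_pairSums l
    simp only [pairSums, List.length_cons]
    omega

theorem le_sum_of_mem_pairSums {B : ℕ} :
    ∀ l : List ℕ, (∀ x ∈ l, x ≤ B) → ∀ x ∈ pairSums l, x ≤ 2 * B
  | [], _ => by simp [pairSums]
  | [a], h => by
    simp only [pairSums, List.mem_singleton, forall_eq] at h ⊢
    omega
  | a :: b :: l, h => by
    simp only [pairSums, List.mem_cons, forall_eq_or_imp] at h ⊢
    exact ⟨by omega, le_sum_of_mem_pairSums l h.2.2⟩

theorem widen_ofDigits (w : ℕ) (hw : 0 < w) :
    ∀ (l : List ℕ) (k : ℕ), (∀ x ∈ l, x < 2 ^ w) → l.length < 2 * k + 1 →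
      widen w k (Nat.ofDigits (2 ^ w) l) = Nat.ofDigits (2 ^ (2 * w)) (pairSums l) := by
  -- Here `e` collects the fields in even positions and `2 ^ w * o` those in odd positions; moving
  -- `o` down by one field and adding forms the pair sums.
  have key : ∀ (n : ℕ) (l : List ℕ), l.length ≤ n → ∀ (k : ℕ), (∀ x ∈ l, x < 2 ^ w) →
      l.length < 2 * k + 1 → ∃ e o : ℕ, Nat.ofDigits (2 ^ w) l &&& fieldMask w k = e ∧
        Nat.ofDigits (2 ^ w) l = e + 2 ^ w * o ∧
        Nat.ofDigits (2 ^ (2 * w)) (pairSums l) = e + o := by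
    intro n
    induction n with
    | zero =>
      intro l hn k _ _
      rw [List.length_eq_zero_iff.1 (Nat.le_zero.1 hn)]
      exact ⟨0, 0, by simp, by simp, by simp [pairSums]⟩
    | succ n ih =>
      have hpos : 0 < 2 ^ w := Nat.two_pow_pos w
      have hmod : ∀ x, x &&& (2 ^ w - 1) = x % 2 ^ w := fun x => Nat.and_two_pow_sub_one_eq_mod x w
      have hpw : 2 ^ (2 * w) = 2 ^ w * 2 ^ w := by rw [two_mul, pow_add]
      have hlt : 2 ^ w - 1 < 2 ^ (2 * w) := by rw [hpw]; nlinarith [Nat.sub_lt hpos one_pos]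
      intro l hn k hl hk
      match l, hn, hl, hk with
      | [], _, _, _ => exact ⟨0, 0, by simp, by simp, by simp [pairSums]⟩
      | [a], _, hl, hk =>
        obtain ⟨k, rfl⟩ : ∃ k', k = k' + 1 := ⟨k - 1, by simp at hk; omega⟩
        have ha : a < 2 ^ w := hl a (by simp)
        refine ⟨a, 0, ?_, by simp, by simp [pairSums]⟩
        have := land_add_two_pow_mul (i := 2 * w) 0
          (Nat.ofDigits (2 ^ (2 * w)) (List.replicate k (2 ^ w - 1)))
          (by rw [hpw]; nlinarith : a < 2 ^ (2 * w)) hlt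
        rw [fieldMask_eq w _ hw, List.replicate_succ, Nat.ofDigits_singleton, Nat.ofDigits_cons]
        rw [mul_zero, add_zero, hmod, Nat.mod_eq_of_lt ha, Nat.zero_and, mul_zero, add_zero] at this
        exact this
      | a :: b :: l, hn, hl, hk =>
        simp only [List.mem_cons, forall_eq_or_imp] at hl
        simp only [List.length_cons] at hk hn
        obtain ⟨k, rfl⟩ : ∃ k', k = k' + 1 := ⟨k - 1, by omega⟩
        obtain ⟨e, o, h1, h2, h3⟩ := ih l (by omega) k hl.2.2 (by omega)
        have hab : a + 2 ^ w * b < 2 ^ (2 * w) := by rw [hpw]; nlinarith [hl.1, hl.2.1]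
        have hN : Nat.ofDigits (2 ^ w) (a :: b :: l) =
            (a + 2 ^ w * b) + 2 ^ (2 * w) * Nat.ofDigits (2 ^ w) l := by
          rw [Nat.ofDigits_cons, Nat.ofDigits_cons, hpw]; ring
        refine ⟨a + 2 ^ (2 * w) * e, b + 2 ^ (2 * w) * o, ?_, ?_, ?_⟩
        · rw [hN, fieldMask_eq w _ hw, List.replicate_succ, Nat.ofDigits_cons,
            land_add_two_pow_mul _ _ hab hlt, ← fieldMask_eq w _ hw, h1, hmod,
            Nat.add_mul_mod_self_left, Nat.mod_eq_of_lt hl.1]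
        · rw [hN, h2]; ring
        · rw [pairSums, Nat.ofDigits_cons, h3]; ring
  intro l k hl hk
  obtain ⟨e, o, h1, h2, h3⟩ := key l.length l le_rfl k hl hk
  rw [widen, h1, h3, h2, Nat.add_sub_cancel_left, Nat.shiftRight_eq_div_pow,
    Nat.mul_div_cancel_left _ (Nat.two_pow_pos w)]

/-- The bound on the length keeps the total below `2 ^ 28 - 1`, so that the remainder is the sum
itself. -/
theorem digitSum_pack {α : Type*} {f : α → ℕ} {L : List α} (hf : ∀ x ∈ L, f x ≤ 1)
    (hL : L.length < 2 ^ 20) : digitSum L.length (pack f L) = (L.map f).sum := by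
  set l := L.map f with hl
  have h0 : ∀ x ∈ l, x ≤ 1 := by
    intro x hx
    obtain ⟨a, ha, rfl⟩ := List.mem_map.1 hx
    exact hf a ha
  have h1 := le_sum_of_mem_pairSums l h0
  have hlen : l.length = L.length := List.length_map _
  have e1 := widen_ofDigits 7 (by norm_num) l (L.length / 2 + 1)
    (fun x hx => lt_of_le_of_lt (h0 x hx) (by norm_num)) (by omega)
  have h2 := length_pairSums l
  have e2 := widen_ofDigits 14 (by norm_num) (pairSums l) (L.length / 4 + 1)
    (fun x hx => lt_of_le_of_lt (h1 x hx) (by norm_num)) (by omega)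
  have hs : l.sum ≤ L.length := by
    have := List.sum_le_card_nsmul l 1 h0
    rw [hlen] at this
    simpa using this
  rw [digitSum, show pack f L = Nat.ofDigits (2 ^ 7) l from rfl, e1]
  rw [show 2 ^ (2 * 7) = 2 ^ 14 from rfl, e2, Nat.ofDigits_mod,
    show 2 ^ (2 * 14) % (2 ^ 28 - 1) = 1 from rfl, Nat.ofDigits_one, sum_pairSums, sum_pairSums]
  exact Nat.mod_eq_of_lt (by omega)

/-! ### Lanes as sums of few rows of a matrix. -/

/-- The vector with the binary digits of a number as entries. -/
def digitVec (b : ℕ) : Fin 34 → ZMod 2 := fun j => bitAt b j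

theorem digitVec_apply (b : ℕ) (j : Fin 34) :
    digitVec b j = if b.testBit (33 - j) then 1 else 0 := rfl

theorem bits_eq (b : ℕ) : bits b = List.ofFn fun j : Fin 34 => b.testBit (33 - j) := by
  refine List.ext_getElem ?_ fun i _ _ => ?_
  · simp only [bits, List.length_map, List.length_range, List.length_ofFn]
  · simp only [bits, List.getElem_map, List.getElem_range, List.getElem_ofFn]

theorem digitVec_xor (a b : ℕ) : digitVec (a ^^^ b) = digitVec a + digitVec b := by
  ext j
  simp only [digitVec_apply, Pi.add_apply, Nat.testBit_xor]
  cases a.testBit (33 - j) <;> cases b.testBit (33 - j) <;> decide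

theorem digitVec_zero : digitVec 0 = 0 := by
  ext j
  simp [digitVec_apply]

theorem count_ofFn {n : ℕ} (f : Fin n → Bool) :
    (List.ofFn f).count true = ∑ j, (f j).toNat := by
  induction n with
  | zero => rfl
  | succ n ih =>
    rw [List.ofFn_succ, List.count_cons, ih, Fin.sum_univ_succ, add_comm]
    cases f 0 <;> rfl

theorem popCount_eq (b : ℕ) : popCount b = hammingNorm (digitVec b) := by
  rw [popCount, bits_eq, count_ofFn, BinaryCode.hammingNorm_eq_sum]
  refine Finset.sum_congr rfl fun j _ => ?_
  rw [digitVec_apply]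
  cases b.testBit (33 - j) <;> rfl

theorem popCount_land (a b : ℕ) : (popCount (a &&& b) : ZMod 2) = digitVec a ⬝ᵥ digitVec b := by
  rw [popCount, bits_eq, count_ofFn, dotProduct, Nat.cast_sum]
  refine Finset.sum_congr rfl fun j _ => ?_
  rw [digitVec_apply, digitVec_apply, Nat.testBit_and]
  cases a.testBit (33 - j) <;> cases b.testBit (33 - j) <;> decide

/-- A lane: the size of a set of rows, and the sum of these rows. -/
abbrev Lane := ℕ × (Fin 34 → ZMod 2)

namespace LaneBatch

/-- The batch `B` consists of the lanes in the list `L`. -/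
structure Packs (L : List Lane) (B : LaneBatch) : Prop where
  len : B.len = L.length
  ones : B.ones = pack (fun _ => 1) L
  size : B.size = pack (fun x => x.1) L
  planes : B.planes = List.ofFn fun j : Fin 34 => pack (fun x => (x.2 j).val) L

theorem zipWith_ofFn {α β γ : Type*} {n : ℕ} (g : α → β → γ) (p : Fin n → α) (q : Fin n → β) :
    List.zipWith g (List.ofFn p) (List.ofFn q) = List.ofFn fun j => g (p j) (q j) := by
  refine List.ext_getElem ?_ fun i _ _ => ?_
  · simp only [List.length_zipWith, List.length_ofFn, min_self]
  · simp only [List.getElem_zipWith, List.getElem_ofFn]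

theorem replicate_eq_ofFn {α : Type*} (n : ℕ) (a : α) :
    List.replicate n a = List.ofFn fun _ : Fin n => a := by
  refine List.ext_getElem ?_ fun i _ _ => ?_
  · simp only [List.length_replicate, List.length_ofFn]
  · simp only [List.getElem_replicate, List.getElem_ofFn]

theorem packs_append {L L' : List Lane} {A B : LaneBatch} (hA : Packs L A) (hB : Packs L' B) :
    Packs (L ++ L') (A.append B) where
  len := by rw [append, hA.len, hB.len, List.length_append]
  ones := by rw [append, hA.len, hA.ones, hB.ones, pack_append]
  size := by rw [append, hA.len, hA.size, hB.size, pack_append]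
  planes := by
    rw [append, hA.len, hA.planes, hB.planes, zipWith_ofFn]
    simp only [pack_append]

theorem val_add_vec (a : ZMod 2) (r : ℕ) (j : Fin 34) :
    (a + digitVec r j).val = cond (r.testBit (33 - j)) (1 - a.val) a.val := by
  rw [digitVec_apply]
  cases r.testBit (33 - j) <;> revert a <;> decide

theorem val_le_one (a : ZMod 2) : a.val ≤ 1 := by revert a; decide

theorem cond_sub_pack (L : List Lane) (r : ℕ) (j : Fin 34) :
    cond (r.testBit (33 - j)) (pack (fun _ => 1) L - pack (fun x => (x.2 j).val) L)
      (pack (fun x => (x.2 j).val) L) = pack (fun x => ((x.2 + digitVec r) j).val) L := by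
  rw [pack_sub fun x _ => val_le_one (x.2 j)]
  simp only [Pi.add_apply, val_add_vec]
  cases r.testBit (33 - j) <;> rfl

theorem packs_addRow {L : List Lane} {B : LaneBatch} (hB : Packs L B) (r : ℕ) :
    Packs (L.map fun x => (x.1 + 1, x.2 + digitVec r)) (B.addRow (bits r)) where
  len := by rw [addRow, hB.len, List.length_map]
  ones := by rw [addRow, hB.ones, pack_map]
  size := by rw [addRow, hB.size, hB.ones, pack_map, pack_add]
  planes := by
    rw [addRow, hB.planes, bits_eq, hB.ones, zipWith_ofFn]
    simp only [cond_sub_pack, pack_map]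

theorem packs_empty : Packs [] empty := ⟨rfl, rfl, rfl, replicate_eq_ofFn 34 0⟩

theorem packs_unit : Packs [(0, 0)] unit :=
  ⟨rfl, rfl, rfl, replicate_eq_ofFn 34 0⟩

/-- The step from the lanes for some rows to the lanes with one more row. -/
def laneStep (r : Fin 34 → ZMod 2) : List (List Lane) → List (List Lane)
  | [] => []
  | b :: bs => b :: List.zipWith (· ++ ·) bs
      ((b :: bs).map fun L => L.map fun x => (x.1 + 1, x.2 + r))

theorem forall₂_zipWith {α β α' β' α'' β'' : Type*} {R : α → β → Prop} {R' : α' → β' → Prop}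
    {R'' : α'' → β'' → Prop} {f : α → α' → α''} {g : β → β' → β''}
    (h : ∀ a b a' b', R a b → R' a' b' → R'' (f a a') (g b b')) {l : List α} {m : List β}
    {l' : List α'} {m' : List β'} (h1 : List.Forall₂ R l m) (h2 : List.Forall₂ R' l' m') :
    List.Forall₂ R'' (List.zipWith f l l') (List.zipWith g m m') := by
  induction h1 generalizing l' m' with
  | nil => simp
  | cons hab _ ih =>
    cases h2 with
    | nil => simp
    | cons hab' h2 => exact List.Forall₂.cons (h _ _ _ _ hab hab') (ih h2)

theorem packs_step {Ls : List (List Lane)} {Bs : List LaneBatch} (h : List.Forall₂ Packs Ls Bs)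
    (r : ℕ) : List.Forall₂ Packs (laneStep (digitVec r) Ls) (step (bits r) Bs) := by
  cases h with
  | nil => exact List.Forall₂.nil
  | cons hb hbs =>
    refine List.Forall₂.cons hb (forall₂_zipWith (R := Packs) (R' := Packs)
      (f := (· ++ ·)) (g := append) (fun _ _ _ _ => packs_append) hbs ?_)
    rw [List.forall₂_map_left_iff, List.forall₂_map_right_iff]
    exact (List.Forall₂.cons hb hbs).imp fun _ _ h => packs_addRow h r

/-- The lanes for the sets of at most `t` rows. -/
def lanes (t : ℕ) (rows : List (Fin 34 → ZMod 2)) : List Lane :=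
  (rows.foldr laneStep ([(0, 0)] :: List.replicate t [])).flatten

theorem packs_ofRows (t : ℕ) (rows : List ℕ) :
    Packs (lanes t (rows.map digitVec)) (ofRows t rows) := by
  have h : List.Forall₂ Packs ((rows.map digitVec).foldr laneStep ([(0, 0)] :: List.replicate t []))
      ((rows.map bits).foldr step (unit :: List.replicate t empty)) := by
    induction rows with
    | nil =>
      refine List.Forall₂.cons packs_unit ?_
      induction t with
      | zero => exact List.Forall₂.nil
      | succ t ih => exact List.Forall₂.cons packs_empty ih
    | cons r rows ih => exact packs_step ih r
  rw [lanes, ofRows]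
  generalize (rows.map digitVec).foldr laneStep _ = Ls at h
  generalize (rows.map bits).foldr step _ = Bs at h
  induction h with
  | nil => exact packs_empty
  | cons hb _ ih => exact packs_append hb ih

/-- The lane of a list of rows. -/
def laneOf (S : List (Fin 34 → ZMod 2)) : Lane := (S.length, S.sum)

theorem foldr_laneStep (t : ℕ) (rows : List (Fin 34 → ZMod 2)) :
    rows.foldr laneStep ([(0, 0)] :: List.replicate t []) =
      List.ofFn fun i : Fin (t + 1) => (rows.sublistsLen i).map laneOf := by
  induction rows with
  | nil =>
    rw [List.foldr_nil, List.ofFn_succ, replicate_eq_ofFn]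
    simp [laneOf]
  | cons r rows ih =>
    rw [List.foldr_cons, ih, List.ofFn_succ, List.ofFn_succ, laneStep, ← List.ofFn_succ
      (f := fun i : Fin (t + 1) => (rows.sublistsLen i).map laneOf)]
    congr 1
    · simp
    · refine List.ext_getElem ?_ fun i h1 h2 => ?_
      · simp
      · simp only [List.getElem_zipWith, List.getElem_ofFn, List.getElem_map, Fin.val_succ,
          List.sublistsLen_succ_cons, List.map_append, List.map_map]
        congr 1
        refine List.map_congr_left fun S _ => ?_
        simp [laneOf, add_comm]

theorem countP_lanes (t : ℕ) (rows : List (Fin 34 → ZMod 2)) (P : Lane → Bool) :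
    (lanes t rows).countP P =
      ∑ i ∈ Finset.range (t + 1), (rows.sublistsLen i).countP fun S => P (laneOf S) := by
  rw [lanes, foldr_laneStep, List.countP_flatten, List.map_ofFn, List.sum_ofFn,
    ← Fin.sum_univ_eq_sum_range (fun i => (rows.sublistsLen i).countP fun S => P (laneOf S))]
  refine Finset.sum_congr rfl fun i _ => ?_
  rw [Function.comp_apply, List.countP_map]
  rfl

theorem fst_le_of_mem_lanes {t : ℕ} {rows : List (Fin 34 → ZMod 2)} {x : Lane}
    (hx : x ∈ lanes t rows) : x.1 ≤ t := by
  rw [lanes, foldr_laneStep, List.mem_flatten] at hx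
  obtain ⟨l, hl, hx⟩ := hx
  rw [List.mem_ofFn] at hl
  obtain ⟨i, rfl⟩ := hl
  obtain ⟨S, hS, rfl⟩ := List.mem_map.1 hx
  rw [List.mem_sublistsLen] at hS
  rw [laneOf, hS.2]
  omega

theorem length_lanes (t : ℕ) (rows : List (Fin 34 → ZMod 2)) :
    (lanes t rows).length = ∑ i ∈ Finset.range (t + 1), rows.length.choose i := by
  rw [← List.countP_true, countP_lanes]
  simp

/-- The passage through multisets counts sets of row indices, so equal rows would be counted
separately. -/
theorem countP_sublistsLen {n : ℕ} (i : ℕ) (A : Fin n → Fin 34 → ZMod 2) (P : Lane → Bool) :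
    ((List.ofFn A).sublistsLen i).countP (fun S => P (laneOf S)) =
      ((Finset.univ.powersetCard i).filter fun s => P (s.card, ∑ j ∈ s, A j)).card := by
  have h1 : ((List.ofFn A).sublistsLen i).countP (fun S => P (laneOf S)) =
      (Multiset.powersetCard i (List.ofFn A : Multiset (Fin 34 → ZMod 2))).countP
        (fun m => P (m.card, m.sum)) := by
    rw [Multiset.powersetCard_coe, Multiset.coe_countP, List.countP_map]
    refine List.countP_congr fun S _ => ?_
    simp [laneOf]
  have h2 : (List.ofFn A : Multiset (Fin 34 → ZMod 2)) = Finset.univ.val.map A := by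
    rw [List.ofFn_eq_map]
    rfl
  rw [h1, h2, Multiset.powersetCard_map, ← Finset.map_val_val_powersetCard, Multiset.map_map,
    Multiset.countP_map, Finset.card_def, Finset.filter_val]
  congr 1
  refine Multiset.filter_congr fun s _ => ?_
  simp only [Function.comp_apply, Multiset.card_map, Finset.card_val]
  rfl

open Matrix in
/-- The lanes of the rows of a matrix, counted by means of the vectors of small weight. -/
theorem countP_lanes_eq_ncard {n : ℕ} (t : ℕ) (A : Fin n → Fin 34 → ZMod 2) (P : Lane → Bool) :
    (lanes t (List.ofFn A)).countP P =
      {u : Fin n → ZMod 2 | hammingNorm u ≤ t ∧ P (hammingNorm u, u ᵥ* of A)}.ncard := by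
  classical
  have two : ∀ a : ZMod 2, a = if a ≠ 0 then 1 else 0 := by decide
  have h1 : ∀ i, ((List.ofFn A).sublistsLen i).countP (fun S => P (laneOf S)) =
      (Finset.univ.filter fun u : Fin n → ZMod 2 =>
        hammingNorm u = i ∧ P (hammingNorm u, u ᵥ* of A)).card := by
    intro i
    rw [countP_sublistsLen]
    have hv : ∀ s : Finset (Fin n), (fun j => if j ∈ s then (1 : ZMod 2) else 0) ᵥ* of A =
        ∑ j ∈ s, A j := by
      intro s
      ext k
      simp [Matrix.vecMul, dotProduct, Finset.sum_ite_mem]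
    have hn : ∀ s : Finset (Fin n),
        hammingNorm (fun j => if j ∈ s then (1 : ZMod 2) else 0) = s.card := by
      intro s
      simp [hammingNorm]
    refine Finset.card_nbij' (fun s j => if j ∈ s then (1 : ZMod 2) else 0)
      (fun u => Finset.univ.filter fun j => u j ≠ 0) ?_ ?_ ?_ ?_
    · intro s hs
      simp only [Finset.coe_filter, Finset.mem_powersetCard_univ, Set.mem_ofPred_eq,
        Finset.mem_univ, true_and] at hs ⊢
      rw [hv, hn]
      exact hs
    · intro u hu
      simp only [Finset.coe_filter, Finset.mem_powersetCard_univ, Set.mem_ofPred_eq,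
        Finset.mem_univ, true_and] at hu ⊢
      have hu' : u = fun j => if j ∈ Finset.univ.filter (fun j => u j ≠ 0) then (1 : ZMod 2)
          else 0 := by
        ext j
        simpa using two (u j)
      refine ⟨hu.1, ?_⟩
      rw [← hv, ← hn, ← hu']
      exact hu.2
    · intro s _
      ext j
      simp
    · intro u _
      ext j
      simpa using (two (u j)).symm
  rw [countP_lanes, Finset.sum_congr rfl fun i _ => h1 i]
  have h2 : {u : Fin n → ZMod 2 | hammingNorm u ≤ t ∧ P (hammingNorm u, u ᵥ* of A)} =
      (Finset.univ.filter fun u : Fin n → ZMod 2 =>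
        hammingNorm u ≤ t ∧ P (hammingNorm u, u ᵥ* of A) : Finset _) := by
    ext u
    simp
  rw [h2, Set.ncard_coe_finset, Finset.card_eq_sum_card_fiberwise (f := hammingNorm)
    (t := Finset.range (t + 1))]
  · refine Finset.sum_congr rfl fun i hi => ?_
    congr 1
    ext u
    rw [Finset.mem_range] at hi
    simp only [Finset.mem_filter, Finset.mem_univ, true_and]
    constructor
    · rintro ⟨rfl, h⟩
      exact ⟨⟨by omega, h⟩, rfl⟩
    · rintro ⟨⟨_, h⟩, rfl⟩
      exact ⟨rfl, h⟩
  · intro u hu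
    simp only [Finset.coe_filter, Set.mem_ofPred_eq, Finset.mem_univ, true_and] at hu
    simp only [Finset.coe_range, Set.mem_Iio]
    omega

section Count

variable {L : List Lane} {B : LaneBatch}

theorem maskSum_ofFn {n : ℕ} (f : Fin n → Bool) (p : Fin n → ℕ) :
    maskSum (List.ofFn f) (List.ofFn p) = ∑ j, cond (f j) (p j) 0 := by
  induction n with
  | zero => rfl
  | succ n ih =>
    rw [List.ofFn_succ, List.ofFn_succ, maskSum, ih, Fin.sum_univ_succ]
    cases f 0
    · exact (zero_add _).symm
    · rfl

theorem maskSum_eq (hB : Packs L B) (b : ℕ) :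
    maskSum (bits b) B.planes = pack (fun x => ∑ j, (x.2 j * digitVec b j).val) L := by
  have h1 : ∀ j : Fin 34, cond (b.testBit (33 - j)) (pack (fun x : Lane => (x.2 j).val) L) 0 =
      pack (fun x => (x.2 j * digitVec b j).val) L := by
    intro j
    rw [digitVec_apply]
    cases b.testBit (33 - j)
    · simp only [cond_false, Bool.false_eq_true, if_false, mul_zero, ZMod.val_zero, pack_zero]
    · simp only [cond_true, if_true, mul_one]
  rw [hB.planes, bits_eq, maskSum_ofFn]
  simp only [h1, pack_sum]

/-- The weight of a sum is the sum of the weights minus twice the overlap, for all lanes at once;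
the truncated subtraction is exact in every digit. -/
theorem weights_eq (hB : Packs L B) (r : ℕ) :
    B.weights r = pack (fun x => x.1 + hammingNorm (x.2 + digitVec r)) L := by
  have key : ∀ a b : ZMod 2, (a + b).val + 2 * (a * b).val = a.val + b.val := by decide
  have h1 : ∀ x : Lane, hammingNorm (x.2 + digitVec r) + 2 * ∑ j, (x.2 j * digitVec r j).val =
      ∑ j, (x.2 j).val + popCount r := by
    intro x
    simp only [popCount_eq, BinaryCode.hammingNorm_eq_sum, Finset.mul_sum,
      ← Finset.sum_add_distrib, Pi.add_apply, key]
  rw [weights, hB.size, hB.ones, maskSum_eq hB, hB.planes, List.sum_ofFn]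
  simp only [pack_sum, pack_mul, pack_add]
  rw [pack_sub]
  · refine pack_congr fun x _ => ?_
    have := h1 x
    omega
  · intro x _
    have := h1 x
    omega

/-- The overlap is at most 34, so with `c ≤ 64` the digits stay below 128 and do not carry. -/
theorem parity_eq (hB : Packs L B) (b : ℕ) {c : ℕ} (hc : c ≤ 64) :
    B.parity b c = pack (fun x => (x.2 ⬝ᵥ digitVec b + (c : ZMod 2)).val) L := by
  rw [parity, hB.ones, maskSum_eq hB]
  simp only [pack_mul, pack_add]
  rw [pack_land]
  · refine pack_congr fun x _ => ?_
    rw [Nat.and_one_is_mod, mul_one, ← ZMod.val_natCast, Nat.cast_add, Nat.cast_sum]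
    simp only [ZMod.natCast_val, ZMod.cast_id', id_eq]
    rfl
  · intro x _
    have := Finset.sum_le_card_nsmul Finset.univ (fun j : Fin 34 => (x.2 j * digitVec b j).val) 1
      fun j _ => val_le_one _
    rw [Finset.card_univ, Fintype.card_fin, smul_eq_mul] at this
    omega
  · intro x _
    norm_num

theorem above_eq (hB : Packs L B) {w : Lane → ℕ} (hw : ∀ x ∈ L, w x ≤ 64) {m : ℕ} (hm : m ≤ 63) :
    B.above (pack w L) m = pack (fun x => if m < w x then 1 else 0) L := by
  have h64 : ∀ v < 128, v &&& 64 = 64 * if 64 ≤ v then 1 else 0 := by decide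
  rw [above, hB.ones, pack_mul, pack_add, Nat.shiftLeft_eq, mul_comm (pack _ _), pack_mul,
    pack_land]
  · rw [show pack (fun x => w x + (63 - m) * 1 &&& 2 ^ 6 * 1) L =
      2 ^ 6 * pack (fun x => if m < w x then 1 else 0) L by
        rw [pack_mul]
        refine pack_congr fun x hx => ?_
        have := hw x hx
        rw [show 2 ^ 6 * 1 = 64 from rfl, h64 _ (by omega)]
        congr 1
        by_cases h : m < w x
        · rw [if_pos h, if_pos (by omega)]
        · rw [if_neg h, if_neg (by omega)]]
    rw [Nat.shiftRight_eq_div_pow, Nat.mul_div_cancel_left _ (by norm_num)]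
  · intro x hx
    have := hw x hx
    omega
  · intro x _
    norm_num

theorem sum_map_ite {α : Type*} (L : List α) (P : α → Prop) [DecidablePred P] :
    (L.map fun x => if P x then 1 else 0).sum = L.countP fun x => P x := by
  induction L with
  | nil => rfl
  | cons a L ih =>
    rw [List.map_cons, List.sum_cons, ih, List.countP_cons, add_comm]
    by_cases h : P a <;> simp [h]

theorem ite_land_val (P : Prop) [Decidable P] (a : ZMod 2) :
    (if P then 1 else 0) &&& a.val = if P ∧ a = 1 then 1 else 0 := by
  have hp : ∀ a : ZMod 2, 1 &&& a.val = if a = 1 then 1 else 0 := by decide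
  by_cases h : P
  · simp only [h, if_true, true_and, hp]
  · simp only [h, if_false, false_and, Nat.zero_and]

theorem digitSum_land (hB : Packs L B) (hL : L.length < 2 ^ 20) (P : Lane → Prop)
    [DecidablePred P] (p : Lane → ZMod 2) :
    digitSum B.len (pack (fun x => if P x then 1 else 0) L &&& pack (fun x => (p x).val) L) =
      L.countP fun x => P x ∧ p x = 1 := by
  rw [pack_land, hB.len]
  · simp only [ite_land_val]
    rw [digitSum_pack _ hL, sum_map_ite]
    intro x _
    split_ifs <;> norm_num
  · intro x _
    split_ifs <;> norm_num
  · intro x _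
    exact lt_of_le_of_lt (val_le_one _) (by norm_num)

theorem countEq_eq (hB : Packs L B) (hL : L.length < 2 ^ 20) {w : Lane → ℕ}
    (hw : ∀ x ∈ L, w x ≤ 64) (p : Lane → ZMod 2) {m : ℕ} (h0 : 0 < m) (hm : m ≤ 63) :
    B.countEq (pack w L) (pack (fun x => (p x).val) L) m =
      L.countP fun x => w x = m ∧ p x = 1 := by
  rw [countEq, above_eq hB hw hm, above_eq hB hw (m := m - 1) (by omega), pack_sub,
    ← digitSum_land hB hL]
  · congr 2
    refine pack_congr fun x _ => ?_
    split_ifs <;> omega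
  · intro x _
    split_ifs <;> omega

theorem countLe_eq (hB : Packs L B) (hL : L.length < 2 ^ 20) {w : Lane → ℕ}
    (hw : ∀ x ∈ L, w x ≤ 64) (p : Lane → ZMod 2) {m : ℕ} (hm : m ≤ 63) :
    B.countLe (pack w L) (pack (fun x => (p x).val) L) m =
      L.countP fun x => w x ≤ m ∧ p x = 1 := by
  rw [countLe, above_eq hB hw hm, hB.ones, pack_sub, ← digitSum_land hB hL]
  · congr 2
    refine pack_congr fun x _ => ?_
    split_ifs <;> omega
  · intro x _
    split_ifs <;> omega

end Count

end LaneBatch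

/-! ### Codes in standard form and the two parametrisations of their cosets. -/

open Matrix

/-- The matrix whose rows have the digits of the members of a list. -/
def matrixOf (rows : List ℕ) : Matrix (Fin 34) (Fin 34) (ZMod 2) :=
  of fun i => digitVec (rows.getD i 0)

theorem map_digitVec {rows : List ℕ} (h : rows.length = 34) :
    rows.map digitVec = List.ofFn fun i : Fin 34 => digitVec (rows.getD i 0) := by
  refine List.ext_getElem ?_ fun i hi _ => ?_
  · rw [List.length_map, List.length_ofFn, h]
  · rw [List.length_map] at hi
    rw [List.getElem_map, List.getElem_ofFn, List.getD_eq_getElem _ _ hi]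

theorem digitVec_rowSum {rows : List ℕ} (h : rows.length = 34) (b : ℕ) :
    digitVec (rowSum rows b) = digitVec b ᵥ* matrixOf rows := by
  have h1 : ∀ l : List ℕ, digitVec (l.foldr (· ^^^ ·) 0) = (l.map digitVec).sum := by
    intro l
    induction l with
    | nil => exact digitVec_zero
    | cons a l ih => rw [List.foldr_cons, digitVec_xor, ih, List.map_cons, List.sum_cons]
  have h2 : rows = List.ofFn fun i : Fin 34 => rows.getD i 0 := by
    refine List.ext_getElem ?_ fun i hi _ => ?_
    · rw [List.length_ofFn, h]
    · rw [List.getElem_ofFn, List.getD_eq_getElem _ _ hi]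
  rw [rowSum, h1, bits_eq]
  conv_lhs => rw [h2]
  rw [LaneBatch.zipWith_ofFn, List.map_ofFn, List.sum_ofFn]
  ext j
  rw [Finset.sum_apply, vecMul, dotProduct]
  refine Finset.sum_congr rfl fun i _ => ?_
  rw [Function.comp_apply, matrixOf, of_apply, digitVec_apply b]
  cases b.testBit (33 - i)
  · simp only [cond_false, digitVec_zero, Pi.zero_apply, Bool.false_eq_true, if_false, zero_mul]
  · simp only [cond_true, if_true, one_mul]

section Parts

variable (π : Equiv.Perm (Fin 68))

/-- The first 34 coordinates, after a permutation of the coordinates. -/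
def leftPart (y : Fin 68 → ZMod 2) : Fin 34 → ZMod 2 := fun j => y (π (Fin.castAdd 34 j))

/-- The last 34 coordinates, after a permutation of the coordinates. -/
def rightPart (y : Fin 68 → ZMod 2) : Fin 34 → ZMod 2 := fun j => y (π (Fin.natAdd 34 j))

/-- The vector with given first and last 34 coordinates, after a permutation. -/
def join (u v : Fin 34 → ZMod 2) : Fin 68 → ZMod 2 :=
  fun i => Fin.addCases (motive := fun _ : Fin (34 + 34) => ZMod 2) u v (π.symm i)

@[simp] theorem leftPart_join (u v : Fin 34 → ZMod 2) : leftPart π (join π u v) = u := by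
  ext j
  rw [leftPart, join, Equiv.symm_apply_apply]
  exact Fin.addCases_left j

@[simp] theorem rightPart_join (u v : Fin 34 → ZMod 2) : rightPart π (join π u v) = v := by
  ext j
  rw [rightPart, join, Equiv.symm_apply_apply]
  exact Fin.addCases_right j

theorem parts_ext {y z : Fin 68 → ZMod 2} (h1 : leftPart π y = leftPart π z)
    (h2 : rightPart π y = rightPart π z) : y = z := by
  ext i
  obtain ⟨j, rfl⟩ := π.surjective i
  refine Fin.addCases (m := 34) (n := 34)
    (motive := fun j : Fin (34 + 34) => y (π j) = z (π j)) (fun j => ?_) (fun j => ?_) j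
  · exact congrFun h1 j
  · exact congrFun h2 j

theorem sum_parts {M : Type*} [AddCommMonoid M] (f : Fin 68 → M) :
    ∑ i, f i = ∑ j : Fin 34, f (π (Fin.castAdd 34 j)) + ∑ j : Fin 34, f (π (Fin.natAdd 34 j)) := by
  rw [← Equiv.sum_comp π f]
  exact Fin.sum_univ_add (a := 34) (b := 34) fun i => f (π i)

theorem hammingNorm_parts (y : Fin 68 → ZMod 2) :
    hammingNorm y = hammingNorm (leftPart π y) + hammingNorm (rightPart π y) := by
  simp only [BinaryCode.hammingNorm_eq_sum, sum_parts π, leftPart, rightPart]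

theorem dotProduct_parts (y z : Fin 68 → ZMod 2) :
    y ⬝ᵥ z = leftPart π y ⬝ᵥ leftPart π z + rightPart π y ⬝ᵥ rightPart π z := by
  simp only [dotProduct, sum_parts π, leftPart, rightPart]

theorem leftPart_add (y z : Fin 68 → ZMod 2) :
    leftPart π (y + z) = leftPart π y + leftPart π z := rfl

theorem rightPart_add (y z : Fin 68 → ZMod 2) :
    rightPart π (y + z) = rightPart π y + rightPart π z := rfl

theorem join_add (u v u' v' : Fin 34 → ZMod 2) :
    join π (u + u') (v + v') = join π u v + join π u' v' := by
  apply parts_ext π <;> simp [leftPart_add, rightPart_add]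

end Parts

/-- The code with generator matrix `(I | A)`, after a permutation of the coordinates. -/
def stdCode (π : Equiv.Perm (Fin 68)) (rows : List ℕ) : BinaryCode 68 where
  carrier := {y | rightPart π y = leftPart π y ᵥ* matrixOf rows}
  add_mem' := by
    intro a b ha hb
    simp only [Set.mem_ofPred_eq, leftPart_add, rightPart_add, add_vecMul] at *
    rw [ha, hb]
  zero_mem' := by
    change (0 : Fin 34 → ZMod 2) = (0 : Fin 34 → ZMod 2) ᵥ* _
    rw [zero_vecMul]
  smul_mem' := by
    intro c a ha
    change c • rightPart π a = (c • leftPart π a) ᵥ* _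
    rw [smul_vecMul, ← show rightPart π a = leftPart π a ᵥ* matrixOf rows from ha]

theorem mem_stdCode {π : Equiv.Perm (Fin 68)} {rows : List ℕ} {y : Fin 68 → ZMod 2} :
    y ∈ stdCode π rows ↔ rightPart π y = leftPart π y ᵥ* matrixOf rows := Iff.rfl

/-- The rows of the generator matrix `(I | A)`. -/
def stdRow (π : Equiv.Perm (Fin 68)) (rows : List ℕ) (i : Fin 34) : Fin 68 → ZMod 2 :=
  join π (Pi.single i 1) (digitVec (rows.getD i 0))

theorem stdRow_mem (π : Equiv.Perm (Fin 68)) (rows : List ℕ) (i : Fin 34) :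
    stdRow π rows i ∈ stdCode π rows := by
  rw [mem_stdCode, stdRow, leftPart_join, rightPart_join, single_one_vecMul]
  rfl

theorem stdCode_le {π : Equiv.Perm (Fin 68)} {rows : List ℕ} {D : BinaryCode 68}
    (h : ∀ i, stdRow π rows i ∈ D) : stdCode π rows ≤ D := by
  intro y hy
  have : y = ∑ i, leftPart π y i • stdRow π rows i := by
    have h1 : ∀ f : Fin 34 → ZMod 2, leftPart π (∑ i, f i • stdRow π rows i) = f := by
      intro f
      ext j
      have : ∀ i, stdRow π rows i (π (Fin.castAdd 34 j)) = (Pi.single i 1 : Fin 34 → ZMod 2) j :=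
        fun i => congrFun (leftPart_join π (Pi.single i 1) (digitVec (rows.getD i 0))) j
      simp only [leftPart, Finset.sum_apply, Pi.smul_apply, this, smul_eq_mul]
      simp [Pi.single_apply]
    have h2 : ∑ i, leftPart π y i • stdRow π rows i ∈ stdCode π rows :=
      Submodule.sum_mem _ fun i _ => Submodule.smul_mem _ _ (stdRow_mem π rows i)
    refine parts_ext π (h1 _).symm ?_
    rw [mem_stdCode.1 h2, mem_stdCode.1 hy, h1]
  rw [this]
  exact Submodule.sum_mem _ fun i _ => Submodule.smul_mem _ _ (h i)

/-- The rows of a matrix `A` and of its transpose, where `A Aᵀ = 1`. -/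
structure IsOrthogonal (rows rowsT : List ℕ) : Prop where
  length : rows.length = 34
  lengthT : rowsT.length = 34
  transpose : matrixOf rowsT = (matrixOf rows)ᵀ
  mul_transpose : matrixOf rows * (matrixOf rows)ᵀ = 1

namespace IsOrthogonal

variable {rows rowsT : List ℕ}

theorem mul_one' (h : IsOrthogonal rows rowsT) : matrixOf rows * matrixOf rowsT = 1 :=
  h.transpose ▸ h.mul_transpose

theorem one_mul' (h : IsOrthogonal rows rowsT) : matrixOf rowsT * matrixOf rows = 1 := by
  have h1 := h.mul_one'
  generalize matrixOf rows = M at h1 ⊢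
  generalize matrixOf rowsT = N at h1 ⊢
  exact (mul_eq_one_comm_of_equiv (Equiv.refl _)).1 h1

theorem dotProduct_vecMul (h : IsOrthogonal rows rowsT) (u v : Fin 34 → ZMod 2) :
    u ᵥ* matrixOf rows ⬝ᵥ v ᵥ* matrixOf rows = u ⬝ᵥ v := by
  rw [← dotProduct_mulVec, ← mulVec_transpose (matrixOf rows), mulVec_mulVec, h.mul_transpose,
    one_mulVec]

theorem dotProduct_vecMulT (h : IsOrthogonal rows rowsT) (u v : Fin 34 → ZMod 2) :
    u ᵥ* matrixOf rowsT ⬝ᵥ v ᵥ* matrixOf rowsT = u ⬝ᵥ v := by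
  have := h.dotProduct_vecMul (u ᵥ* matrixOf rowsT) (v ᵥ* matrixOf rowsT)
  rw [vecMul_vecMul, vecMul_vecMul, h.one_mul', vecMul_one, vecMul_one] at this
  exact this.symm

/-- This exchanges the roles of the two halves: a coset is a graph over the left part by means of
`A`, and over the right part by means of `Aᵀ`. -/
theorem vecMul_eq_iff (h : IsOrthogonal rows rowsT) (u v w : Fin 34 → ZMod 2) :
    v = u ᵥ* matrixOf rows + w ↔ u = v ᵥ* matrixOf rowsT + w ᵥ* matrixOf rowsT := by
  have hw : ∀ z : Fin 34 → ZMod 2, z + w + w = z := fun z => by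
    rw [add_assoc, BinaryCode.add_self_eq_zero, add_zero]
  constructor
  · rintro rfl
    rw [← add_vecMul, hw, vecMul_vecMul, h.mul_one', vecMul_one]
  · rintro rfl
    rw [← add_vecMul, vecMul_vecMul, h.one_mul', vecMul_one, hw]

theorem isSelfDual (h : IsOrthogonal rows rowsT) (π : Equiv.Perm (Fin 68)) :
    (stdCode π rows).IsSelfDual := by
  apply le_antisymm
  · intro y hy z hz
    rw [dotProduct_parts π, mem_stdCode.1 hy, mem_stdCode.1 hz, h.dotProduct_vecMul]
    exact CharTwo.add_self_eq_zero _
  · intro y hy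
    have h1 : leftPart π y = rightPart π y ᵥ* matrixOf rowsT := by
      ext i
      have := hy _ (stdRow_mem π rows i)
      rw [dotProduct_parts π, stdRow, leftPart_join, rightPart_join, dotProduct_single_one] at this
      rw [h.transpose, vecMul_transpose]
      have e := eq_neg_of_add_eq_zero_left this
      rw [CharTwo.neg_eq, dotProduct_comm] at e
      exact e
    rw [mem_stdCode, h1, vecMul_vecMul, h.one_mul', vecMul_one]

end IsOrthogonal

/-- The vectors `y` in the coset of `(0, r)` with `y ⬝ᵥ (0, b) = ε`. -/
def cosetPart (π : Equiv.Perm (Fin 68)) (rows : List ℕ) (r b : Fin 34 → ZMod 2) (ε : ZMod 2) :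
    Set (Fin 68 → ZMod 2) :=
  {y | y + join π 0 r ∈ stdCode π rows ∧ y ⬝ᵥ join π 0 b = ε}

section Coset

variable {π : Equiv.Perm (Fin 68)} {rows rowsT : List ℕ} {r b : Fin 34 → ZMod 2} {ε : ZMod 2}

theorem mem_cosetPart {y : Fin 68 → ZMod 2} : y ∈ cosetPart π rows r b ε ↔
    rightPart π y = leftPart π y ᵥ* matrixOf rows + r ∧ rightPart π y ⬝ᵥ b = ε := by
  have h1 : rightPart π y + r = leftPart π y ᵥ* matrixOf rows ↔
      rightPart π y = leftPart π y ᵥ* matrixOf rows + r := by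
    constructor
    · intro e
      rw [← e, add_assoc, BinaryCode.add_self_eq_zero, add_zero]
    · intro e
      rw [e, add_assoc, BinaryCode.add_self_eq_zero, add_zero]
  rw [cosetPart, Set.mem_ofPred_eq, mem_stdCode, rightPart_add, leftPart_add, leftPart_join,
    rightPart_join, add_zero, h1, dotProduct_parts π, leftPart_join, rightPart_join,
    dotProduct_zero, zero_add]

theorem ncard_cosetPart_left (t : ℕ) (P : ℕ → Prop) :
    {y ∈ cosetPart π rows r b ε | hammingNorm (leftPart π y) ≤ t ∧ P (hammingNorm y)}.ncard =
      {u : Fin 34 → ZMod 2 | hammingNorm u ≤ t ∧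
        P (hammingNorm u + hammingNorm (u ᵥ* matrixOf rows + r)) ∧
        u ᵥ* matrixOf rows ⬝ᵥ b + (1 + ε + r ⬝ᵥ b) = 1}.ncard := by
  -- The condition is normalised to an equation with value 1, the form in which the packed masks
  -- test it.
  have hε : ∀ a c ε : ZMod 2, a + c = ε ↔ a + (1 + ε + c) = 1 := by decide
  refine Set.ncard_congr (fun y _ => leftPart π y) ?_ ?_ ?_
  · rintro y ⟨hy, h1, h2⟩
    obtain ⟨h3, h4⟩ := mem_cosetPart.1 hy
    rw [hammingNorm_parts π, h3] at h2
    rw [h3, add_dotProduct, hε] at h4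
    exact ⟨h1, h2, h4⟩
  · rintro y z ⟨hy, _⟩ ⟨hz, _⟩ hyz
    refine parts_ext π hyz ?_
    rw [(mem_cosetPart.1 hy).1, (mem_cosetPart.1 hz).1, hyz]
  · rintro u ⟨h1, h2, h3⟩
    refine ⟨join π u (u ᵥ* matrixOf rows + r), ⟨mem_cosetPart.2 ?_, ?_⟩, leftPart_join π _ _⟩
    · rw [leftPart_join, rightPart_join, add_dotProduct, hε]
      exact ⟨rfl, h3⟩
    · rw [hammingNorm_parts π, leftPart_join, rightPart_join]
      exact ⟨h1, h2⟩

theorem ncard_cosetPart_right (h : IsOrthogonal rows rowsT) (t : ℕ) (P : ℕ → Prop) :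
    {y ∈ cosetPart π rows r b ε | hammingNorm (rightPart π y) ≤ t ∧ P (hammingNorm y)}.ncard =
      {v : Fin 34 → ZMod 2 | hammingNorm v ≤ t ∧
        P (hammingNorm v + hammingNorm (v ᵥ* matrixOf rowsT + r ᵥ* matrixOf rowsT)) ∧
        v ᵥ* matrixOf rowsT ⬝ᵥ b ᵥ* matrixOf rowsT + (1 + ε) = 1}.ncard := by
  have hε : ∀ a ε : ZMod 2, a = ε ↔ a + (1 + ε) = 1 := by decide
  refine Set.ncard_congr (fun y _ => rightPart π y) ?_ ?_ ?_
  · rintro y ⟨hy, h1, h2⟩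
    obtain ⟨h3, h4⟩ := mem_cosetPart.1 hy
    rw [h.vecMul_eq_iff] at h3
    rw [hammingNorm_parts π, h3, add_comm] at h2
    rw [hε, ← h.dotProduct_vecMulT] at h4
    exact ⟨h1, h2, h4⟩
  · rintro y z ⟨hy, _⟩ ⟨hz, _⟩ hyz
    refine parts_ext π ?_ hyz
    have hy' := (mem_cosetPart.1 hy).1
    have hz' := (mem_cosetPart.1 hz).1
    rw [h.vecMul_eq_iff] at hy' hz'
    rw [hy', hz', hyz]
  · rintro v ⟨h1, h2, h3⟩
    rw [h.dotProduct_vecMulT, ← hε] at h3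
    refine ⟨join π (v ᵥ* matrixOf rowsT + r ᵥ* matrixOf rowsT) v, ⟨mem_cosetPart.2 ?_, ?_⟩,
      rightPart_join π _ _⟩
    · rw [leftPart_join, rightPart_join, h.vecMul_eq_iff]
      exact ⟨rfl, h3⟩
    · rw [hammingNorm_parts π, leftPart_join, rightPart_join, add_comm]
      exact ⟨h1, h2⟩

end Coset

/-! ### Counting vectors of small weight in a coset by the packed computation. -/

namespace LaneBatch

variable {t : ℕ} {rows : List ℕ}

/-- For `t = 5` there are 331212 lanes. -/
theorem length_lanes_lt (ht : t ≤ 5) (hr : rows.length = 34) :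
    (lanes t (rows.map digitVec)).length < 2 ^ 20 := by
  rw [length_lanes, List.length_map, hr]
  interval_cases t <;> decide

theorem lane_weight_le (ht : t ≤ 5) (r : ℕ) :
    ∀ x ∈ lanes t (rows.map digitVec), x.1 + hammingNorm (x.2 + digitVec r) ≤ 64 := by
  intro x hx
  have h1 := fst_le_of_mem_lanes hx
  have h2 := hammingNorm_le_card_fintype (x := x.2 + digitVec r)
  rw [Fintype.card_fin] at h2
  omega

theorem countEq_ofRows (ht : t ≤ 5) (hr : rows.length = 34) (r b : ℕ) {c m : ℕ} (hc : c ≤ 64)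
    (h0 : 0 < m) (hm : m ≤ 63) :
    (ofRows t rows).countEq ((ofRows t rows).weights r) ((ofRows t rows).parity b c) m =
      (lanes t (rows.map digitVec)).countP fun x =>
        x.1 + hammingNorm (x.2 + digitVec r) = m ∧ x.2 ⬝ᵥ digitVec b + (c : ZMod 2) = 1 := by
  rw [weights_eq (packs_ofRows t rows), parity_eq (packs_ofRows t rows) b hc]
  exact countEq_eq (packs_ofRows t rows) (length_lanes_lt ht hr) (lane_weight_le ht r) _ h0 hm

theorem countLe_ofRows (ht : t ≤ 5) (hr : rows.length = 34) (r b : ℕ) {c m : ℕ} (hc : c ≤ 64)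
    (hm : m ≤ 63) :
    (ofRows t rows).countLe ((ofRows t rows).weights r) ((ofRows t rows).parity b c) m =
      (lanes t (rows.map digitVec)).countP fun x =>
        x.1 + hammingNorm (x.2 + digitVec r) ≤ m ∧ x.2 ⬝ᵥ digitVec b + (c : ZMod 2) = 1 := by
  rw [weights_eq (packs_ofRows t rows), parity_eq (packs_ofRows t rows) b hc]
  exact countLe_eq (packs_ofRows t rows) (length_lanes_lt ht hr) (lane_weight_le ht r) _ hm

theorem countP_lanes_matrixOf (hr : rows.length = 34) (t : ℕ) (P : Lane → Prop)
    [DecidablePred P] :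
    (lanes t (rows.map digitVec)).countP (fun x => P x) =
      {u : Fin 34 → ZMod 2 | hammingNorm u ≤ t ∧ P (hammingNorm u, u ᵥ* matrixOf rows)}.ncard := by
  rw [map_digitVec hr, countP_lanes_eq_ncard]
  simp only [decide_eq_true_eq]
  rfl

end LaneBatch

section Count

variable {π : Equiv.Perm (Fin 68)} {rows rowsT : List ℕ} {r r' b b' c c' : ℕ} {ε : ZMod 2}

theorem countP_left (h : IsOrthogonal rows rowsT) (t : ℕ) (P : ℕ → Prop) [DecidablePred P]
    (hc : (c : ZMod 2) = 1 + ε + digitVec r ⬝ᵥ digitVec b) :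
    ((LaneBatch.lanes t (rows.map digitVec)).countP fun x =>
        P (x.1 + hammingNorm (x.2 + digitVec r)) ∧ x.2 ⬝ᵥ digitVec b + (c : ZMod 2) = 1) =
      {y ∈ cosetPart π rows (digitVec r) (digitVec b) ε |
        hammingNorm (leftPart π y) ≤ t ∧ P (hammingNorm y)}.ncard := by
  rw [ncard_cosetPart_left, ← hc]
  exact LaneBatch.countP_lanes_matrixOf h.length t fun x : Lane =>
    P (x.1 + hammingNorm (x.2 + digitVec r)) ∧ x.2 ⬝ᵥ digitVec b + (c : ZMod 2) = 1

theorem countP_right (h : IsOrthogonal rows rowsT) (t : ℕ) (P : ℕ → Prop) [DecidablePred P]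
    (hr : digitVec r' = digitVec r ᵥ* matrixOf rowsT)
    (hb : digitVec b' = digitVec b ᵥ* matrixOf rowsT) (hc : (c' : ZMod 2) = 1 + ε) :
    ((LaneBatch.lanes t (rowsT.map digitVec)).countP fun x =>
        P (x.1 + hammingNorm (x.2 + digitVec r')) ∧ x.2 ⬝ᵥ digitVec b' + (c' : ZMod 2) = 1) =
      {y ∈ cosetPart π rows (digitVec r) (digitVec b) ε |
        hammingNorm (rightPart π y) ≤ t ∧ P (hammingNorm y)}.ncard := by
  rw [ncard_cosetPart_right h, ← hc, ← hr, ← hb]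
  exact LaneBatch.countP_lanes_matrixOf h.lengthT t fun x : Lane =>
    P (x.1 + hammingNorm (x.2 + digitVec r')) ∧ x.2 ⬝ᵥ digitVec b' + (c' : ZMod 2) = 1

/-- The part of a coset with at most 5 ones on the left. -/
theorem countEq_left (h : IsOrthogonal rows rowsT)
    (hc : (c : ZMod 2) = 1 + ε + digitVec r ⬝ᵥ digitVec b) (hc' : c ≤ 64) {m : ℕ} (h0 : 0 < m)
    (hm : m ≤ 63) :
    (LaneBatch.ofRows 5 rows).countEq ((LaneBatch.ofRows 5 rows).weights r)
        ((LaneBatch.ofRows 5 rows).parity b c) m =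
      {y ∈ cosetPart π rows (digitVec r) (digitVec b) ε |
        hammingNorm (leftPart π y) ≤ 5 ∧ hammingNorm y = m}.ncard := by
  rw [LaneBatch.countEq_ofRows le_rfl h.length r b hc' h0 hm]
  exact countP_left h 5 (· = m) hc

theorem countLe_left (h : IsOrthogonal rows rowsT)
    (hc : (c : ZMod 2) = 1 + ε + digitVec r ⬝ᵥ digitVec b) (hc' : c ≤ 64) {m : ℕ} (hm : m ≤ 63) :
    (LaneBatch.ofRows 5 rows).countLe ((LaneBatch.ofRows 5 rows).weights r)
        ((LaneBatch.ofRows 5 rows).parity b c) m =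
      {y ∈ cosetPart π rows (digitVec r) (digitVec b) ε |
        hammingNorm (leftPart π y) ≤ 5 ∧ hammingNorm y ≤ m}.ncard := by
  rw [LaneBatch.countLe_ofRows le_rfl h.length r b hc' hm]
  exact countP_left h 5 (· ≤ m) hc

/-- The part of a coset with at most 4 ones on the right. -/
theorem countEq_right (h : IsOrthogonal rows rowsT)
    (hr : digitVec r' = digitVec r ᵥ* matrixOf rowsT)
    (hb : digitVec b' = digitVec b ᵥ* matrixOf rowsT) (hc : (c' : ZMod 2) = 1 + ε)
    (hc' : c' ≤ 64) {m : ℕ} (h0 : 0 < m) (hm : m ≤ 63) :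
    (LaneBatch.ofRows 4 rowsT).countEq ((LaneBatch.ofRows 4 rowsT).weights r')
        ((LaneBatch.ofRows 4 rowsT).parity b' c') m =
      {y ∈ cosetPart π rows (digitVec r) (digitVec b) ε |
        hammingNorm (rightPart π y) ≤ 4 ∧ hammingNorm y = m}.ncard := by
  rw [LaneBatch.countEq_ofRows (by norm_num) h.lengthT r' b' hc' h0 hm]
  exact countP_right h 4 (· = m) hr hb hc

theorem countLe_right (h : IsOrthogonal rows rowsT)
    (hr : digitVec r' = digitVec r ᵥ* matrixOf rowsT)
    (hb : digitVec b' = digitVec b ᵥ* matrixOf rowsT) (hc : (c' : ZMod 2) = 1 + ε)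
    (hc' : c' ≤ 64) {m : ℕ} (hm : m ≤ 63) :
    (LaneBatch.ofRows 4 rowsT).countLe ((LaneBatch.ofRows 4 rowsT).weights r')
        ((LaneBatch.ofRows 4 rowsT).parity b' c') m =
      {y ∈ cosetPart π rows (digitVec r) (digitVec b) ε |
        hammingNorm (rightPart π y) ≤ 4 ∧ hammingNorm y ≤ m}.ncard := by
  rw [LaneBatch.countLe_ofRows (by norm_num) h.lengthT r' b' hc' hm]
  exact countP_right h 4 (· ≤ m) hr hb hc

open BinaryCode

theorem weightCountOn_two (h : IsOrthogonal rows rowsT)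
    (hc : (c : ZMod 2) = 1 + ε + digitVec r ⬝ᵥ digitVec b) (hc' : c ≤ 64) :
    weightCountOn (cosetPart π rows (digitVec r) (digitVec b) ε) 2 =
      (LaneBatch.ofRows 5 rows).countEq ((LaneBatch.ofRows 5 rows).weights r)
        ((LaneBatch.ofRows 5 rows).parity b c) 2 := by
  rw [countEq_left (π := π) h hc hc' (by norm_num) (by norm_num), weightCountOn]
  congr 1
  ext y
  have := hammingNorm_parts π y
  simp only [Set.mem_ofPred_eq]
  refine and_congr_right fun _ => ?_
  omega

/-- The list from the left could miss only vectors with zero right part. The only such vector the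
coset can contain has left part `r'`, and this does not have weight 6. -/
theorem weightCountOn_six (h : IsOrthogonal rows rowsT)
    (hr : digitVec r' = digitVec r ᵥ* matrixOf rowsT)
    (hc : (c : ZMod 2) = 1 + ε + digitVec r ⬝ᵥ digitVec b) (hc' : c ≤ 64)
    (h6 : popCount r' ≠ 6) :
    weightCountOn (cosetPart π rows (digitVec r) (digitVec b) ε) 6 =
      (LaneBatch.ofRows 5 rows).countEq ((LaneBatch.ofRows 5 rows).weights r)
        ((LaneBatch.ofRows 5 rows).parity b c) 6 := by
  rw [countEq_left (π := π) h hc hc' (by norm_num) (by norm_num), weightCountOn]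
  congr 1
  ext y
  have hy := hammingNorm_parts π y
  simp only [Set.mem_ofPred_eq]
  refine and_congr_right fun hm => ⟨fun e => ⟨?_, e⟩, fun e => e.2⟩
  by_contra hl
  have h0 : rightPart π y = 0 := by
    rw [← hammingNorm_eq_zero]
    omega
  have h1 := (h.vecMul_eq_iff _ _ _).1 (mem_cosetPart.1 hm).1
  rw [h0, zero_vecMul, zero_add, ← hr] at h1
  rw [popCount_eq, ← h1] at h6
  rw [h0, hammingNorm_zero] at hy
  omega

/-- For weight exactly 10, "at most 5 on the left" and "at most 4 on the right" are complementary,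
so nothing is counted twice. -/
theorem weightCountOn_ten (h : IsOrthogonal rows rowsT)
    (hr : digitVec r' = digitVec r ᵥ* matrixOf rowsT)
    (hb : digitVec b' = digitVec b ᵥ* matrixOf rowsT)
    (hc : (c : ZMod 2) = 1 + ε + digitVec r ⬝ᵥ digitVec b) (hc₁ : c ≤ 64)
    (hc' : (c' : ZMod 2) = 1 + ε) (hc₂ : c' ≤ 64) :
    weightCountOn (cosetPart π rows (digitVec r) (digitVec b) ε) 10 =
      (LaneBatch.ofRows 5 rows).countEq ((LaneBatch.ofRows 5 rows).weights r)
        ((LaneBatch.ofRows 5 rows).parity b c) 10 +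
      (LaneBatch.ofRows 4 rowsT).countEq ((LaneBatch.ofRows 4 rowsT).weights r')
        ((LaneBatch.ofRows 4 rowsT).parity b' c') 10 := by
  rw [countEq_left (π := π) h hc hc₁ (by norm_num) (by norm_num),
    countEq_right (π := π) h hr hb hc' hc₂ (by norm_num) (by norm_num), weightCountOn,
    ← Set.ncard_union_eq _ (Set.toFinite _) (Set.toFinite _)]
  · congr 1
    ext y
    have hy := hammingNorm_parts π y
    simp only [Set.mem_ofPred_eq, Set.mem_union, ← and_or_left]
    refine and_congr_right fun _ => ?_
    omega
  · rw [Set.disjoint_left]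
    rintro y ⟨_, h1, h2⟩ ⟨_, h3, _⟩
    have hy := hammingNorm_parts π y
    omega

/-- Vectors of small weight have few ones on the left or few ones on the right. -/
theorem le_or_le_of_hammingNorm_le {y : Fin 68 → ZMod 2} (hy : hammingNorm y ≤ 10) :
    hammingNorm (leftPart π y) ≤ 5 ∨ hammingNorm (rightPart π y) ≤ 4 := by
  have := hammingNorm_parts π y
  omega

end Count

/-! ### Soundness of the two checks. -/

section Check

open BinaryCode

variable {π : Equiv.Perm (Fin 68)} {rows rowsT : List ℕ} {s b : ℕ} {γ β : ℤ}

theorem natCast_mod_two (m : ℕ) : ((m % 2 : ℕ) : ZMod 2) = m := by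
  rw [ZMod.natCast_eq_natCast_iff']
  omega

theorem stdCode_eq_cosetPart :
    (stdCode π rows : Set (Fin 68 → ZMod 2)) = cosetPart π rows (digitVec 0) (digitVec 0) 0 := by
  ext y
  rw [mem_cosetPart, digitVec_zero, add_zero, dotProduct_zero]
  exact (and_iff_left rfl).symm

/-- The shadow is a single coset of the code, represented by any of its members. -/
theorem shadow_stdCode (h : IsOrthogonal rows rowsT)
    (hs : join π 0 (digitVec s) ∈ (stdCode π rows).shadow) :
    (stdCode π rows).shadow = cosetPart π rows (digitVec s) (digitVec 0) 0 := by
  ext y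
  have h0 : join π 0 (digitVec 0) = 0 := by
    rw [digitVec_zero]
    apply parts_ext π <;> simp only [leftPart_join, rightPart_join] <;> rfl
  rw [cosetPart, Set.mem_ofPred_eq, h0, dotProduct_zero, and_iff_left rfl]
  constructor
  · exact fun hy => (h.isSelfDual π).add_mem_of_shadow hy hs
  · intro hy c hc
    have := (h.isSelfDual π).dotProduct_eq_zero hy hc
    rw [add_dotProduct, hs c hc] at this
    rw [← CharTwo.neg_eq (halfWeight c)]
    exact eq_neg_of_add_eq_zero_left this

theorem extremal_of_standardCheck (h : IsOrthogonal rows rowsT)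
    (hs : join π 0 (digitVec s) ∈ (stdCode π rows).shadow)
    (hcheck : standardCheck (.ofRows 5 rows) (.ofRows 4 rowsT) rowsT s γ β = true) :
    IsExtremal (stdCode π rows) ∧ HasParameters (stdCode π rows) 34 12 ∧
      weightEnumerator (stdCode π rows) = W682 β γ := by
  simp only [standardCheck, Bool.and_eq_true, beq_iff_eq, bne_iff_ne] at hcheck
  obtain ⟨⟨⟨⟨⟨hL, hR⟩, h2⟩, h6⟩, h10⟩, hp⟩ := hcheck
  have hc : ∀ r : ℕ, ((1 : ℕ) : ZMod 2) = 1 + 0 + digitVec r ⬝ᵥ digitVec 0 := fun r => by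
    rw [digitVec_zero, dotProduct_zero, add_zero, add_zero, Nat.cast_one]
  have hc' : ((1 : ℕ) : ZMod 2) = 1 + 0 := by rw [add_zero, Nat.cast_one]
  have h0 : digitVec 0 = digitVec 0 ᵥ* matrixOf rowsT := by rw [digitVec_zero, zero_vecMul]
  have hsT := digitVec_rowSum h.lengthT s
  have hsh := shadow_stdCode h hs
  refine extremal_of_shadow (h.isSelfDual π) ?_ ?_ ?_ ?_
  · intro w hw hw'
    rw [weightCount_eq_zero]
    rintro y hy rfl
    have hy0 : y ≠ 0 := hammingNorm_pos_iff.1 hw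
    have hm : ∀ z ∈ stdCode π rows, z ∈ cosetPart π rows (digitVec 0) (digitVec 0) 0 :=
      fun z hz => by rwa [← stdCode_eq_cosetPart]
    have hl0 : hammingNorm (leftPart π 0) = 0 := hammingNorm_zero
    have hr0 : hammingNorm (rightPart π 0) = 0 := hammingNorm_zero
    rw [countLe_left (π := π) h (hc 0) (by norm_num) (by norm_num), Set.ncard_eq_one] at hL
    rw [countLe_right (π := π) h h0 h0 hc' (by norm_num) (by norm_num), Set.ncard_eq_one] at hR
    obtain ⟨a, ha⟩ := hL
    obtain ⟨a', ha'⟩ := hR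
    -- Each list contains the zero word and has one element, so `y` would be zero.
    rcases le_or_le_of_hammingNorm_le (π := π) hw' with hl | hr
    · have e1 : y ∈ ({a} : Set (Fin 68 → ZMod 2)) := ha ▸ ⟨hm y hy, hl, hw'⟩
      have e2 : (0 : Fin 68 → ZMod 2) ∈ ({a} : Set (Fin 68 → ZMod 2)) :=
        ha ▸ ⟨hm 0 (zero_mem _), by omega, by rw [hammingNorm_zero]; norm_num⟩
      exact hy0 (e1.trans e2.symm)
    · have e1 : y ∈ ({a'} : Set (Fin 68 → ZMod 2)) := ha' ▸ ⟨hm y hy, hr, hw'⟩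
      have e2 : (0 : Fin 68 → ZMod 2) ∈ ({a'} : Set (Fin 68 → ZMod 2)) :=
        ha' ▸ ⟨hm 0 (zero_mem _), by omega, by rw [hammingNorm_zero]; norm_num⟩
      exact hy0 (e1.trans e2.symm)
  · rw [hsh, weightCountOn_two h (hc s) (by norm_num), h2]
  · rw [hsh, weightCountOn_six h hsT (hc s) (by norm_num) hp, h6]
  · rw [hsh, weightCountOn_ten h hsT h0 (hc s) (by norm_num) hc' (by norm_num), h10]

theorem weightCountOn_union {n : ℕ} {S T : Set (Fin n → ZMod 2)} (h : Disjoint S T) (w : ℕ) :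
    weightCountOn (S ∪ T) w = weightCountOn S w + weightCountOn T w := by
  rw [weightCountOn, weightCountOn, weightCountOn,
    ← Set.ncard_union_eq _ (Set.toFinite _) (Set.toFinite _)]
  · congr 1
    ext y
    exact or_and_right
  · exact h.mono (fun _ hy => hy.1) (fun _ hy => hy.1)

/-- Words of the neighbour that lie in the base code have no forbidden weight by hypothesis, so only
the coset of `x` is searched. The shadow splits into two disjoint pieces, which are counted
separately. -/
theorem extremal_of_neighbourCheck (h : IsOrthogonal rows rowsT)
    (hs : join π 0 (digitVec s) ∈ (stdCode π rows).shadow)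
    (hmin : ∀ w, 0 < w → w ≤ 10 → (stdCode π rows).weightCount w = 0)
    (hcheck : neighbourCheck (.ofRows 5 rows) (.ofRows 4 rowsT) rowsT s b γ β = true) :
    join π 0 (digitVec b) ∉ stdCode π rows ∧
    AreNeighbours (stdCode π rows) ((stdCode π rows).neighbourBy (join π 0 (digitVec b))) ∧
    IsExtremal ((stdCode π rows).neighbourBy (join π 0 (digitVec b))) ∧
    HasParameters ((stdCode π rows).neighbourBy (join π 0 (digitVec b))) 34 12 ∧
    weightEnumerator ((stdCode π rows).neighbourBy (join π 0 (digitVec b))) = W682 β γ := by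
  have hD := h.isSelfDual π
  simp only [neighbourCheck, shadowCheck, Bool.and_eq_true, beq_iff_eq, bne_iff_ne,
    Nat.add_eq_zero_iff] at hcheck
  obtain ⟨⟨⟨⟨hb0, hb2⟩, hL⟩, hR⟩, ⟨⟨⟨⟨h2, h2'⟩, h6⟩, h10⟩, hp⟩, hp'⟩ := hcheck
  have hbn : hammingNorm (join π 0 (digitVec b)) = popCount b := by
    rw [hammingNorm_parts π, leftPart_join, rightPart_join, popCount_eq, hammingNorm_zero, zero_add]
  have hxx : join π 0 (digitVec b) ⬝ᵥ join π 0 (digitVec b) = 0 := by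
    rw [← even_hammingNorm_iff, hbn]
    exact Nat.even_iff.2 hb2
  have hbb : digitVec b ⬝ᵥ digitVec b = 0 := by
    rw [← even_hammingNorm_iff, ← popCount_eq]
    exact Nat.even_iff.2 hb2
  have hxD : join π 0 (digitVec b) ∉ stdCode π rows := by
    rw [mem_stdCode, leftPart_join, rightPart_join, zero_vecMul]
    intro e
    rw [popCount_eq, e, hammingNorm_zero] at hb0
    exact hb0 rfl
  have hbT := digitVec_rowSum h.lengthT b
  have hsT := digitVec_rowSum h.lengthT s
  have htT : digitVec (rowSum rowsT s ^^^ rowSum rowsT b) =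
      digitVec (s ^^^ b) ᵥ* matrixOf rowsT := by
    rw [digitVec_xor, digitVec_xor, add_vecMul, hsT, hbT]
  have hε : halfWeight (join π 0 (digitVec b)) = ((popCount b / 2 : ℕ) : ZMod 2) := by
    rw [halfWeight, hbn]
  have hc1 : ((1 : ℕ) : ZMod 2) = 1 + 0 + digitVec b ⬝ᵥ digitVec b := by
    rw [hbb, add_zero, add_zero, Nat.cast_one]
  have hc1' : ((1 : ℕ) : ZMod 2) = 1 + 0 := by rw [add_zero, Nat.cast_one]
  have hc : ((1 + popCount b / 2 % 2 + popCount (s &&& b) % 2 : ℕ) : ZMod 2) =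
      1 + halfWeight (join π 0 (digitVec b)) + digitVec s ⬝ᵥ digitVec b := by
    rw [Nat.cast_add, Nat.cast_add, natCast_mod_two, natCast_mod_two, Nat.cast_one, hε,
      popCount_land]
  have hc₂ : ((1 + popCount b / 2 % 2 + popCount (s &&& b) % 2 : ℕ) : ZMod 2) =
      1 + halfWeight (join π 0 (digitVec b)) + digitVec (s ^^^ b) ⬝ᵥ digitVec b := by
    rw [hc, digitVec_xor, add_dotProduct, hbb, add_zero]
  have hc' : ((1 + popCount b / 2 % 2 : ℕ) : ZMod 2) =
      1 + halfWeight (join π 0 (digitVec b)) := by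
    rw [Nat.cast_add, natCast_mod_two, Nat.cast_one, hε]
  have hle : 1 + popCount b / 2 % 2 + popCount (s &&& b) % 2 ≤ 64 := by omega
  have hle' : 1 + popCount b / 2 % 2 ≤ 64 := by omega
  generalize 1 + popCount b / 2 % 2 + popCount (s &&& b) % 2 = c at *
  generalize 1 + popCount b / 2 % 2 = c' at *
  have hsh : ((stdCode π rows).neighbourBy (join π 0 (digitVec b))).shadow =
      cosetPart π rows (digitVec s) (digitVec b) (halfWeight (join π 0 (digitVec b))) ∪
      cosetPart π rows (digitVec (s ^^^ b)) (digitVec b)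
        (halfWeight (join π 0 (digitVec b))) := by
    ext y
    rw [mem_shadow_neighbourBy hD hxx hs, ← join_add, add_zero, ← digitVec_xor]
    exact and_or_left.trans (or_congr and_comm and_comm)
  have hdisj : Disjoint
      (cosetPart π rows (digitVec s) (digitVec b) (halfWeight (join π 0 (digitVec b))))
      (cosetPart π rows (digitVec (s ^^^ b)) (digitVec b)
        (halfWeight (join π 0 (digitVec b)))) := by
    rw [Set.disjoint_left]
    rintro y ⟨hy, _⟩ ⟨hy', _⟩
    refine hxD ?_
    have := add_mem hy hy'
    rwa [add_add_add_comm, add_self_eq_zero, zero_add, ← join_add, add_zero, digitVec_xor,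
      ← add_assoc, add_self_eq_zero, zero_add] at this
  refine ⟨hxD, areNeighbours_neighbourBy hD hxx hxD,
    extremal_of_shadow (isSelfDual_neighbourBy hD hxx) ?_ ?_ ?_ ?_⟩
  · intro w hw hw'
    rw [weightCount_eq_zero]
    rintro y hy rfl
    rw [mem_neighbourBy hxx] at hy
    obtain ⟨hyx, hy | hy⟩ := hy
    · exact weightCount_eq_zero.1 (hmin _ hw hw') y hy rfl
    · rw [countLe_left (π := π) h hc1 (by norm_num) (by norm_num),
        Set.ncard_eq_zero (Set.toFinite _)] at hL
      rw [countLe_right (π := π) h hbT hbT hc1' (by norm_num) (by norm_num),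
        Set.ncard_eq_zero (Set.toFinite _)] at hR
      rcases le_or_le_of_hammingNorm_le (π := π) hw' with hl | hr
      · exact Set.notMem_empty y (hL ▸ ⟨⟨hy, hyx⟩, hl, hw'⟩)
      · exact Set.notMem_empty y (hR ▸ ⟨⟨hy, hyx⟩, hr, hw'⟩)
  · rw [hsh, weightCountOn_union hdisj, weightCountOn_two h hc hle, weightCountOn_two h hc₂ hle,
      h2, h2']
  · rw [hsh, weightCountOn_union hdisj, weightCountOn_six h hsT hc hle hp,
      weightCountOn_six h htT hc₂ hle hp', h6]
  · rw [hsh, weightCountOn_union hdisj, weightCountOn_ten h hsT hbT hc hle hc' hle',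
      weightCountOn_ten h htT hbT hc₂ hle hc' hle', ← h10]
    push_cast
    ring

end Check

/-! ### Validation of explicit standard forms. -/

/-- A code with generator matrix `(I | A)` after a permutation of the coordinates: the rows of `A`,
the rows of its transpose, and a vector of the shadow which is zero on the left. -/
structure StandardForm where
  perm : Equiv.Perm (Fin 68)
  rows : List ℕ
  rowsT : List ℕ
  shadow : ℕ

namespace StandardForm

open BinaryCode

variable {F F' : StandardForm} {D : BinaryCode 68}

def code (F : StandardForm) : BinaryCode 68 := stdCode F.perm F.rows

/-- The vector with given right part that vanishes on the left. -/
def rightVector (F : StandardForm) (b : ℕ) : Fin 68 → ZMod 2 := join F.perm 0 (digitVec b)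

/-- The first row list times the second matrix must give the unit vectors; the `i`-th unit vector is
encoded by `2 ^ (33 - i)`, as digits are read from the left. -/
def orthogonalCheck (F : StandardForm) : Bool :=
  (F.rows.length == 34) &&
  (F.rowsT.map bits == (List.range 34).map fun j => F.rows.map fun r => r.testBit (33 - j)) &&
  (F.rows.map (rowSum F.rowsT) == (List.range 34).map fun i => 2 ^ (33 - i))

/-- The digits of the shadow vector times `Aᵀ` are its inner products with the rows of `A`; a
generator has weight 1 plus that of its row. -/
def rowShadowCheck (F : StandardForm) : Bool :=
  bits (rowSum F.rowsT F.shadow) == F.rows.map fun r => (1 + popCount r) / 2 % 2 == 1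

/-- The data are consistent: the code is self-dual, and the vector belongs to the shadow. -/
structure Valid (F : StandardForm) : Prop where
  orthogonal : F.orthogonalCheck = true
  rowShadow : F.rowShadowCheck = true

theorem digitVec_two_pow (i : Fin 34) : digitVec (2 ^ (33 - i : ℕ)) = Pi.single i 1 := by
  ext j
  rw [digitVec_apply, Pi.single_apply, Nat.testBit_two_pow]
  congr 1
  simp only [decide_eq_true_eq, Fin.ext_iff, eq_iff_iff]
  omega

theorem getD_map_range {α : Type*} (f : ℕ → α) (a : α) (i : Fin 34) :
    ((List.range 34).map f).getD i a = f i := by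
  rw [List.getD_eq_getElem _ _ (by rw [List.length_map, List.length_range]; exact i.2),
    List.getElem_map, List.getElem_range]

theorem getD_map {α β : Type*} (f : α → β) {l : List α} {n : ℕ} (hl : l.length = n) (a : α)
    (b : β) (i : Fin n) : (l.map f).getD i b = f (l.getD i a) := by
  rw [List.getD_eq_getElem _ _ (by rw [List.length_map, hl]; exact i.2), List.getElem_map,
    List.getD_eq_getElem _ _ (by rw [hl]; exact i.2)]

theorem isOrthogonal (h : F.Valid) : IsOrthogonal F.rows F.rowsT := by
  have h1 := h.orthogonal
  simp only [orthogonalCheck, Bool.and_eq_true, beq_iff_eq] at h1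
  obtain ⟨⟨hl, hT⟩, hA⟩ := h1
  have hl' : F.rowsT.length = 34 := by
    simpa only [List.length_map, List.length_range] using congrArg List.length hT
  have htr : matrixOf F.rowsT = (matrixOf F.rows)ᵀ := by
    ext i j
    rw [transpose_apply, matrixOf, of_apply, matrixOf, of_apply, digitVec_apply, digitVec_apply]
    have e := congrArg (fun l => (l.getD i []).getD j false) hT
    simp only [getD_map_range, getD_map bits hl' 0, getD_map _ hl 0, bits] at e
    rw [e]
  refine ⟨hl, hl', htr, ?_⟩
  ext i j
  have e := congrArg (fun l => digitVec (l.getD i 0)) hA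
  simp only [getD_map_range, getD_map _ hl 0, digitVec_two_pow, digitVec_rowSum hl'] at e
  rw [← htr, one_apply]
  refine (congrFun e j).trans ?_
  rw [Pi.single_apply]
  simp only [eq_comm]

theorem isSelfDual (h : F.Valid) : F.code.IsSelfDual := (isOrthogonal h).isSelfDual F.perm

/-- Both sides of the shadow condition are additive on the self-dual code, so the words satisfying
it form a subspace `E`, and only the generators have to be tested. -/
theorem rightVector_mem_shadow (h : F.Valid) : F.rightVector F.shadow ∈ F.code.shadow := by
  have hD := isSelfDual h
  let E : BinaryCode 68 :=
    { carrier := {c | c ∈ F.code ∧ F.rightVector F.shadow ⬝ᵥ c = halfWeight c}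
      add_mem' := by
        rintro a b ⟨ha, ha'⟩ ⟨hb, hb'⟩
        refine ⟨add_mem ha hb, ?_⟩
        rw [dotProduct_add, ha', hb', halfWeight_add (hD.dotProduct_eq_zero ha ha)
          (hD.dotProduct_eq_zero hb hb) (hD.dotProduct_eq_zero ha hb)]
      zero_mem' := ⟨zero_mem _, by rw [dotProduct_zero, halfWeight_zero]⟩
      smul_mem' := by
        have h01 : ∀ c : ZMod 2, c = 0 ∨ c = 1 := by decide
        intro c a ha
        rcases h01 c with rfl | rfl
        · rw [zero_smul]
          exact ⟨zero_mem _, by rw [dotProduct_zero, halfWeight_zero]⟩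
        · rwa [one_smul] }
  have hE : F.code ≤ E := by
    refine stdCode_le fun i => ⟨stdRow_mem _ _ i, ?_⟩
    have hO := isOrthogonal h
    have h1 : digitVec F.shadow ⬝ᵥ digitVec (F.rows.getD i 0) =
        ((1 + popCount (F.rows.getD i 0)) / 2 : ℕ) := by
      have e := congrArg (fun l => l.getD i false) (beq_iff_eq.1 h.rowShadow)
      simp only [getD_map _ hO.length 0, bits, getD_map_range] at e
      have e2 := congrFun (digitVec_rowSum hO.lengthT F.shadow) i
      rw [hO.transpose, vecMul_transpose] at e2
      rw [dotProduct_comm]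
      refine e2.symm.trans ?_
      rw [digitVec_apply, e, ← natCast_mod_two]
      rcases Nat.mod_two_eq_zero_or_one ((1 + popCount (F.rows.getD i 0)) / 2) with h0 | h0 <;>
        rw [h0] <;> rfl
    have hs : hammingNorm (Pi.single i 1 : Fin 34 → ZMod 2) = 1 := by
      rw [hammingNorm_eq_sum, Finset.sum_eq_single i]
      · rw [Pi.single_eq_same]; rfl
      · intro j _ hj
        rw [Pi.single_eq_of_ne hj, ZMod.val_zero]
      · exact fun hi => absurd (Finset.mem_univ i) hi
    rw [rightVector, stdRow, halfWeight, hammingNorm_parts F.perm, dotProduct_parts F.perm]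
    simp only [leftPart_join, rightPart_join]
    rw [zero_dotProduct, zero_add, h1, hs, ← popCount_eq]
  exact fun c hc => (hE hc).2

/-- The lines of a table pass the computation for neighbours. -/
def tableCheck (F : StandardForm) (L R : LaneBatch) (es : List TableEntry) : Bool :=
  es.all fun e => neighbourCheck L R F.rowsT F.shadow e.bits e.gamma e.beta

/-- The statement about the neighbour that is given by a line of a table. -/
def NeighbourHolds (D : BinaryCode 68) (x : Fin 68 → ZMod 2) (β γ : ℤ) : Prop :=
  x ∉ D ∧ AreNeighbours D (D.neighbourBy x) ∧ IsExtremal (D.neighbourBy x) ∧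
    HasParameters (D.neighbourBy x) 34 12 ∧ weightEnumerator (D.neighbourBy x) = W682 β γ

theorem neighbourHolds (h : F.Valid) (hD : HasParameters F.code 34 12) {es : List TableEntry}
    (hes : F.tableCheck (.ofRows 5 F.rows) (.ofRows 4 F.rowsT) es = true) :
    ∀ e ∈ es, NeighbourHolds F.code (F.rightVector e.bits) e.beta e.gamma := fun e he =>
  extremal_of_neighbourCheck (isOrthogonal h) (rightVector_mem_shadow h)
    (weightCount_of_minDist hD.2) (List.all_eq_true.1 hes e he)

theorem code_holds (h : F.Valid) {β γ : ℤ} (hc : standardCheck (.ofRows 5 F.rows)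
    (.ofRows 4 F.rowsT) F.rowsT F.shadow γ β = true) :
    IsExtremal F.code ∧ HasParameters F.code 34 12 ∧ weightEnumerator F.code = W682 β γ :=
  extremal_of_standardCheck (isOrthogonal h) (rightVector_mem_shadow h) hc

/-- Both codes are self-dual, so it suffices that the generators of one lie in the other. -/
theorem code_eq_neighbourBy (h : F.Valid) (h' : F'.Valid) {b : ℕ} (hb : popCount b % 2 = 0)
    (hrow : ∀ i, stdRow F'.perm F'.rows i ⬝ᵥ F.rightVector b = 0 ∧
      (stdRow F'.perm F'.rows i ∈ F.code ∨ stdRow F'.perm F'.rows i + F.rightVector b ∈ F.code)) :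
    F.code.neighbourBy (F.rightVector b) = F'.code := by
  have hx : F.rightVector b ⬝ᵥ F.rightVector b = 0 := by
    rw [← even_hammingNorm_iff, hammingNorm_parts F.perm, rightVector, leftPart_join,
      rightPart_join, hammingNorm_zero, zero_add, ← popCount_eq]
    exact Nat.even_iff.2 hb
  refine ((isSelfDual h').eq_of_le (isSelfDual_neighbourBy (isSelfDual h) hx) ?_).symm
  exact stdCode_le fun i => (mem_neighbourBy hx).2 (hrow i)

/-! ### Explicit data and kernel computations. -/

/-- The standard form of `𝒩₍0₎`. -/
def chain0 : StandardForm where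
  perm := 1
  rows := [
    1203715398, 6608788018, 5020769921, 8933790094, 3118656007, 1993463051, 6993906852,
    9983651988, 11098212395, 15701942191, 13884050902, 8474323357, 14515160421, 10137824750,
    14124864345, 9806382290, 16851825559, 8906904607, 4193590498, 4143590609, 9199318161,
    16459211738, 15767487835, 11168771539, 6996759551, 9965281075, 3453417051, 8602312403,
    4482695994, 4375674873, 1398348465, 10434576902, 14824218597, 3010162650]
  -- For this code `A` is symmetric.
  rowsT := [
    1203715398, 6608788018, 5020769921, 8933790094, 3118656007, 1993463051, 6993906852,
    9983651988, 11098212395, 15701942191, 13884050902, 8474323357, 14515160421, 10137824750,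
    14124864345, 9806382290, 16851825559, 8906904607, 4193590498, 4143590609, 9199318161,
    16459211738, 15767487835, 11168771539, 6996759551, 9965281075, 3453417051, 8602312403,
    4482695994, 4375674873, 1398348465, 10434576902, 14824218597, 3010162650]
  shadow := 1995056881

/-- The standard form of `𝒩₍1₎`. -/
def chain1 : StandardForm where
  perm := Equiv.swap 33 34
  rows := [
    12697490076, 13866464744, 5020769921, 4592979082, 3118656007, 1993463051, 13215589246,
    16739762762, 6714873135, 8879238513, 1043353810, 14133790279, 1687574625, 16820477744,
    1280691805, 17152046604, 3922718355, 4686678299, 9841832760, 9757082379, 15343060559,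
    3501604574, 2926401631, 13679927053, 6996759551, 5708939831, 3453417051, 4378936279,
    4482695994, 4375674873, 1398348465, 6044950274, 11899333947, 4391279876]
  rowsT := [
    13108569090, 7756654453, 9228925570, 8933790094, 15916731908, 14957228296, 6993906852,
    8936836563, 6859107368, 3976414955, 14968615057, 12688756126, 734010401, 9059553449, 50563613,
    8845703573, 3777402772, 5772365147, 3192529317, 17107437778, 4983263378, 15346212509,
    3778747423, 7841133719, 11481839612, 4749117047, 16114651736, 4528290512, 4482695994,
    8751127546, 14462877362, 9299574593, 2126740454, 3010162650]
  shadow := 11903519019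

/-- The standard form of `𝒩₍2₎`. -/
def chain2 : StandardForm where
  perm := Equiv.swap 33 35
  rows := [
    8402522780, 13945858284, 3566965581, 8933790094, 3118656007, 10950608323, 8261512882,
    4733128582, 1877317859, 16833494457, 11883806746, 14223743811, 1687574625, 16897376820,
    1280691805, 17111378696, 8919924315, 3900720343, 15854117872, 16105444291, 15422004043,
    9308401174, 9999845527, 13604127241, 1590910515, 9965281075, 3453417051, 8602312403,
    8834063934, 8614241021, 1398348465, 10434576902, 13944339955, 4292431308]
  rowsT := [
    5668011382, 13108569090, 11703541889, 10938551181, 13609849863, 16710560523, 5358048935,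
    16558615207, 4418074155, 4887830943, 11583084517, 10398521245, 6343287126, 16469522397,
    7739977065, 14477182178, 3777402772, 2522507823, 8315002066, 14565577425, 4983263378,
    11867939818, 5090720619, 487265251, 11481839612, 3578061059, 14478854235, 6751510739,
    4482695994, 8751127546, 16132220081, 16711751733, 2126740454, 3010162650]
  shadow := 13956913635

/-- The standard form of `𝒩₍3₎`. -/
def chain3 : StandardForm where
  -- The right factor acts first: 34 and 35 go to 25 and 34, in the order given by `freePair 3`, and
  -- 25 goes to 35.
  perm := Equiv.swap 25 34 * Equiv.swap 25 35
  rows := [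
    14889436726, 11753651270, 15122664574, 4638822798, 16778851636, 6655641027, 1043866923,
    3360244767, 1877317859, 10350766355, 7588839450, 12019011561, 13781190482, 10410727070,
    1280691805, 10607689634, 9702547816, 15996705764, 5950548073, 6134241370, 5459775698,
    10656215333, 8689784740, 11432629923, 13139263744, 4292431308, 3453417051, 4307345107,
    4539096638, 4319273725, 1398348465, 6139609606, 8278586986, 3528756121]
  rowsT := [
    15593840128, 12627075702, 7327516035, 9258856847, 13609850118, 14095290633, 5358049190,
    16558615462, 8757875497, 10773168030, 4614834660, 11944275359, 12270566998, 14924058079,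
    10404082536, 1404870881, 13963987092, 2522508078, 12394707153, 14565577680, 4983263378,
    5940542698, 6497878377, 16047148514, 8598129919, 2036800257, 1381313881, 6751510994,
    11446754362, 11370258681, 3436888499, 16711751988, 16638043366, 524850393]
  shadow := 8282772090

/-- The standard form of `𝒩₍4₎`. -/
def chain4 : StandardForm where
  perm := Equiv.swap 34 35
  rows := [
    15291193226, 3143426102, 6487478286, 16838532162, 13154329736, 14821378063, 11842709735,
    3360244767, 11009840431, 1866118499, 13884050902, 9469976149, 16332330734, 1799981806,
    1280691805, 10742902302, 11715145940, 13982599768, 5950548073, 15342261654, 16017317150,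
    10791887001, 37555156, 2931722963, 17032974524, 130980976, 9429826455, 17169748767,
    4539096638, 17157566257, 1398348465, 15337148362, 13197933478, 3528756121]
  rowsT := [
    10651923158, 12627075702, 16343529045, 1564050009, 5667727056, 5146567391, 14054728816,
    8613529456, 16400973823, 14389678920, 3363874098, 13363003721, 12270566998, 4352409097,
    15966789566, 16958341089, 3777402772, 12561750264, 5431568337, 4811546630, 4983263378,
    11867939818, 1490922943, 10333479220, 8598129919, 8648681687, 9272712847, 1241222404,
    4482695994, 4375674873, 11647431269, 6962440930, 16638043366, 524850393]
  shadow := 13193732022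

/-- A four-circulant code. -/
def fourCirculant : StandardForm where
  perm := 1
  rows := [
    1622417894, 811208947, 8995539065, 4497835068, 10838786590, 14009262351, 7004696711,
    12092282947, 6046207009, 3023169040, 1511584520, 755792260, 377896130, 8778817121,
    12979343152, 6489671576, 3244835788, 3473431052, 1736715526, 868357763, 9024113473,
    4512122272, 2256061136, 1128030568, 564015284, 8871876698, 13025807405, 15102838294,
    16141288203, 8070709637, 4035420354, 10607579233, 13893724208, 6946862104]
  rowsT := [
    3021480422, 1510740211, 755435641, 8967652412, 13073695262, 6536847631, 3268489351,
    1634310211, 817220641, 408675856, 8794206984, 4397103492, 10788420802, 13984079457,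
    6992105264, 12085921688, 6042960844, 3473420378, 1736710189, 868420630, 9024079371,
    4512105221, 2256118146, 1128059073, 564095072, 8871916592, 13025827352, 15102782732,
    16141260422, 8070630211, 4035380641, 10607624912, 13893681512, 6946840756]
  -- This is `2 ^ 34 - 1`, the all-one vector on the right; it belongs to the shadow because every
  -- row of `A` has weight 1 modulo 4.
  shadow := 17179869183

theorem valid_chain0 : chain0.Valid := ⟨by decide +kernel, by decide +kernel⟩

theorem valid_chain1 : chain1.Valid := ⟨by decide +kernel, by decide +kernel⟩

theorem valid_chain2 : chain2.Valid := ⟨by decide +kernel, by decide +kernel⟩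

theorem valid_chain3 : chain3.Valid := ⟨by decide +kernel, by decide +kernel⟩

theorem valid_chain4 : chain4.Valid := ⟨by decide +kernel, by decide +kernel⟩

theorem valid_fourCirculant : fourCirculant.Valid := ⟨by decide +kernel, by decide +kernel⟩

theorem generatorRow_eq (i : Fin 34) :
    generatorRow i = stdRow chain0.perm chain0.rows i := by
  refine parts_ext chain0.perm ?_ ?_
  · rw [stdRow, leftPart_join]
    ext j
    change (if (j : ℕ) < 34 then if (j : ℕ) = i then (1 : ZMod 2) else 0 else _) = _
    rw [if_pos j.2, Pi.single_apply]
    simp only [Fin.ext_iff]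
  · rw [stdRow, rightPart_join]
    ext j
    change (if 34 + (j : ℕ) < 34 then _ else bitAt (rowsA i) (34 + (j : ℕ) - 34)) = _
    have hr : rowsA i = chain0.rows.getD i 0 := by
      revert i
      decide +kernel
    rw [if_neg (by omega), Nat.add_sub_cancel_left, hr]
    rfl

theorem knownCode_eq : knownCode = chain0.code := by
  apply le_antisymm
  · refine Submodule.span_le.2 ?_
    rintro _ ⟨i, rfl⟩
    rw [generatorRow_eq]
    exact stdRow_mem _ _ i
  · exact stdCode_le fun i => Submodule.subset_span ⟨i, generatorRow_eq i⟩

/-- The hypotheses say that the permutation moves the pair `freePair k` to the front of the right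
half, keeps the order of the remaining right coordinates, and leaves on the left only coordinates
where the search vectors vanish. -/
theorem searchVector_eq {k : ℕ} {F : StandardForm}
    (hl : ∀ j : Fin 34, (F.perm (Fin.castAdd 34 j)).val ≠ (freePair k).1 ∧
      (F.perm (Fin.castAdd 34 j)).val ≠ (freePair k).2 ∧ (F.perm (Fin.castAdd 34 j)).val < 36)
    (hr : ∀ j : Fin 34, if j = 0 then (F.perm (Fin.natAdd 34 j)).val = (freePair k).1 else
      (F.perm (Fin.natAdd 34 j)).val ≠ (freePair k).1 ∧
      if j = 1 then (F.perm (Fin.natAdd 34 j)).val = (freePair k).2 else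
        (F.perm (Fin.natAdd 34 j)).val ≠ (freePair k).2 ∧
        (F.perm (Fin.natAdd 34 j)).val = 34 + j) (b : ℕ) :
    searchVector k b = F.rightVector b := by
  refine parts_ext F.perm ?_ ?_
  · rw [rightVector, leftPart_join]
    ext j
    have h36 : ¬36 ≤ (F.perm (Fin.castAdd 34 j)).val := not_le.2 (hl j).2.2
    rw [leftPart, searchVector, if_neg (hl j).1, if_neg (hl j).2.1, if_neg h36]
    rfl
  · rw [rightVector, rightPart_join]
    ext j
    have h := hr j
    rw [rightPart, searchVector]
    split_ifs at h with h0 h1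
    · rw [if_pos h, h0]
      rfl
    · rw [if_neg h.1, if_pos h.2, h1]
      rfl
    · have : 2 ≤ (j : ℕ) := by
        simp only [Fin.ext_iff, Fin.val_zero, Fin.val_one] at h0 h1
        omega
      rw [if_neg h.1, if_neg h.2.1, if_pos (by omega), h.2.2, Nat.add_sub_cancel_left]
      rfl

theorem searchVector_chain0 (b : ℕ) : searchVector 0 b = chain0.rightVector b :=
  searchVector_eq (by decide +kernel) (by decide +kernel) b

theorem searchVector_chain1 (b : ℕ) : searchVector 1 b = chain1.rightVector b :=
  searchVector_eq (by decide +kernel) (by decide +kernel) b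

theorem searchVector_chain2 (b : ℕ) : searchVector 2 b = chain2.rightVector b :=
  searchVector_eq (by decide +kernel) (by decide +kernel) b

theorem searchVector_chain3 (b : ℕ) : searchVector 3 b = chain3.rightVector b :=
  searchVector_eq (by decide +kernel) (by decide +kernel) b

theorem searchVector_chain4 (b : ℕ) : searchVector 4 b = chain4.rightVector b :=
  searchVector_eq (by decide +kernel) (by decide +kernel) b

instance (π : Equiv.Perm (Fin 68)) (rows : List ℕ) (y : Fin 68 → ZMod 2) :
    Decidable (y ∈ stdCode π rows) :=
  inferInstanceAs (Decidable (rightPart π y = leftPart π y ᵥ* matrixOf rows))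

instance (F : StandardForm) (y : Fin 68 → ZMod 2) : Decidable (y ∈ F.code) :=
  inferInstanceAs (Decidable (y ∈ stdCode F.perm F.rows))

theorem neighbour_chain0 :
    chain0.code.neighbourBy (chain0.rightVector (chainTable 0).bits) = chain1.code :=
  code_eq_neighbourBy valid_chain0 valid_chain1 (by decide +kernel) (by decide +kernel)

theorem neighbour_chain1 :
    chain1.code.neighbourBy (chain1.rightVector (chainTable 1).bits) = chain2.code :=
  code_eq_neighbourBy valid_chain1 valid_chain2 (by decide +kernel) (by decide +kernel)

theorem neighbour_chain2 :
    chain2.code.neighbourBy (chain2.rightVector (chainTable 2).bits) = chain3.code :=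
  code_eq_neighbourBy valid_chain2 valid_chain3 (by decide +kernel) (by decide +kernel)

theorem neighbour_chain3 :
    chain3.code.neighbourBy (chain3.rightVector (chainTable 3).bits) = chain4.code :=
  code_eq_neighbourBy valid_chain3 valid_chain4 (by decide +kernel) (by decide +kernel)

theorem chainCode_zero : chainCode 0 = chain0.code := knownCode_eq

theorem chainCode_one : chainCode 1 = chain1.code := by
  rw [chainCode, chainCode_zero, dif_pos (by norm_num), searchVector_chain0]
  exact neighbour_chain0

theorem chainCode_two : chainCode 2 = chain2.code := by
  rw [chainCode, chainCode_one, dif_pos (by norm_num), searchVector_chain1]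
  exact neighbour_chain1

theorem chainCode_three : chainCode 3 = chain3.code := by
  rw [chainCode, chainCode_two, dif_pos (by norm_num), searchVector_chain2]
  exact neighbour_chain2

theorem chainCode_four : chainCode 4 = chain4.code := by
  rw [chainCode, chainCode_three, dif_pos (by norm_num), searchVector_chain3]
  exact neighbour_chain3

theorem standardCheck_chain0 : standardCheck (.ofRows 5 chain0.rows) (.ofRows 4 chain0.rowsT)
    chain0.rowsT chain0.shadow 5 213 = true := by decide +kernel

theorem standardCheck_fourCirculant : standardCheck (.ofRows 5 fourCirculant.rows)
    (.ofRows 4 fourCirculant.rowsT) fourCirculant.rowsT fourCirculant.shadow 0 136 = true := by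
  decide +kernel

/-- Neighbours of `𝒩₍0₎` with small `γ`. -/
def smallGammaTable : List TableEntry :=
  [⟨12313555156, 2, 158⟩, ⟨9485843651, 3, 151⟩, ⟨4804873669, 4, 183⟩]

/-- A neighbour of the four-circulant code. -/
def gammaOneTable : List TableEntry := [⟨5952582470, 1, 133⟩]

/-- The row sums depend only on the base code; a line of a table changes merely the translation and
the parity mask. -/
theorem tableCheck_fourCirculant : fourCirculant.tableCheck
    (.ofRows 5 fourCirculant.rows) (.ofRows 4 fourCirculant.rowsT) gammaOneTable = true := by decide +kernel

theorem tableCheck_chain0 : chain0.tableCheck (.ofRows 5 chain0.rows) (.ofRows 4 chain0.rowsT)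
    (chainTable 0 :: smallGammaTable ++ neighbourTable0) = true := by decide +kernel

theorem tableCheck_chain1 : chain1.tableCheck (.ofRows 5 chain1.rows) (.ofRows 4 chain1.rowsT)
    (chainTable 1 :: neighbourTable1) = true := by decide +kernel

theorem tableCheck_chain2 : chain2.tableCheck (.ofRows 5 chain2.rows) (.ofRows 4 chain2.rowsT)
    (chainTable 2 :: neighbourTable2) = true := by decide +kernel

theorem tableCheck_chain3 : chain3.tableCheck (.ofRows 5 chain3.rows) (.ofRows 4 chain3.rowsT)
    (chainTable 3 :: neighbourTable3) = true := by decide +kernel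

theorem tableCheck_chain4 : chain4.tableCheck (.ofRows 5 chain4.rows) (.ofRows 4 chain4.rowsT)
    neighbourTable4 = true := by decide +kernel

end StandardForm

/-! ### The tables of neighbours. -/

open BinaryCode

namespace StandardForm

theorem holds_chain0 : IsExtremal chain0.code ∧ HasParameters chain0.code 34 12 ∧
    weightEnumerator chain0.code = W682 213 5 :=
  code_holds valid_chain0 standardCheck_chain0

theorem holds_fourCirculant : IsExtremal fourCirculant.code ∧
    HasParameters fourCirculant.code 34 12 ∧ weightEnumerator fourCirculant.code = W682 136 0 :=
  code_holds valid_fourCirculant standardCheck_fourCirculant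

theorem neighbours_fourCirculant : ∀ e ∈ gammaOneTable,
    NeighbourHolds fourCirculant.code (fourCirculant.rightVector e.bits) e.beta e.gamma :=
  neighbourHolds valid_fourCirculant holds_fourCirculant.2.1 tableCheck_fourCirculant

theorem neighbours_chain0 : ∀ e ∈ chainTable 0 :: smallGammaTable ++ neighbourTable0,
    NeighbourHolds (chainCode 0) (searchVector 0 e.bits) e.beta e.gamma := by
  simp only [chainCode_zero, searchVector_chain0]
  exact neighbourHolds valid_chain0 holds_chain0.2.1 tableCheck_chain0

/-- The head of the preceding table produces this base code, so its minimum distance is already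
known and no separate check is needed. -/
theorem neighbours_chain1 : ∀ e ∈ chainTable 1 :: neighbourTable1,
    NeighbourHolds (chainCode 1) (searchVector 1 e.bits) e.beta e.gamma := by
  have h := (neighbours_chain0 _ List.mem_cons_self).2.2.2.1
  rw [searchVector_chain0, chainCode_zero, neighbour_chain0] at h
  simp only [chainCode_one, searchVector_chain1]
  exact neighbourHolds valid_chain1 h tableCheck_chain1

theorem neighbours_chain2 : ∀ e ∈ chainTable 2 :: neighbourTable2,
    NeighbourHolds (chainCode 2) (searchVector 2 e.bits) e.beta e.gamma := by
  have h := (neighbours_chain1 _ List.mem_cons_self).2.2.2.1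
  rw [searchVector_chain1, chainCode_one, neighbour_chain1] at h
  simp only [chainCode_two, searchVector_chain2]
  exact neighbourHolds valid_chain2 h tableCheck_chain2

theorem neighbours_chain3 : ∀ e ∈ chainTable 3 :: neighbourTable3,
    NeighbourHolds (chainCode 3) (searchVector 3 e.bits) e.beta e.gamma := by
  have h := (neighbours_chain2 _ List.mem_cons_self).2.2.2.1
  rw [searchVector_chain2, chainCode_two, neighbour_chain2] at h
  simp only [chainCode_three, searchVector_chain3]
  exact neighbourHolds valid_chain3 h tableCheck_chain3

theorem neighbours_chain4 : ∀ e ∈ neighbourTable4,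
    NeighbourHolds (chainCode 4) (searchVector 4 e.bits) e.beta e.gamma := by
  have h := (neighbours_chain3 _ List.mem_cons_self).2.2.2.1
  rw [searchVector_chain3, chainCode_three, neighbour_chain3] at h
  simp only [chainCode_four, searchVector_chain4]
  exact neighbourHolds valid_chain4 h tableCheck_chain4

theorem neighbours_chainTable (i : Fin 4) : NeighbourHolds (chainCode i)
    (searchVector i (chainTable i).bits) (chainTable i).beta (chainTable i).gamma := by
  fin_cases i
  · exact neighbours_chain0 _ List.mem_cons_self
  · exact neighbours_chain1 _ List.mem_cons_self
  · exact neighbours_chain2 _ List.mem_cons_self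
  · exact neighbours_chain3 _ List.mem_cons_self

theorem chainCode_succ (i : Fin 4) : chainCode (i + 1) =
    (chainCode i).neighbourBy (searchVector i (chainTable i).bits) := by
  rw [chainCode, dif_pos i.2]

theorem neighbours_neighbourTable (k : Fin 5) : ∀ e ∈ neighbourTable k,
    NeighbourHolds (chainCode k) (searchVector k e.bits) e.beta e.gamma := by
  intro e he
  fin_cases k
  · exact neighbours_chain0 e (List.mem_append_right _ he)
  · exact neighbours_chain1 e (List.mem_cons_of_mem _ he)
  · exact neighbours_chain2 e (List.mem_cons_of_mem _ he)
  · exact neighbours_chain3 e (List.mem_cons_of_mem _ he)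
  · exact neighbours_chain4 e he

end StandardForm

/-! ### Counting the new codes by their parameters. -/

/-- The values of `β` and `γ` in a line of a table. -/
def TableEntry.params (e : TableEntry) : ℤ × ℤ := (e.beta, e.gamma)

/-- The new codes with their values of `β` and `γ`. -/
noncomputable def newCodeList : List (BinaryCode 68 × ℤ × ℤ) :=
  [(chainCode 2, 212, 7), (chainCode 3, 221, 8), (chainCode 4, 221, 9)] ++
    (List.finRange 5).flatMap fun k =>
      (neighbourTable k).map fun e => (tableCode k e, e.params)

/-- The values of `β` and `γ` for the new codes. -/
def newParams : List (ℤ × ℤ) :=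
  [(212, 7), (221, 8), (221, 9)] ++
    (List.finRange 5).flatMap fun k => (neighbourTable k).map TableEntry.params

theorem map_snd_newCodeList : newCodeList.map Prod.snd = newParams := by
  rw [newCodeList, newParams, List.map_append, List.map_flatMap]
  simp only [List.map_map]
  rfl

theorem nodup_newParams : newParams.Nodup := by decide +kernel

theorem length_newParams : newParams.length = 143 := by decide +kernel

theorem mem_newCodes {D : BinaryCode 68} : D ∈ newCodes ↔ ∃ a ∈ newCodeList, a.1 = D := by
  simp only [newCodes, newCodeList, List.mem_append, List.mem_flatMap, List.mem_map,
    List.mem_finRange, true_and, Set.mem_union, Set.mem_insert_iff, Set.mem_singleton_iff,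
    Set.mem_ofPred_eq, List.mem_cons, List.not_mem_nil, or_false]
  constructor
  · rintro ((rfl | rfl | rfl) | ⟨k, e, he, rfl⟩)
    · exact ⟨_, Or.inl (Or.inl rfl), rfl⟩
    · exact ⟨_, Or.inl (Or.inr (Or.inl rfl)), rfl⟩
    · exact ⟨_, Or.inl (Or.inr (Or.inr rfl)), rfl⟩
    · exact ⟨_, Or.inr ⟨k, e, he, rfl⟩, rfl⟩
  · rintro ⟨a, (rfl | rfl | rfl) | ⟨k, e, he, rfl⟩, rfl⟩
    · exact Or.inl (Or.inl rfl)
    · exact Or.inl (Or.inr (Or.inl rfl))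
    · exact Or.inl (Or.inr (Or.inr rfl))
    · exact Or.inr ⟨k, e, he, rfl⟩

theorem weightEnumerator_newCodeList :
    ∀ a ∈ newCodeList, weightEnumerator a.1 = W682 a.2.1 a.2.2 := by
  have hc : ∀ i : Fin 4, weightEnumerator (chainCode (i + 1)) =
      W682 (chainTable i).beta (chainTable i).gamma := fun i => by
    rw [StandardForm.chainCode_succ]
    exact (StandardForm.neighbours_chainTable i).2.2.2.2
  simp only [newCodeList, List.mem_append, List.mem_flatMap, List.mem_map,
    List.mem_finRange, true_and, List.mem_cons, List.not_mem_nil, or_false]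
  rintro a ((rfl | rfl | rfl) | ⟨k, e, he, rfl⟩)
  · exact hc 1
  · exact hc 2
  · exact hc 3
  · exact (StandardForm.neighbours_neighbourTable k e he).2.2.2.2

/-- Equal enumerators give equal parameters, and no pair of parameters occurs twice in the list.
Thus the codes are told apart without being compared. -/
theorem eq_of_weightEnumerator_eq {a b : BinaryCode 68 × ℤ × ℤ} (ha : a ∈ newCodeList)
    (hb : b ∈ newCodeList) (h : weightEnumerator a.1 = weightEnumerator b.1) : a = b := by
  rw [weightEnumerator_newCodeList a ha, weightEnumerator_newCodeList b hb] at h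
  obtain ⟨h1, h2⟩ := W682_injective h
  exact List.inj_on_of_nodup_map (map_snd_newCodeList ▸ nodup_newParams) ha hb (Prod.ext h1 h2)

theorem weightEnumerator_injOn : Set.InjOn weightEnumerator newCodes := by
  intro D hD D' hD' h
  obtain ⟨a, ha, rfl⟩ := mem_newCodes.1 hD
  obtain ⟨b, hb, rfl⟩ := mem_newCodes.1 hD'
  rw [eq_of_weightEnumerator_eq ha hb h]

theorem ncard_newCodes_filter (p : ℤ × ℤ → Bool) :
    {D | ∃ a ∈ newCodeList, p a.2 ∧ a.1 = D}.ncard = (newParams.filter p).length := by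
  classical
  have h1 : {D | ∃ a ∈ newCodeList, p a.2 ∧ a.1 = D} =
      Prod.fst '' ((newCodeList.filter fun a => p a.2).toFinset : Set (BinaryCode 68 × ℤ × ℤ)) := by
    ext D
    simp only [Set.mem_ofPred_eq, Set.mem_image, List.coe_toFinset, List.mem_filter, and_assoc]
  rw [h1, Set.InjOn.ncard_image, Set.ncard_coe_finset, List.toFinset_card_of_nodup,
    ← map_snd_newCodeList, List.filter_map, List.length_map]
  · rfl
  · have h2 : (newCodeList.map Prod.snd).Nodup := map_snd_newCodeList ▸ nodup_newParams
    exact h2.of_map.filter _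
  · intro a ha b hb h
    simp only [List.coe_toFinset, List.mem_filter, Set.mem_ofPred_eq] at ha hb
    exact eq_of_weightEnumerator_eq ha.1 hb.1 (congrArg _ h)

theorem ncard_newCodes : newCodes.ncard = 143 := by
  have h := ncard_newCodes_filter fun _ => true
  rw [List.filter_true, length_newParams] at h
  rw [← h]
  congr 1
  ext D
  simp only [mem_newCodes, Set.mem_ofPred_eq, true_and]

theorem exists_newCodes_iff (β γ : ℤ) :
    (∃ D ∈ newCodes, weightEnumerator D = W682 β γ) ↔ (β, γ) ∈ newParams := by
  rw [← map_snd_newCodeList, List.mem_map]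
  constructor
  · rintro ⟨D, hD, h⟩
    obtain ⟨a, ha, rfl⟩ := mem_newCodes.1 hD
    rw [weightEnumerator_newCodeList a ha] at h
    exact ⟨a, ha, Prod.ext (W682_injective h).1 (W682_injective h).2⟩
  · rintro ⟨a, ha, h⟩
    refine ⟨a.1, mem_newCodes.2 ⟨a, ha, rfl⟩, ?_⟩
    rw [weightEnumerator_newCodeList a ha, h]

theorem mem_newParams_iff (β γ : ℤ) : (β, γ) ∈ newParams ↔ β ∈ newBetas γ := by
  constructor
  · have h : ∀ p ∈ newParams, p.1 ∈ newBetas p.2 := by decide +kernel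
    exact h (β, γ)
  · rw [newBetas]
    split_ifs with h5 h6 h7 h8 h9
    · subst h5; revert β; decide +kernel
    · subst h6; revert β; decide +kernel
    · subst h7; revert β; decide +kernel
    · subst h8; revert β; decide +kernel
    · subst h9; revert β; decide +kernel
    · exact fun h => absurd h (Finset.notMem_empty β)

theorem ncard_newCodes_gamma (γ : ℤ) :
    {D ∈ newCodes | ∃ β : ℤ, weightEnumerator D = W682 β γ}.ncard =
      (newParams.filter fun p => p.2 == γ).length := by
  rw [← ncard_newCodes_filter]
  congr 1
  ext D
  simp only [Set.mem_ofPred_eq, mem_newCodes, beq_iff_eq]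
  constructor
  · rintro ⟨⟨a, ha, rfl⟩, β, h⟩
    rw [weightEnumerator_newCodeList a ha] at h
    exact ⟨a, ha, (W682_injective h).2, rfl⟩
  · rintro ⟨a, ha, rfl, rfl⟩
    exact ⟨⟨a, ha, rfl⟩, a.2.1, weightEnumerator_newCodeList a ha⟩

-- The upper bound is the count of weight-6 shadow vectors. The values are attained by the
-- four-circulant code (0), one of its neighbours (1), three neighbours of `𝒩₍₀₎` (2, 3, 4), `𝒩₍₀₎`
-- itself (5) and its iterated neighbours (6 to 9).
open StandardForm in
theorem exists_extremal_iff (γ : ℤ) :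
    (∃ (D : BinaryCode 68) (β : ℤ), IsExtremal D ∧ HasParameters D 34 12 ∧
      weightEnumerator D = W682 β γ) ↔ γ ∈ Set.Icc 0 9 := by
  constructor
  · rintro ⟨D, β, hE, hP, hW⟩
    have h1 := weightCountOn_shadow_six hE.1 hP.2 hW
    have h2 := weightCountOn_shadow_six_lt hE.1 hP.2
    rw [Set.mem_Icc]
    omega
  · rintro ⟨h0, h9⟩
    have hN : ∀ {D : BinaryCode 68} {x : Fin 68 → ZMod 2} (e : TableEntry) {γ : ℤ},
        NeighbourHolds D x e.beta e.gamma → e.gamma = γ →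
        ∃ (D : BinaryCode 68) (β : ℤ), IsExtremal D ∧ HasParameters D 34 12 ∧
          weightEnumerator D = W682 β γ := by
      rintro D x e _ h rfl
      exact ⟨_, _, h.2.2⟩
    have hs : ∀ e ∈ smallGammaTable, ∀ {γ : ℤ}, e.gamma = γ →
        ∃ (D : BinaryCode 68) (β : ℤ), IsExtremal D ∧ HasParameters D 34 12 ∧
          weightEnumerator D = W682 β γ := fun e he =>
      hN e (neighbours_chain0 e (List.mem_append_left _ (List.mem_cons_of_mem _ he)))
    interval_cases γ
    · exact ⟨fourCirculant.code, 136, holds_fourCirculant⟩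
    · exact hN _ (neighbours_fourCirculant _ List.mem_cons_self) rfl
    · exact hs _ List.mem_cons_self rfl
    · exact hs _ (List.mem_cons_of_mem _ List.mem_cons_self) rfl
    · exact hs _ (List.mem_cons_of_mem _ (List.mem_cons_of_mem _ List.mem_cons_self)) rfl
    · exact ⟨chain0.code, 213, holds_chain0⟩
    · exact hN _ (neighbours_chainTable 0) rfl
    · exact hN _ (neighbours_chainTable 1) rfl
    · exact hN _ (neighbours_chainTable 2) rfl
    · exact hN _ (neighbours_chainTable 3) rfl

open BinaryCode in
theorem mainTheorem1 :
    -- the known code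
    (IsExtremal knownCode ∧ HasParameters knownCode 34 12 ∧
      weightEnumerator knownCode = W682 213 5) ∧
    -- its iterated neighbours
    (∀ i : Fin 4,
      searchVector i (chainTable i).bits ∉ chainCode i ∧
      AreNeighbours (chainCode i) (chainCode (i + 1)) ∧
      IsExtremal (chainCode (i + 1)) ∧ HasParameters (chainCode (i + 1)) 34 12 ∧
      weightEnumerator (chainCode (i + 1)) =
        W682 (chainTable i).beta (chainTable i).gamma) ∧
    -- the tables of neighbours of the iterated neighbours
    (∀ k : Fin 5, ∀ e ∈ neighbourTable k,
      searchVector k e.bits ∉ chainCode k ∧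
      AreNeighbours (chainCode k) (tableCode k e) ∧
      IsExtremal (tableCode k e) ∧ HasParameters (tableCode k e) 34 12 ∧
      weightEnumerator (tableCode k e) = W682 e.beta e.gamma) ∧
    -- there are 143 new codes, with 143 different weight enumerators
    newCodes.ncard = 143 ∧
    (weightEnumerator '' newCodes).ncard = 143 ∧
    -- the parameters that occur
    (∀ D ∈ newCodes, ∃ β γ : ℤ, weightEnumerator D = W682 β γ) ∧
    (∀ β γ : ℤ, (∃ D ∈ newCodes, weightEnumerator D = W682 β γ) ↔ β ∈ newBetas γ) ∧
    -- 42 of the new codes have `γ = 8`, and 40 have `γ = 9`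
    {D ∈ newCodes | ∃ β : ℤ, weightEnumerator D = W682 β 8}.ncard = 42 ∧
    {D ∈ newCodes | ∃ β : ℤ, weightEnumerator D = W682 β 9}.ncard = 40 ∧
    -- the possible values of `γ` are exactly `0, …, 9`
    {γ : ℤ | ∃ (D : BinaryCode 68) (β : ℤ), IsExtremal D ∧ HasParameters D 34 12 ∧
      weightEnumerator D = W682 β γ} = Set.Icc 0 9 := by

  refine ⟨?_, fun i => ?_, fun k e he => StandardForm.neighbours_neighbourTable k e he,
    ncard_newCodes, ?_, ?_, fun β γ => (exists_newCodes_iff β γ).trans (mem_newParams_iff β γ),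
    ?_, ?_, Set.ext exists_extremal_iff⟩
  · rw [StandardForm.knownCode_eq]
    exact StandardForm.holds_chain0
  · rw [StandardForm.chainCode_succ]
    exact StandardForm.neighbours_chainTable i
  · rw [weightEnumerator_injOn.ncard_image, ncard_newCodes]
  · intro D hD
    obtain ⟨a, ha, rfl⟩ := mem_newCodes.1 hD
    exact ⟨_, _, weightEnumerator_newCodeList a ha⟩
  · rw [ncard_newCodes_gamma]
    decide +kernel
  · rw [ncard_newCodes_gamma]
    decide +kernel
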